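/- Let $k$ be an algebraically closed field of characteristic $0$, let $1\le m<n$ be coprime integers, let $\alpha\in k$, $\alpha\neq 0$, and let $C\subset\mathbb P^2$ be the curve $F=0$, $F=x^n-\alpha y^mz^{n-m}$. Let $\mathbb P^8$ be the projective space of $3\times3$ matrices over $k$, let $\mathbb P^N$, $N=n(n+3)/2$, be the space of plane curves of degree $n$, and let $c:\mathbb P^8\dashrightarrow\mathbb P^N$ be the rational map sending a matrix $\varphi$ to the curve with equation $F(\varphi(x:y:z))=0$. **Directed blow-ups.** For nonsingular $B\subset P\subset V$ and $\ell\ge1$, the $\ell$-directed blow-up of $V$ along $B$ in the direction of $P$ is the following sequence of $\ell$ blow-ups: first blow up $V$ along $B$; then, $\ell-1$ times, blow up along the intersection of the latest exceptional divisor with the proper transform of $P$. Its exceptional divisor is the last one produced; its distinguished subvariety is the intersection of this divisor with the proper transform of $P$. **Local blow-ups.** Let $V\to\mathbb P^8$ be an isomorphism over a neighbourhood of $B$, where $B$ is the set of matrices with image the point $p=(0:0:1)$ (resp. $\bar p=(0:1:0)$), and let $P$ be the set of matrices with image contained in the line $y=0$ (resp. $z=0$); identify $B$ and $P$ with their inverse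 images in $V$. Put $m_1=m$ (resp. $m_1=n-m$) and let $$n=m_1\ell_1+m_2,\quad m_1=m_2\ell_2+m_3,\quad\dots,\quad m_{e-1}=m_e\ell_e$$ be the Euclidean algorithm. The local blow-ups of $V$ over $p$ (resp. $\bar p$) are: the $\ell_1$-directed blow-up of $V$ along $B$ in the direction of $P$, with exceptional divisor $E_1$ and distinguished subvariety $B_1$; then, for $i=2,\dots,e$, the $\ell_i$-directed blow-up along $B_{i-1}$ in the direction of $E_{i-1}$, with exceptional divisor $E_i$ and distinguished subvariety $B_i$. **Theorem.** 1. Let $\pi:\widetilde V^{\mathrm{loc}}\to\mathbb P^8$ be the result of the local blow-ups of $\mathbb P^8$ over one of the two points $p,\bar p$, and let $U\subset\widetilde V^{\mathrm{loc}}$ be the inverse image of the complement of the set of matrices whose image is the other point. Then two blow-ups at smooth centers, the first one a closed subscheme of $U$ of dimension $3$, the second one a closed subscheme of the resulting variety of dimension $4$, remove the indeterminacies of the lifted map $c\circ\pi:U\dashrightarrow\mathbb P^N$: after them, the lift of $c$ is a morphism to $\mathbb P^N$. 2. Let $\pi:\widetilde V\to\mathbb P^8$ be the result of the local blow-ups of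 $\mathbb P^8$ over $p$ followed by the local blow-ups over $\bar p$. Then two blow-ups at smooth centers, of dimensions $3$ and $4$, remove the indeterminacies of the lifted map $c\circ\pi:\widetilde V\dashrightarrow\mathbb P^N$. -/

import Mathlib

open CategoryTheory AlgebraicGeometry TopologicalSpace

universe u

namespace LinearOrbit

attribute [local instance] MvPolynomial.gradedAlgebra

noncomputable section

/-! ## Blow-ups -/

/-- The closed subscheme cut out by `I` is an effective Cartier divisor: locally `I` is generated
by one non-zero-divisor. -/
def IsCartier {X : Scheme.{u}} (I : X.IdealSheafData) : Prop :=
  ∀ x : X, ∃ U : X.affineOpens, x ∈ U.1 ∧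
    ∃ a ∈ nonZeroDivisors Γ(X, U.1), I.ideal U = Ideal.span {a}

/-- `ρ : W ⟶ V` is the blow-up of `V` along the closed subscheme cut out by `I`, characterised by
its universal property (so it is determined up to a unique isomorphism over `V`). -/
structure IsBlowup {V W : Scheme.{u}} (I : V.IdealSheafData) (ρ : W ⟶ V) : Prop where
  isCartier : IsCartier (I.comap ρ)
  existsUnique_lift : ∀ {T : Scheme.{u}} (t : T ⟶ V), IsCartier (I.comap t) →
    ∃! s : T ⟶ W, s ≫ ρ = t

/-- The proper transform, under a morphism `ρ : W ⟶ V` (a blow-up along `C`), of the closed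
subscheme cut out by `I`: the scheme-theoretic closure in `W` of the inverse image of the part of
that subscheme lying outside of the center `C`. -/
def properTransform {V W : Scheme.{u}} (C : V.IdealSheafData) (ρ : W ⟶ V)
    (I : V.IdealSheafData) : W.IdealSheafData :=
  (I.comap ((ρ ⁻¹ᵁ C.support.compl).ι ≫ ρ)).map (ρ ⁻¹ᵁ C.support.compl).ι

/-- `IsDirectedBlowup B P ℓ π E Q` says that `π : W ⟶ V` is the `ℓ`-directed blow-up of `V` along
`B` in the direction of `P`, that `E` is (the ideal of) its exceptional divisor, i.e. the last
exceptional divisor produced, and that `Q` is (the ideal of) the proper transform of `P` in `W`.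
The intersection of the two subschemes has ideal `E ⊔ Q`. -/
inductive IsDirectedBlowup {V : Scheme.{u}} (B P : V.IdealSheafData) :
    ℕ → ∀ {W : Scheme.{u}}, (W ⟶ V) → W.IdealSheafData → W.IdealSheafData → Prop
  | one {W : Scheme.{u}} (ρ : W ⟶ V) (hρ : IsBlowup B ρ) :
      IsDirectedBlowup B P 1 ρ (B.comap ρ) (properTransform B ρ P)
  | succ {ℓ : ℕ} {W W' : Scheme.{u}} {π : W ⟶ V} {E Q : W.IdealSheafData}
      (h : IsDirectedBlowup B P ℓ π E Q) (ρ : W' ⟶ W) (hρ : IsBlowup (E ⊔ Q) ρ) :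
      IsDirectedBlowup B P (ℓ + 1) (ρ ≫ π) ((E ⊔ Q).comap ρ) (properTransform (E ⊔ Q) ρ Q)

/-- `IsEuclideanBlowup n m B P π` says that `π : W ⟶ V` is the composition of the sequence of
directed blow-ups prescribed by the Euclidean algorithm
`n = m ℓ₁ + m₂`, `m = m₂ ℓ₂ + m₃`, …, `m_{e-1} = m_e ℓ_e`:
first the `ℓ₁`-directed blow-up along `B` in the direction of `P`; then, successively, the
`ℓᵢ`-directed blow-up along the distinguished subvariety of the previous directed blow-up (the
intersection of its exceptional divisor with the proper transform of the subvariety giving its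
direction), in the direction of the exceptional divisor of the previous directed blow-up. -/
inductive IsEuclideanBlowup : ℕ → ℕ → ∀ {V : Scheme.{u}}, V.IdealSheafData → V.IdealSheafData →
    ∀ {W : Scheme.{u}}, (W ⟶ V) → Prop
  | last {n m : ℕ} {V W : Scheme.{u}} {B P : V.IdealSheafData} {π : W ⟶ V}
      {E Q : W.IdealSheafData} (hr : n % m = 0) (h : IsDirectedBlowup B P (n / m) π E Q) :
      IsEuclideanBlowup n m B P π
  | step {n m : ℕ} {V V' W : Scheme.{u}} {B P : V.IdealSheafData} {π : V' ⟶ V}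
      {E Q : V'.IdealSheafData} {σ : W ⟶ V'} (hr : n % m ≠ 0)
      (h : IsDirectedBlowup B P (n / m) π E Q)
      (hσ : IsEuclideanBlowup m (n % m) (E ⊔ Q) E σ) :
      IsEuclideanBlowup n m B P (σ ≫ π)

/-! ## The projective space of `3 × 3` matrices and the rational map given by a plane curve -/

variable (k : Type u) [Field k]

/-- The projective space over `k` with homogeneous coordinates indexed by `ι`. -/
abbrev ProjectiveSpace (ι : Type) : Scheme.{u} :=
  Proj (MvPolynomial.homogeneousSubmodule ι k)

/-- The structure morphism of projective space. -/
def ProjectiveSpace.structureMap (ι : Type) :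
    ProjectiveSpace k ι ⟶ Spec (CommRingCat.of k) :=
  Proj.toSpecZero (MvPolynomial.homogeneousSubmodule ι k) ≫
    Spec.map (CommRingCat.ofHom (algebraMap k (MvPolynomial.homogeneousSubmodule ι k 0)))

/-- The `ℙ⁸` of `3 × 3` matrices; the variable `(i, j)` is the entry in row `i`, column `j`. -/
abbrev MatrixSpace : Scheme.{u} := ProjectiveSpace k (Fin 3 × Fin 3)

/-- The (reduced) linear subspace of `ℙ⁸` formed by the matrices whose rows with index in `s`
vanish, i.e. whose image lies in the linear subspace of `ℙ²` where the coordinates with index in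
`s` vanish. -/
def vanishingRows (s : Set (Fin 3)) : (MatrixSpace k).IdealSheafData :=
  Scheme.IdealSheafData.vanishingIdeal
    ⟨ProjectiveSpectrum.zeroLocus (MvPolynomial.homogeneousSubmodule (Fin 3 × Fin 3) k)
      {f | ∃ i ∈ s, ∃ j, f = MvPolynomial.X (i, j)},
      ProjectiveSpectrum.isClosed_zeroLocus _ _⟩

/-- The exponents of the monomials of degree `d` in three variables: they index the coordinates
of the `ℙᴺ`, `N = d(d+3)/2`, parametrizing plane curves of degree `d`. -/
abbrev Exponent (d : ℕ) : Type := {a : Fin 3 →₀ ℕ // a.degree = d}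

/-- The projective space parametrizing plane curves of degree `d`. -/
abbrev CurveSpace (d : ℕ) : Scheme.{u} := ProjectiveSpace k (Exponent d)

variable {k}

/-- The form `F(φ(x:y:z))`, where `φ` is the generic `3 × 3` matrix. -/
def composeMatrix (F : MvPolynomial (Fin 3) k) :
    MvPolynomial (Fin 3) (MvPolynomial (Fin 3 × Fin 3) k) :=
  MvPolynomial.aeval
    (fun i ↦ ∑ j, MvPolynomial.C (MvPolynomial.X (i, j)) * MvPolynomial.X j) F

/-- The coefficient of the monomial with exponent `a` in `F(φ(x:y:z))`, as a polynomial in the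
entries of `φ`. -/
def orbitCoeff (F : MvPolynomial (Fin 3) k) (a : Fin 3 →₀ ℕ) :
    MvPolynomial (Fin 3 × Fin 3) k :=
  (composeMatrix F).coeff a

lemma coeff_mul_isHomogeneous {G H : MvPolynomial (Fin 3) (MvPolynomial (Fin 3 × Fin 3) k)}
    {d e : ℕ} (hG : ∀ a, (G.coeff a).IsHomogeneous d) (hH : ∀ a, (H.coeff a).IsHomogeneous e)
    (a : Fin 3 →₀ ℕ) : ((G * H).coeff a).IsHomogeneous (d + e) := by
  rw [MvPolynomial.coeff_mul]
  exact MvPolynomial.IsHomogeneous.sum _ _ _ fun x _ ↦ (hG x.1).mul (hH x.2)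

lemma coeff_one_isHomogeneous (a : Fin 3 →₀ ℕ) :
    ((1 : MvPolynomial (Fin 3) (MvPolynomial (Fin 3 × Fin 3) k)).coeff a).IsHomogeneous 0 := by
  rw [MvPolynomial.coeff_one]
  split_ifs
  · exact MvPolynomial.isHomogeneous_one _ _
  · exact MvPolynomial.isHomogeneous_zero _ _ _

lemma coeff_pow_isHomogeneous {G : MvPolynomial (Fin 3) (MvPolynomial (Fin 3 × Fin 3) k)}
    (hG : ∀ a, (G.coeff a).IsHomogeneous 1) (e : ℕ) (a : Fin 3 →₀ ℕ) :
    ((G ^ e).coeff a).IsHomogeneous e := by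
  induction e generalizing a with
  | zero => simpa using coeff_one_isHomogeneous a
  | succ e ih => rw [pow_succ]; exact coeff_mul_isHomogeneous ih hG a

lemma coeff_row_isHomogeneous (i : Fin 3) (a : Fin 3 →₀ ℕ) :
    ((∑ j, MvPolynomial.C (MvPolynomial.X (i, j)) * MvPolynomial.X j :
      MvPolynomial (Fin 3) (MvPolynomial (Fin 3 × Fin 3) k)).coeff a).IsHomogeneous 1 := by
  rw [MvPolynomial.coeff_sum]
  refine MvPolynomial.IsHomogeneous.sum _ _ _ fun j _ ↦ ?_
  rw [MvPolynomial.coeff_C_mul, MvPolynomial.coeff_X]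
  split_ifs
  · simpa using MvPolynomial.isHomogeneous_X k (i, j)
  · simpa using MvPolynomial.isHomogeneous_zero _ k 1

lemma orbitCoeff_mem {F : MvPolynomial (Fin 3) k} {d : ℕ} (hF : F.IsHomogeneous d)
    (a : Fin 3 →₀ ℕ) :
    orbitCoeff F a ∈ MvPolynomial.homogeneousSubmodule (Fin 3 × Fin 3) k d := by
  rw [MvPolynomial.mem_homogeneousSubmodule, orbitCoeff, composeMatrix, MvPolynomial.aeval_def,
    MvPolynomial.eval₂_eq', MvPolynomial.coeff_sum]
  refine MvPolynomial.IsHomogeneous.sum _ _ _ fun b hb ↦ ?_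
  have hd : b 0 + b 1 + b 2 = d := by
    have h : b.degree = d := by
      rw [Finsupp.degree_eq_weight_one]
      exact hF (MvPolynomial.mem_support_iff.mp hb)
    rwa [Finsupp.degree_eq_sum, Fin.sum_univ_three] at h
  rw [MvPolynomial.algebraMap_apply, MvPolynomial.algebraMap_eq, MvPolynomial.coeff_C_mul,
    Fin.prod_univ_three, ← zero_add d, ← hd]
  refine (MvPolynomial.isHomogeneous_C _ _).mul ?_
  exact coeff_mul_isHomogeneous (coeff_mul_isHomogeneous
    (coeff_pow_isHomogeneous (coeff_row_isHomogeneous 0) _)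
    (coeff_pow_isHomogeneous (coeff_row_isHomogeneous 1) _))
    (coeff_pow_isHomogeneous (coeff_row_isHomogeneous 2) _) a

/-- The open subset of `ℙ⁸` where the coefficient with exponent `a` of `F(φ(x:y:z))` does not
vanish. The union of these subsets is the complement of the base locus. -/
abbrev orbitOpen (F : MvPolynomial (Fin 3) k) (a : Fin 3 →₀ ℕ) : (MatrixSpace k).Opens :=
  Proj.basicOpen (MvPolynomial.homogeneousSubmodule (Fin 3 × Fin 3) k) (orbitCoeff F a)

/-- Homogeneous fractions of degree zero, with denominator a power of the coefficient with exponent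
`a` of `F(φ(x:y:z))`, are regular functions on the open subset where it does not vanish. -/
def awayToOrbitOpen (F : MvPolynomial (Fin 3) k) (a : Fin 3 →₀ ℕ) :
    HomogeneousLocalization.Away (MvPolynomial.homogeneousSubmodule (Fin 3 × Fin 3) k)
      (orbitCoeff F a) →+* Γ((orbitOpen F a).toScheme, ⊤) :=
  (Proj.awayToSection (MvPolynomial.homogeneousSubmodule (Fin 3 × Fin 3) k)
    (orbitCoeff F a) ≫ (orbitOpen F a).topIso.inv).hom

/-- The quotient of the coefficients with exponents `b` and `a` of `F(φ(x:y:z))`, as a regular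
function on the open subset where the second one does not vanish. -/
def orbitRatio {F : MvPolynomial (Fin 3) k} {d : ℕ} (hF : F.IsHomogeneous d)
    (a b : Fin 3 →₀ ℕ) : Γ((orbitOpen F a).toScheme, ⊤) :=
  awayToOrbitOpen F a (HomogeneousLocalization.Away.mk _ (orbitCoeff_mem hF a) 1 (orbitCoeff F b)
    (by simpa using orbitCoeff_mem hF b))

/-- The `k`-algebra homomorphism sending the homogeneous coordinate with index `b` of the space of
plane curves of degree `d` to the quotient of the coefficients with exponents `b` and `a` of
`F(φ(x:y:z))`. -/
def orbitRatioHom {F : MvPolynomial (Fin 3) k} {d : ℕ} (hF : F.IsHomogeneous d)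
    (a : Fin 3 →₀ ℕ) : MvPolynomial (Exponent d) k →+* Γ((orbitOpen F a).toScheme, ⊤) :=
  MvPolynomial.eval₂Hom
    ((awayToOrbitOpen F a).comp ((HomogeneousLocalization.fromZeroRingHom
      (MvPolynomial.homogeneousSubmodule (Fin 3 × Fin 3) k) _).comp
      (algebraMap k (MvPolynomial.homogeneousSubmodule (Fin 3 × Fin 3) k 0))))
    (fun b ↦ orbitRatio hF a b.1)

lemma orbitRatio_self {F : MvPolynomial (Fin 3) k} {d : ℕ} (hF : F.IsHomogeneous d)
    (a : Fin 3 →₀ ℕ) : orbitRatio hF a a = 1 := by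
  have : HomogeneousLocalization.Away.mk (MvPolynomial.homogeneousSubmodule (Fin 3 × Fin 3) k)
      (orbitCoeff_mem hF a) 1 (orbitCoeff F a) (by simpa using orbitCoeff_mem hF a) = 1 := by
    ext
    simp [HomogeneousLocalization.Away.val_mk]
  rw [orbitRatio, this, map_one]

lemma map_irrelevant_orbitRatioHom {F : MvPolynomial (Fin 3) k} {d : ℕ} (hF : F.IsHomogeneous d)
    (a : Exponent d) :
    (HomogeneousIdeal.irrelevant (MvPolynomial.homogeneousSubmodule (Exponent d) k)).toIdeal.map
      (orbitRatioHom hF a.1) = ⊤ := by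
  rw [Ideal.eq_top_iff_one]
  have h : orbitRatioHom hF a.1 (MvPolynomial.X a) = 1 := by
    simp [orbitRatioHom, orbitRatio_self]
  rw [← h]
  refine Ideal.mem_map_of_mem _ ?_
  exact HomogeneousIdeal.mem_irrelevant_of_mem _ one_pos (MvPolynomial.isHomogeneous_X k a)

/-- The rational map `c : ℙ⁸ ⇢ ℙᴺ` given by the plane curve `F = 0` of degree `d` sends a matrix
`φ` to the curve with equation `F(φ(x:y:z)) = 0`. This is its restriction to the open subset
where the coefficient with exponent `a` of `F(φ(x:y:z))` does not vanish. -/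
def orbitMap {F : MvPolynomial (Fin 3) k} {d : ℕ} (hF : F.IsHomogeneous d) (a : Exponent d) :
    (orbitOpen F a.1).toScheme ⟶ CurveSpace k d :=
  Proj.fromOfGlobalSections (MvPolynomial.homogeneousSubmodule (Exponent d) k)
    (orbitRatioHom hF a.1) (map_irrelevant_orbitRatioHom hF a)

/-- The morphism `f : W ⟶ ℙᴺ` coincides with `c ∘ π` wherever `c` is defined: the rational map
`c ∘ π : W ⇢ ℙᴺ` is (everywhere) regular, and equal to `f`. -/
def IsRegularLift {F : MvPolynomial (Fin 3) k} {d : ℕ} (hF : F.IsHomogeneous d) {W : Scheme.{u}}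
    (π : W ⟶ MatrixSpace k) (f : W ⟶ CurveSpace k d) : Prop :=
  ∀ a : Exponent d,
    (π ⁻¹ᵁ orbitOpen F a.1).ι ≫ f = (π ∣_ orbitOpen F a.1) ≫ orbitMap hF a

/-- Two blow-ups at smooth centers, of dimension `3` and `4`, remove the indeterminacies of the
lifted rational map `c ∘ π : V ⇢ ℙᴺ`. -/
def TwoBlowupsResolve {F : MvPolynomial (Fin 3) k} {d : ℕ} (hF : F.IsHomogeneous d)
    {V : Scheme.{u}} (π : V ⟶ MatrixSpace k) : Prop :=
  ∃ Z₁ : V.IdealSheafData,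
    SmoothOfRelativeDimension 3 (Z₁.subschemeι ≫ π ≫ ProjectiveSpace.structureMap k _) ∧
    ∀ {V₁ : Scheme.{u}} (ρ₁ : V₁ ⟶ V), IsBlowup Z₁ ρ₁ →
      ∃ Z₂ : V₁.IdealSheafData,
        SmoothOfRelativeDimension 4
          (Z₂.subschemeι ≫ ρ₁ ≫ π ≫ ProjectiveSpace.structureMap k _) ∧
        ∀ {V₂ : Scheme.{u}} (ρ₂ : V₂ ⟶ V₁), IsBlowup Z₂ ρ₂ →
          ∃ f : V₂ ⟶ CurveSpace k d, IsRegularLift hF (ρ₂ ≫ ρ₁ ≫ π) f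

/-- The form `x ^ n - α y ^ m z ^ (n - m)`. -/
def cuspidalForm (n m : ℕ) (α : k) : MvPolynomial (Fin 3) k :=
  MvPolynomial.X 0 ^ n -
    MvPolynomial.C α * MvPolynomial.X 1 ^ m * MvPolynomial.X 2 ^ (n - m)

lemma cuspidalForm_isHomogeneous {n m : ℕ} (h : m < n) (α : k) :
    (cuspidalForm n m α).IsHomogeneous n := by
  refine (MvPolynomial.isHomogeneous_X_pow 0 n).sub ?_
  have := ((MvPolynomial.isHomogeneous_C (Fin 3) α).mul
    (MvPolynomial.isHomogeneous_X_pow 1 m)).mul (MvPolynomial.isHomogeneous_X_pow 2 (n - m))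
  rwa [zero_add, Nat.add_sub_cancel' h.le] at this

end

end LinearOrbit

/-! Let f, g₁, g₂ be the linear forms given by the rows of φ; the translated curve is f^n = α g₁^m
g₂^(n-m). Let `b` be the ideal sheaf on ℙ⁸ generated by the coefficients of this form
(`exists_isBaseIdeal`). Once the pull-back of `b` is invertible, the lift of c is regular: dividing
the coefficients by a local generator gives local lifts, and these glue because they agree off a
Cartier divisor (`exists_isRegularLift`, `IsRegularLift.unique`). So the task is to make `b`
invertible.

Near a matrix whose image is one of the two points, one of g₁, g₂ does not vanish. Normalize one of
its entries to 1, add multiples of it to the other two rows and use it as a coordinate x of the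
plane: the equation becomes f^n = α g^M x^(n-M), where the six coefficients of f and g are free
coordinates of an affine 8-space (`coeffIdeal_matrixCoord`). There B is f = g = 0 and P is g = 0. If
g₁ or g₂ vanishes but f does not, the form reduces to f^n ≠ 0 and `b` is trivial.

In suitable affine charts all centers of the local blow-ups are coordinate subspaces, so f and g are
replaced by monomials times linear forms whose coefficients are variables, some of them replaced by
1 (`ToricChart`). Compare the monomial factor of f^n with that of g^M. The differences of their
exponents start as (n, -M), and each blow-up adds one difference to the other: the directed blow-ups
carry out the subtractions of the Euclidean algorithm. At the end the differences have a common weak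
sign in every chart, so one monomial divides the other, and the linear form with the smaller
monomial has a coefficient 1 (`IsEuclideanBlowup.exists_chart`).

Divide by the smaller monomial; say f keeps the coefficient 1, so that the equation is f^n = α ν g^M
x^(n-M) with ν a monomial. If the coefficient 1 is not that of x, there are no base points.
Otherwise, in characteristic zero, comparing derivatives up to order two at (1:0:0) shows that the
equation holds over a ring iff ν g₀^M = 1/α, g_i = (n/M) g₀ f_i and f_i f_j = 0 for i, j ≠ 0
(`linForm_pow_eq_iff`). When it is not the unit ideal, an automorphism of the chart turns the ideal
into `residualIdeal`, generated by a torus equation X_a^p X_b^q - γ, two variables w, and the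
products of two more variables y.

The reduced subscheme of the residual ideal is smooth of dimension 8 - 5 = 3. After blowing it up,
the ideal is principal except in the charts where some y generates the exceptional divisor. There it
is y · (y, w/y, t) with y t equal to the torus equation, and the second factor defines a smooth
center of dimension 4; blowing this up makes the ideal invertible (`isCartier_after_two_blowups`).
Both centers are intrinsic, being the reduced loci where the ideal is not invertible
(`nonCartierIdeal`), so the local descriptions need no gluing. -/

namespace LinearOrbit

attribute [local instance] MvPolynomial.gradedAlgebra

noncomputable section

open Scheme.IdealSheafData Limits

/-! ## Ideal sheaves on affine schemes -/

/-- The ideal sheaf on `Spec R` defined by an ideal of `R`. -/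
def idl {R : CommRingCat.{u}} (I : Ideal R) : (Spec R).IdealSheafData :=
  ofIdealTop (I.map (Scheme.ΓSpecIso R).inv.hom)

lemma map_ΓSpecIso_inv_eq_comap {R : CommRingCat.{u}} (I : Ideal R) :
    I.map (Scheme.ΓSpecIso R).inv.hom = I.comap (Scheme.ΓSpecIso R).hom.hom :=
  Ideal.map_comap_of_equiv (Scheme.ΓSpecIso R).symm.commRingCatIsoToRingEquiv

lemma idl_ideal_top {R : CommRingCat.{u}} (I : Ideal R) :
    (idl I).ideal ⟨⊤, isAffineOpen_top _⟩ = I.comap (Scheme.ΓSpecIso R).hom.hom := by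
  rw [← map_ΓSpecIso_inv_eq_comap]
  simp [idl]

lemma comap_ΓSpecIso_hom_le_iff {R : CommRingCat.{u}} {I J : Ideal R} :
    I.comap (Scheme.ΓSpecIso R).hom.hom ≤ J.comap (Scheme.ΓSpecIso R).hom.hom ↔ I ≤ J :=
  Ideal.comap_le_comap_iff_of_surjective _
    (Scheme.ΓSpecIso R).commRingCatIsoToRingEquiv.surjective _ _

lemma idl_le_idl {R : CommRingCat.{u}} {I J : Ideal R} : idl I ≤ idl J ↔ I ≤ J := by
  rw [← comap_ΓSpecIso_hom_le_iff, ← idl_ideal_top, ← idl_ideal_top]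
  exact ⟨fun h ↦ h _, le_of_isAffine⟩

lemma idl_injective {R : CommRingCat.{u}} : Function.Injective (idl (R := R)) :=
  fun _ _ h ↦ le_antisymm (idl_le_idl.mp h.le) (idl_le_idl.mp h.ge)

lemma idl_surjective {R : CommRingCat.{u}} : Function.Surjective (idl (R := R)) := by
  intro J
  refine ⟨(J.ideal ⟨⊤, isAffineOpen_top _⟩).comap (Scheme.ΓSpecIso R).inv.hom, ?_⟩
  apply Scheme.IdealSheafData.ext_of_isAffine
  rw [idl_ideal_top, Ideal.comap_comap, ← CommRingCat.hom_comp]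
  simp

/-- The ideals of `R` are the ideal sheaves on `Spec R`. -/
def idlIso (R : CommRingCat.{u}) : Ideal R ≃o (Spec R).IdealSheafData where
  toEquiv := Equiv.ofBijective idl ⟨idl_injective, idl_surjective⟩
  map_rel_iff' := idl_le_idl

lemma idl_top {R : CommRingCat.{u}} : idl (⊤ : Ideal R) = ⊤ := (idlIso R).map_top

lemma idl_eq_top {R : CommRingCat.{u}} {I : Ideal R} : idl I = ⊤ ↔ I = ⊤ := by
  rw [← idl_top]; exact idl_injective.eq_iff

lemma idl_sup {R : CommRingCat.{u}} (I J : Ideal R) : idl (I ⊔ J) = idl I ⊔ idl J :=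
  (idlIso R).map_sup _ _

lemma map_idl {R S : CommRingCat.{u}} (φ : R ⟶ S) (I : Ideal S) :
    (idl I).map (Spec.map φ) = idl (I.comap φ.hom) := by
  apply Scheme.IdealSheafData.ext_of_isAffine
  rw [ideal_map_of_isAffineHom, idl_ideal_top]
  change ((idl I).ideal ⟨⊤, isAffineOpen_top _⟩).comap _ = _
  rw [idl_ideal_top]
  have h := congr(I.comap (CommRingCat.Hom.hom $(Scheme.ΓSpecIso_naturality φ)))
  rw [CommRingCat.hom_comp, CommRingCat.hom_comp, ← Ideal.comap_comap, ← Ideal.comap_comap] at h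
  exact h

lemma comap_idl {R S : CommRingCat.{u}} (φ : R ⟶ S) (I : Ideal R) :
    (idl I).comap (Spec.map φ) = idl (I.map φ.hom) := by
  apply eq_of_forall_ge_iff
  intro J
  obtain ⟨J, rfl⟩ := idl_surjective J
  rw [← le_map_iff_comap_le, map_idl, idl_le_idl, idl_le_idl, Ideal.map_le_iff_le_comap]

lemma mem_support_idl {R : CommRingCat.{u}} (I : Ideal R) (x : Spec R) :
    x ∈ (idl I).support ↔ I ≤ x.asIdeal := by
  have h (f : R) : x ∈ (Spec R).basicOpen ((Scheme.ΓSpecIso R).inv.hom f) ↔ f ∉ x.asIdeal := by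
    rw [basicOpen_eq_of_affine]
    exact Iff.rfl
  rw [mem_support_iff_of_mem (U := ⟨⊤, isAffineOpen_top _⟩) (Set.mem_univ x), idl_ideal_top,
    Scheme.mem_zeroLocus_iff]
  constructor
  · intro H f hf
    by_contra hx
    refine H ((Scheme.ΓSpecIso R).inv.hom f) ?_ ((h f).mpr hx)
    simpa using hf
  · intro H f hf hx
    obtain ⟨g, rfl⟩ := (Scheme.ΓSpecIso R).symm.commRingCatIsoToRingEquiv.surjective f
    refine (h g).mp hx (H ?_)
    have : (Scheme.ΓSpecIso R).hom.hom ((Scheme.ΓSpecIso R).inv.hom g) = g := by simp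
    rw [← this]
    exact hf

lemma ideal_radical {X : Scheme.{u}} (I : X.IdealSheafData) (U : X.affineOpens) :
    I.radical.ideal U = (I.ideal U).radical := rfl

lemma radical_idl {R : CommRingCat.{u}} (I : Ideal R) : (idl I).radical = idl I.radical := by
  apply Scheme.IdealSheafData.ext_of_isAffine
  rw [ideal_radical, idl_ideal_top, idl_ideal_top, Ideal.comap_radical]

lemma vanishingIdeal_eq_idl {R : CommRingCat.{u}} {I : Ideal R} (hI : I.IsRadical)
    {Z : Closeds (Spec R)} (hZ : ∀ x : Spec R, x ∈ Z ↔ I ≤ x.asIdeal) :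
    vanishingIdeal Z = idl I := by
  have : Z = (idl I).support := by
    ext x; exact (hZ x).trans (mem_support_idl I x).symm
  rw [this, vanishingIdeal_support, radical_idl, hI.radical]

/-! ## Ideal sheaves and open immersions -/

/-- Both sides have the same support, and the restriction of a radical ideal to an open piece is
radical. -/
lemma comap_vanishingIdeal {X Y : Scheme.{u}} (j : X ⟶ Y) [IsOpenImmersion j] (Z : Closeds Y) :
    (vanishingIdeal Z).comap j = vanishingIdeal (Z.preimage j.continuous) := by
  have h : (vanishingIdeal Z).comap j = ((vanishingIdeal Z).comap j).radical := by
    ext U : 2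
    rw [ideal_radical, ideal_comap_of_isOpenImmersion, ← Ideal.comap_radical]
    congr 1
    symm
    exact (PrimeSpectrum.isRadical_vanishingIdeal _).radical
  rw [h, ← vanishingIdeal_support, support_comap]
  congr 2

/-- The push-forward is the kernel of the composite of the closed immersion with `f`, and kernels of
quasi-compact morphisms restrict well to open subschemes. -/
lemma comap_map_of_isPullback {X Y X' Y' : Scheme.{u}} {f : X ⟶ Y} {j : Y' ⟶ Y} {f' : X' ⟶ Y'}
    {j' : X' ⟶ X} [IsOpenImmersion j] [IsOpenImmersion j'] [QuasiCompact f]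
    (h : IsPullback f' j' j f) (I : X.IdealSheafData) :
    (I.map f).comap j = (I.comap j').map f' := by
  have h2 := (((IsPullback.of_hasPullback j' I.subschemeι).flip).paste_vert h.flip).flip
  have h3 : (I.map f).comap j = (pullback.fst j' I.subschemeι ≫ f').ker := by
    ext U : 2
    rw [ideal_comap_of_isOpenImmersion, Scheme.ker_ideal_of_isPullback_of_isOpenImmersion _ _ _ _
        h2]
    rfl
  rw [h3, ← map_ker]
  rfl

lemma comap_iInf_of_isOpenImmersion {X Y : Scheme.{u}} (j : X ⟶ Y) [IsOpenImmersion j]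
    {ι : Type*} [Finite ι] (I : ι → Y.IdealSheafData) :
    (⨅ i, I i).comap j = ⨅ i, (I i).comap j := by
  ext U : 2
  simp only [ideal_comap_of_isOpenImmersion, ideal_iInf, iInf_apply, Ideal.comap_iInf]

/-- Ideal sheaves on the members of a finite open cover that agree on the overlaps glue. -/
lemma exists_glued_ideal {X : Scheme.{u}} {ι : Type*} [Finite ι] {U : ι → Scheme.{u}}
    (j : ∀ i, U i ⟶ X) [∀ i, IsOpenImmersion (j i)] [∀ i, QuasiCompact (j i)]
    (J : ∀ i, (U i).IdealSheafData)
    (h : ∀ i i', (J i).comap (pullback.fst (j i) (j i')) = (J i').comap (pullback.snd (j i) (j i')))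
        :
    ∃ K : X.IdealSheafData, ∀ i, K.comap (j i) = J i := by
  refine ⟨⨅ i, (J i).map (j i), fun i ↦ ?_⟩
  rw [comap_iInf_of_isOpenImmersion]
  apply le_antisymm
  · refine (iInf_le _ i).trans ?_
    exact comap_map_le _ _
  -- On the `i`-th piece, the image ideal of the `i'`-th subscheme is pushed forward from the
  -- overlap, where that subscheme agrees with the one of `J i`.
  · refine le_iInf fun i' ↦ ?_
    rw [comap_map_of_isPullback (IsPullback.of_hasPullback (j i) (j i')), le_map_iff_comap_le, h]

/-! ## Invertible ideal sheaves -/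

/-- The ideal sheaf `J` is generated by a non-zero-divisor on an affine neighbourhood of `x`. -/
def CartierAt {X : Scheme.{u}} (J : X.IdealSheafData) (x : X) : Prop :=
  ∃ (R : CommRingCat.{u}) (j : Spec R ⟶ X) (_ : IsOpenImmersion j) (a : R),
    x ∈ Set.range j ∧ a ∈ nonZeroDivisors R ∧ J.comap j = idl (Ideal.span {a})

lemma ideal_comap_eq_map {X Y : Scheme.{u}} (f : X ⟶ Y) [IsOpenImmersion f]
    (J : Y.IdealSheafData) (U : X.affineOpens) (V : Y.affineOpens) (e : U.1 ≤ f ⁻¹ᵁ V.1) :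
    (J.comap f).ideal U = (J.ideal V).map (f.appLE V.1 U.1 e).hom := by
  have e' : f ''ᵁ U.1 ≤ V.1 := (f.image_mono e).trans (f.image_preimage_le _)
  rw [ideal_comap_of_isOpenImmersion]
  have h1 := J.map_ideal (U := ⟨f ''ᵁ U.1, U.2.image_of_isOpenImmersion f⟩) (V := V) e'
  have h2 (K : Ideal Γ(Y, f ''ᵁ U.1)) :
      K.comap (f.appIso U.1).inv.hom = K.map (f.appIso U.1).hom.hom :=
    (Ideal.map_comap_of_equiv (I := K) (f.appIso U.1).commRingCatIsoToRingEquiv).symm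
  rw [h2, ← h1, Ideal.map_map, ← CommRingCat.hom_comp]
  congr 2
  rw [Scheme.Hom.appIso_hom', Scheme.Hom.map_appLE]

lemma comap_fromSpec {X : Scheme.{u}} (J : X.IdealSheafData) {U : X.Opens} (hU : IsAffineOpen U) :
    J.comap hU.fromSpec = idl (J.ideal ⟨U, hU⟩) := by
  apply Scheme.IdealSheafData.ext_of_isAffine
  rw [idl_ideal_top, ← map_ΓSpecIso_inv_eq_comap,
    ideal_comap_eq_map hU.fromSpec J ⟨⊤, isAffineOpen_top _⟩ ⟨U, hU⟩ (by simp)]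
  congr 2
  have h (i : Opposite.op (⊤ : (Spec Γ(X, U)).Opens) ⟶ Opposite.op ⊤) :
      (Spec Γ(X, U)).presheaf.map i = 𝟙 _ := by
    rw [Subsingleton.elim i (𝟙 _), CategoryTheory.Functor.map_id]
  simp [Scheme.Hom.appLE, IsAffineOpen.fromSpec_app_of_le]
  refine (congrArg ((Scheme.ΓSpecIso Γ(X, U)).inv ≫ ·) ?_).trans (Category.comp_id _)
  exact ((Spec Γ(X, U)).presheaf.map_comp _ _).symm.trans (h _)

lemma exists_affineOpen_of_chart {X : Scheme.{u}} {R : CommRingCat.{u}} (j : Spec R ⟶ X)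
    [IsOpenImmersion j] : ∃ (U : X.Opens) (hU : IsAffineOpen U) (e : R ≅ Γ(X, U)),
      U = j.opensRange ∧ Spec.map e.hom ≫ j = hU.fromSpec := by
  have hU : IsAffineOpen j.opensRange := isAffineOpen_opensRange j
  let i : Spec Γ(X, j.opensRange) ≅ Spec R := IsOpenImmersion.isoOfRangeEq hU.fromSpec j (by
    rw [hU.range_fromSpec]; rfl)
  refine ⟨_, hU, ⟨Spec.preimage i.hom, Spec.preimage i.inv, ?_, ?_⟩, rfl, ?_⟩
  · apply Spec.map_injective; simp
  · apply Spec.map_injective; simp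
  · simp only [Spec.map_preimage]
    exact IsOpenImmersion.isoOfRangeEq_hom_fac _ _ _

lemma isCartier_iff {X : Scheme.{u}} {J : X.IdealSheafData} :
    IsCartier J ↔ ∀ x, CartierAt J x := by
  refine forall_congr' fun x ↦ ⟨?_, ?_⟩
  · rintro ⟨⟨U, hU⟩, hx, a, ha, h⟩
    have hU : IsAffineOpen U := hU
    refine ⟨_, hU.fromSpec, inferInstance, a, ?_, ha, ?_⟩
    · rw [hU.range_fromSpec]; exact hx
    · rw [comap_fromSpec, h]
  · rintro ⟨R, j, hj, a, hx, ha, h⟩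
    obtain ⟨U, hU, e, hj', he⟩ := exists_affineOpen_of_chart j
    refine ⟨⟨U, hU⟩, hj' ▸ hx, e.hom.hom a, ?_, ?_⟩
    · let e' : R ≃* Γ(X, U) := e.commRingCatIsoToRingEquiv.toMulEquiv
      have : (nonZeroDivisors R).map e' = nonZeroDivisors Γ(X, U) :=
        MulEquivClass.map_nonZeroDivisors e'
      exact this.le ⟨a, ha, rfl⟩
    · apply idl_injective
      rw [← comap_fromSpec, ← he, comap_comp, h, comap_idl, Ideal.map_span, Set.image_singleton]

/-- Open immersions are flat, and flat maps preserve regular elements. -/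
lemma map_mem_nonZeroDivisors_of_isOpenImmersion {R S : CommRingCat.{u}} (φ : R ⟶ S)
    [IsOpenImmersion (Spec.map φ)] {a : R} (ha : a ∈ nonZeroDivisors R) :
    φ.hom a ∈ nonZeroDivisors S := by
  have h : φ.hom.Flat := Flat.SpecMap_iff.mp inferInstance
  algebraize [φ.hom]
  have h1 : IsSMulRegular R a := by
    intro x y hxy
    exact (mul_cancel_left_mem_nonZeroDivisors ha).mp hxy
  have h2 : IsSMulRegular S (φ.hom a) := h1.of_flat (S := S)
  rw [mem_nonZeroDivisors_iff_left]
  intro x hx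
  exact h2 (by simpa using hx)

/-- The basic open subset `D(r)` of `Spec R`. -/
abbrev specAway {R : CommRingCat.{u}} (r : R) :
    Spec (CommRingCat.of (Localization.Away r)) ⟶ Spec R :=
  Spec.map (CommRingCat.ofHom (algebraMap R (Localization.Away r)))

lemma mem_range_specAway {R : CommRingCat.{u}} (r : R) (p : Spec R) :
    p ∈ Set.range (specAway r) ↔ r ∉ p.asIdeal := by
  have := PrimeSpectrum.localization_away_comap_range (Localization.Away r) r
  change p ∈ Set.range (PrimeSpectrum.comap (algebraMap R (Localization.Away r))) ↔ _
  rw [this]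
  rfl

lemma exists_specAway_range_subset {R : CommRingCat.{u}} {X : Scheme.{u}} (f : Spec R ⟶ X)
    (W : X.Opens) (p : Spec R) (hp : f p ∈ W) :
    ∃ r : R, r ∉ p.asIdeal ∧ Set.range (specAway r ≫ f) ⊆ W := by
  obtain ⟨_, ⟨_, ⟨r, rfl⟩, rfl⟩, hr, hr'⟩ :=
    PrimeSpectrum.isBasis_basic_opens.exists_subset_of_mem_open
      (show (p : PrimeSpectrum R) ∈ ((f ⁻¹ᵁ W : (Spec R).Opens) : Set (Spec R)) from hp)
      (f ⁻¹ᵁ W).isOpen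
  refine ⟨r, hr, ?_⟩
  rintro _ ⟨q, rfl⟩
  rw [Scheme.Hom.comp_apply]
  exact hr' ((mem_range_specAway r _).mp ⟨q, rfl⟩)

/-- A chart around a point can be shrunk so as to map into a given chart. -/
lemma exists_specAway_lift {R : CommRingCat.{u}} {S : CommRingCat.{u}} {X : Scheme.{u}}
    (f : Spec R ⟶ X) (j : Spec S ⟶ X) [IsOpenImmersion j] (p : Spec R)
    (hp : f p ∈ Set.range j) :
    ∃ r : R, r ∉ p.asIdeal ∧ ∃ ψ : S ⟶ CommRingCat.of (Localization.Away r),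
      specAway r ≫ f = Spec.map ψ ≫ j := by
  obtain ⟨r, hr, h⟩ := exists_specAway_range_subset f j.opensRange p hp
  refine ⟨r, hr, Spec.preimage (IsOpenImmersion.lift j (specAway r ≫ f) h), ?_⟩
  rw [Spec.map_preimage]
  exact (IsOpenImmersion.lift_fac _ _ _).symm

lemma exists_chart {X : Scheme.{u}} (x : X) :
    ∃ (R : CommRingCat.{u}) (j : Spec R ⟶ X) (_ : IsOpenImmersion j), x ∈ Set.range j := by
  obtain ⟨R, f, hf, h, -⟩ := Scheme.exists_affine_mem_range_and_range_subset
    (show x ∈ (⊤ : X.Opens) from trivial)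
  exact ⟨R, f, hf, h⟩

/-- Makes the choice of chart in `CartierAt` irrelevant: in any given chart a basic open
neighbourhood of the point maps into the one where the generator lives. -/
lemma CartierAt.exists_specAway {X : Scheme.{u}} {J : X.IdealSheafData} {R : CommRingCat.{u}}
    {j : Spec R ⟶ X} [IsOpenImmersion j] {p : Spec R} (h : CartierAt J (j p)) {K : Ideal R}
    (hK : J.comap j = idl K) :
    ∃ r : R, r ∉ p.asIdeal ∧ ∃ b ∈ nonZeroDivisors (Localization.Away r),
      K.map (algebraMap R (Localization.Away r)) = Ideal.span {b} := by
  obtain ⟨S, c, hc, a, hx, ha, hJ⟩ := h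
  obtain ⟨r, hr, ψ, hψ⟩ := exists_specAway_lift j c p hx
  have : IsOpenImmersion (Spec.map ψ) := by
    have : IsOpenImmersion (Spec.map ψ ≫ c) := by rw [← hψ]; infer_instance
    exact IsOpenImmersion.of_comp _ c
  refine ⟨r, hr, ψ.hom a, map_mem_nonZeroDivisors_of_isOpenImmersion ψ ha, ?_⟩
  have h1 : J.comap (specAway r ≫ j) = J.comap (Spec.map ψ ≫ c) := by rw [hψ]
  rw [comap_comp, comap_comp, hK, hJ, comap_idl, comap_idl, Ideal.map_span,
    Set.image_singleton] at h1
  exact idl_injective h1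

lemma cartierAt_of_specAway {X : Scheme.{u}} {J : X.IdealSheafData} {R : CommRingCat.{u}}
    {j : Spec R ⟶ X} [IsOpenImmersion j] {p : Spec R} {K : Ideal R} (hK : J.comap j = idl K)
    {r : R} (hr : r ∉ p.asIdeal) {b : Localization.Away r}
    (hb : b ∈ nonZeroDivisors (Localization.Away r))
    (h : K.map (algebraMap R (Localization.Away r)) = Ideal.span {b}) :
    CartierAt J (j p) := by
  refine ⟨_, specAway r ≫ j, inferInstance, b, ?_, hb, ?_⟩
  · obtain ⟨q, rfl⟩ := (mem_range_specAway r p).mpr hr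
    exact ⟨q, rfl⟩
  · rw [comap_comp, hK, comap_idl]
    exact congrArg _ h

lemma cartierAt_comap_iff {X Y : Scheme.{u}} (f : X ⟶ Y) [IsOpenImmersion f]
    (J : Y.IdealSheafData) (x : X) : CartierAt (J.comap f) x ↔ CartierAt J (f x) := by
  obtain ⟨R, j, hj, p, rfl⟩ := exists_chart x
  obtain ⟨K, hK⟩ := idl_surjective ((J.comap f).comap j)
  have hK' : J.comap (j ≫ f) = idl K := by rw [comap_comp, hK]
  constructor
  · intro h
    obtain ⟨r, hr, b, hb, h⟩ := h.exists_specAway hK.symm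
    exact cartierAt_of_specAway (j := j ≫ f) hK' hr hb h
  · intro h
    obtain ⟨r, hr, b, hb, h⟩ := CartierAt.exists_specAway (j := j ≫ f) h hK'
    exact cartierAt_of_specAway hK.symm hr hb h

lemma isOpen_cartierAt {X : Scheme.{u}} (J : X.IdealSheafData) : IsOpen {x | CartierAt J x} := by
  rw [isOpen_iff_forall_mem_open]
  rintro x ⟨R, j, hj, a, hx, ha, h⟩
  refine ⟨Set.range j, ?_, j.isOpenEmbedding.isOpen_range, hx⟩
  intro y hy
  exact ⟨R, j, hj, a, hy, ha, h⟩

lemma cartierAt_top {X : Scheme.{u}} (x : X) : CartierAt (⊤ : X.IdealSheafData) x := by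
  obtain ⟨R, j, hj, hx⟩ := exists_chart x
  refine ⟨R, j, hj, 1, hx, one_mem _, ?_⟩
  rw [comap_top, Ideal.span_singleton_one, idl_top]

lemma cartierAt_idl_span {R : CommRingCat.{u}} {a : R} (ha : a ∈ nonZeroDivisors R) (p : Spec R) :
    CartierAt (idl (Ideal.span {a})) p :=
  ⟨R, 𝟙 _, inferInstance, a, ⟨p, rfl⟩, ha, by rw [comap_id]⟩

lemma isCartier_top {X : Scheme.{u}} : IsCartier (⊤ : X.IdealSheafData) :=
  isCartier_iff.mpr cartierAt_top

lemma IsCartier.comap_of_isOpenImmersion {X Y : Scheme.{u}} {J : Y.IdealSheafData}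
    (h : IsCartier J) (f : X ⟶ Y) [IsOpenImmersion f] : IsCartier (J.comap f) := by
  rw [isCartier_iff] at h ⊢
  exact fun x ↦ (cartierAt_comap_iff f J x).mpr (h _)

lemma mem_nonZeroDivisors_of_span_eq {A : Type*} [CommRing A] {a b : A}
    (hb : b ∈ nonZeroDivisors A) (h : Ideal.span {a} = Ideal.span {b}) :
    a ∈ nonZeroDivisors A := by
  obtain ⟨x, rfl⟩ := Ideal.mem_span_singleton.mp (h.le (Ideal.mem_span_singleton_self a))
  obtain ⟨y, hy⟩ := Ideal.mem_span_singleton.mp (h.ge (Ideal.mem_span_singleton_self b))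
  have : x * y = 1 := by
    rw [← mul_cancel_left_mem_nonZeroDivisors hb]
    linear_combination -hy
  exact mul_mem hb (IsUnit.of_mul_eq_one _ this).mem_nonZeroDivisors

/-- If `a * c = 0` with `c ≠ 0`, take a maximal ideal containing the annihilator of `c`: inverting a
single element outside of it never kills `c`, although it can make `a` regular. -/
lemma mem_nonZeroDivisors_of_cartierAt {R : CommRingCat.{u}} {a : R}
    (h : ∀ p, CartierAt (idl (Ideal.span {a})) p) : a ∈ nonZeroDivisors R := by
  rw [mem_nonZeroDivisors_iff_left]
  intro c hc
  by_contra hc0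
  have hI : Ideal.span {c} ≠ ⊥ := by rwa [Ne, Ideal.span_singleton_eq_bot]
  obtain ⟨M, hM, hle⟩ := Ideal.exists_le_maximal (Ideal.span {c} : Ideal R).annihilator (by
    rw [Ne, Submodule.annihilator_eq_top_iff]; exact hI)
  obtain ⟨r, hr, b, hb, hab⟩ := CartierAt.exists_specAway (j := 𝟙 _) (p := ⟨M, hM.isPrime⟩)
    (h _) (comap_id _)
  rw [Ideal.map_span, Set.image_singleton] at hab
  have ha := mem_nonZeroDivisors_of_span_eq hb hab
  have : algebraMap R (Localization.Away r) c = 0 := by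
    refine (mem_nonZeroDivisors_iff_left.mp ha) _ ?_
    rw [← map_mul, hc, map_zero]
  obtain ⟨⟨_, n, rfl⟩, hn⟩ := (IsLocalization.map_eq_zero_iff (Submonoid.powers r) _ c).mp this
  refine hr (hM.isPrime.mem_of_pow_mem n (hle ?_))
  rw [Submodule.mem_annihilator_span_singleton]
  exact hn

/-! ## Blow-ups -/

lemma hom_ext_of_charts {X Y : Scheme.{u}} {a b : X ⟶ Y}
    (h : ∀ x : X, ∃ (U : Scheme.{u}) (c : U ⟶ X) (_ : IsOpenImmersion c),
      x ∈ Set.range c ∧ c ≫ a = c ≫ b) : a = b := by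
  refine Scheme.hom_ext_of_forall _ _ fun x ↦ ?_
  obtain ⟨U, c, hc, hx, h⟩ := h x
  refine ⟨c.opensRange, hx, ?_⟩
  have : c = c.isoOpensRange.hom ≫ c.opensRange.ι := by simp
  rw [this, Category.assoc, Category.assoc, cancel_epi] at h
  exact h

/-- The universal property passes to any base change; that `f` is an open immersion serves to keep
the inverse image of the center Cartier. -/
lemma IsBlowup.of_isPullback {V W U W' : Scheme.{u}} {I : V.IdealSheafData} {ρ : W ⟶ V}
    (hρ : IsBlowup I ρ) {j : U ⟶ V} {f : W' ⟶ W} {ρ' : W' ⟶ U} [IsOpenImmersion f]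
    (h : IsPullback f ρ' ρ j) : IsBlowup (I.comap j) ρ' := by
  constructor
  · rw [← comap_comp, ← h.w, comap_comp]
    exact hρ.isCartier.comap_of_isOpenImmersion f
  · intro T t ht
    rw [← comap_comp] at ht
    obtain ⟨s, hs, hs'⟩ := hρ.existsUnique_lift (t ≫ j) ht
    refine ⟨h.lift s t hs, h.lift_snd _ _ _, fun s' hs'' ↦ ?_⟩
    apply h.hom_ext
    · rw [h.lift_fst]
      apply hs'
      simp only [Category.assoc, h.w, reassoc_of% hs'']
    · rw [h.lift_snd, hs'']

lemma IsBlowup.isIso {V W : Scheme.{u}} {I : V.IdealSheafData} {ρ : W ⟶ V}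
    (hρ : IsBlowup I ρ) (hI : IsCartier I) : IsIso ρ := by
  obtain ⟨s, hs, -⟩ := hρ.existsUnique_lift (𝟙 V) (by rwa [comap_id])
  refine ⟨s, ?_, hs⟩
  obtain ⟨s', -, hs'⟩ := hρ.existsUnique_lift ρ hρ.isCartier
  exact (hs' _ (by simp [hs])).trans (hs' _ (by simp)).symm

/-- A blow-up is an isomorphism over an open subset where its center is a Cartier divisor. -/
lemma IsBlowup.exists_lift {V W U : Scheme.{u}} {I : V.IdealSheafData} {ρ : W ⟶ V}
    (hρ : IsBlowup I ρ) (j : U ⟶ V) [IsOpenImmersion j] (hI : IsCartier (I.comap j)) :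
    ∃ (j' : U ⟶ W) (_ : IsOpenImmersion j'), j' ≫ ρ = j ∧
      ∀ w, ρ w ∈ Set.range j → w ∈ Set.range j' := by
  have hp := IsPullback.of_hasPullback ρ j
  have := (hρ.of_isPullback hp).isIso hI
  refine ⟨inv (pullback.snd ρ j) ≫ pullback.fst ρ j, inferInstance, ?_, ?_⟩
  · simp [pullback.condition]
  · intro w hw
    have h1 : w ∈ Set.range (pullback.fst ρ j) := by
      rw [IsOpenImmersion.range_pullbackFst]; exact hw
    obtain ⟨q, rfl⟩ := h1
    refine ⟨pullback.snd ρ j q, ?_⟩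
    rw [← Scheme.Hom.comp_apply, IsIso.hom_inv_id_assoc]

lemma mem_nonZeroDivisors_of_localizationAway {A : Type*} [CommRing A] {a b : A}
    (hb : b ∈ nonZeroDivisors A)
    (h : algebraMap A (Localization.Away b) a ∈ nonZeroDivisors (Localization.Away b)) :
    a ∈ nonZeroDivisors A := by
  rw [mem_nonZeroDivisors_iff_left] at h ⊢
  intro c hc
  have h2 := h (algebraMap A _ c) (by rw [← map_mul, hc, map_zero])
  obtain ⟨⟨_, n, rfl⟩, hn⟩ := (IsLocalization.map_eq_zero_iff (Submonoid.powers b) _ c).mp h2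
  exact (mem_nonZeroDivisors_iff_left.mp (pow_mem hb n)) _ hn

/-- The inverse image of a Cartier divisor under a blow-up is a Cartier divisor. -/
lemma IsBlowup.cartierAt_comap {V W : Scheme.{u}} {I J : V.IdealSheafData} {ρ : W ⟶ V}
    (hρ : IsBlowup I ρ) {w : W} (h : CartierAt J (ρ w)) : CartierAt (J.comap ρ) w := by
  obtain ⟨A, c, hc, a, hx, ha, hJ⟩ := h
  obtain ⟨B, d, hd, b, ⟨p, rfl⟩, hb, hI⟩ := isCartier_iff.mp hρ.isCartier w
  obtain ⟨r, hr, ψ, hψ⟩ := exists_specAway_lift (d ≫ ρ) c p hx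
  set b' : Localization.Away r := algebraMap B _ b with hb'_def
  have hb' : b' ∈ nonZeroDivisors (Localization.Away r) :=
    map_mem_nonZeroDivisors_of_isOpenImmersion
      (CommRingCat.ofHom (algebraMap B (Localization.Away r))) hb
  have hJ' : (J.comap ρ).comap (specAway r ≫ d) = idl (Ideal.span {ψ.hom a}) := by
    rw [← comap_comp, Category.assoc, hψ, comap_comp, hJ, comap_idl, Ideal.map_span,
      Set.image_singleton]
  obtain ⟨q, rfl⟩ := (mem_range_specAway r p).mpr hr
  refine ⟨_, specAway r ≫ d, inferInstance, ψ.hom a, ⟨q, rfl⟩, ?_, hJ'⟩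
  -- The exceptional equation `b'` is regular, so regularity may be tested after inverting it. Off
  -- the exceptional divisor the blow-up is an open immersion into `V`, and there the generator `a`
  -- stays regular.
  apply mem_nonZeroDivisors_of_localizationAway hb'
  let B' : CommRingCat.{u} := CommRingCat.of (Localization.Away r)
  let g : Spec (CommRingCat.of (Localization.Away b')) ⟶ W :=
    specAway (R := B') b' ≫ specAway r ≫ d
  have hg : IsOpenImmersion g := by dsimp only [g]; infer_instance
  have hIg : I.comap (g ≫ ρ) = ⊤ := by
    dsimp only [g]
    rw [comap_comp, comap_comp, comap_comp, hI, comap_idl, comap_idl, idl_eq_top, Ideal.map_map,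
      Ideal.map_span, Set.image_singleton, Ideal.span_singleton_eq_top]
    exact IsLocalization.Away.algebraMap_isUnit b'
  let O : V.Opens := I.support.compl
  obtain ⟨o, ho, ho1, ho2⟩ := hρ.exists_lift O.ι (by
    have : I.comap O.ι = ⊤ := by
      rw [← support_eq_bot_iff, support_comap]
      ext x
      exact ⟨fun hx ↦ (show O.ι x ∈ O from x.2) hx, fun hx ↦ hx.elim⟩
    rw [this]
    exact isCartier_top)
  have hgo : Set.range g ⊆ Set.range o := by
    rintro _ ⟨q, rfl⟩
    apply ho2
    rw [Scheme.Opens.range_ι]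
    intro hq
    have : q ∈ (I.comap (g ≫ ρ)).support := by
      rw [support_comap]; exact hq
    rw [hIg] at this
    exact this
  let l := IsOpenImmersion.lift o g hgo
  have hl : l ≫ o = g := IsOpenImmersion.lift_fac _ _ _
  have hl' : IsOpenImmersion l := by
    have : IsOpenImmersion (l ≫ o) := by rw [hl]; exact hg
    exact IsOpenImmersion.of_comp _ o
  have h1 : g ≫ ρ = l ≫ O.ι := by rw [← hl, Category.assoc, ho1]
  have h2 : g ≫ ρ = Spec.map (ψ ≫ CommRingCat.ofHom (algebraMap B' (Localization.Away b'))) ≫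
      c := by
    dsimp only [g]
    rw [Category.assoc, Category.assoc, hψ, Spec.map_comp, Category.assoc]
  have h3 : IsOpenImmersion
      (Spec.map (ψ ≫ CommRingCat.ofHom (algebraMap B' (Localization.Away b')))) := by
    have : IsOpenImmersion (g ≫ ρ) := by rw [h1]; infer_instance
    rw [h2] at this
    exact IsOpenImmersion.of_comp _ c
  exact map_mem_nonZeroDivisors_of_isOpenImmersion
    (ψ ≫ CommRingCat.ofHom (algebraMap B' (Localization.Away b'))) ha

/-- Locally on a blow-up, one of the generators of the center generates its inverse image. -/
lemma IsBlowup.exists_generator {V W : Scheme.{u}} {I : V.IdealSheafData} {ρ : W ⟶ V}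
    (hρ : IsBlowup I ρ) {R : CommRingCat.{u}} {j : Spec R ⟶ V} [IsOpenImmersion j] {S : Set R}
    (hI : I.comap j = idl (Ideal.span S)) {w : W} (hw : ρ w ∈ Set.range j) :
    ∃ s ∈ S, ∃ (A : CommRingCat.{u}) (c : Spec A ⟶ W) (_ : IsOpenImmersion c) (ψ : R ⟶ A),
      w ∈ Set.range c ∧ c ≫ ρ = Spec.map ψ ≫ j ∧ ψ.hom s ∈ nonZeroDivisors A ∧
      (Ideal.span S).map ψ.hom = Ideal.span {ψ.hom s} := by
  obtain ⟨B, d, hd, b, ⟨p, rfl⟩, hb, hIb⟩ := isCartier_iff.mp hρ.isCartier w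
  obtain ⟨r, hr, ψ, hψ⟩ := exists_specAway_lift (d ≫ ρ) j p hw
  obtain ⟨q, rfl⟩ := (mem_range_specAway r p).mpr hr
  let B' : CommRingCat.{u} := CommRingCat.of (Localization.Away r)
  set b' : B' := algebraMap B _ b with hb'_def
  have hb' : b' ∈ nonZeroDivisors B' :=
    map_mem_nonZeroDivisors_of_isOpenImmersion
      (CommRingCat.ofHom (algebraMap B (Localization.Away r))) hb
  have hS : Ideal.span (ψ.hom '' S) = Ideal.span {b'} := by
    rw [← Ideal.map_span]
    apply idl_injective
    rw [← comap_idl, ← hI, ← comap_comp, ← hψ, comap_comp, comap_comp, hIb, comap_idl,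
      Ideal.map_span, Set.image_singleton]
    rfl
  have hdvd : ∀ s ∈ S, ∃ y, ψ.hom s = b' * y := fun s hs ↦
    Ideal.mem_span_singleton.mp (hS.le (Ideal.subset_span ⟨s, hs, rfl⟩))
  -- The quotients of the generators by the regular element `b'` generate the unit ideal, hence one
  -- of them is invertible at the given point.
  have hY : Ideal.span {y : B' | ∃ s ∈ S, ψ.hom s = b' * y} = ⊤ := by
    have h1 : b' ∈ Ideal.span {b'} * Ideal.span {y : B' | ∃ s ∈ S, ψ.hom s = b' * y} := by
      have h2 : Ideal.span (ψ.hom '' S) ≤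
          Ideal.span {b'} * Ideal.span {y : B' | ∃ s ∈ S, ψ.hom s = b' * y} := by
        rw [Ideal.span_le]
        rintro _ ⟨s, hs, rfl⟩
        obtain ⟨y, hy⟩ := hdvd s hs
        rw [hy]
        exact Ideal.mul_mem_mul (Ideal.mem_span_singleton_self _)
          (Ideal.subset_span ⟨s, hs, hy⟩)
      exact h2 (hS.ge (Ideal.mem_span_singleton_self _))
    obtain ⟨z, hz, hz'⟩ := Ideal.mem_span_singleton_mul.mp h1
    rw [Ideal.eq_top_iff_one]
    have : z = 1 := by
      rw [← mul_cancel_left_mem_nonZeroDivisors hb', hz', mul_one]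
    rwa [← this]
  obtain ⟨y, ⟨s, hs, hy⟩, hyq⟩ : ∃ y ∈ {y : B' | ∃ s ∈ S, ψ.hom s = b' * y}, y ∉ q.asIdeal := by
    by_contra! hcon
    exact q.isPrime.ne_top (top_le_iff.mp (hY ▸ Ideal.span_le.mpr hcon))
  obtain ⟨q', hq'⟩ := (mem_range_specAway (R := B') y q).mpr hyq
  let θ : B' ⟶ CommRingCat.of (Localization.Away y) :=
    CommRingCat.ofHom (algebraMap B' (Localization.Away y))
  have hyu : IsUnit (θ.hom y) := IsLocalization.Away.algebraMap_isUnit y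
  have hb'' : θ.hom b' ∈ nonZeroDivisors (Localization.Away y) :=
    map_mem_nonZeroDivisors_of_isOpenImmersion θ hb'
  refine ⟨s, hs, _, specAway (R := B') y ≫ specAway r ≫ d, inferInstance, ψ ≫ θ, ?_, ?_, ?_, ?_⟩
  · exact ⟨q', by rw [Scheme.Hom.comp_apply, hq', Scheme.Hom.comp_apply]⟩
  · rw [Category.assoc, Category.assoc, hψ, Spec.map_comp, Category.assoc]
  · simp only [CommRingCat.hom_comp, RingHom.comp_apply, hy, map_mul]
    exact mul_mem hb'' hyu.mem_nonZeroDivisors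
  · simp only [CommRingCat.hom_comp, RingHom.comp_apply, hy, map_mul]
    rw [← Ideal.map_map, Ideal.map_span, hS, Ideal.map_span, Set.image_singleton,
      Ideal.span_singleton_mul_right_unit hyu]

/-- `φ : R ⟶ R'` has the universal property of the chart of the blow-up of `Spec R` along `I`
where the element `g` generates the inverse image of `I`. -/
structure IsBlowupChart {R R' : CommRingCat.{u}} (φ : R ⟶ R') (I : Ideal R) (g : R) : Prop where
  mem_nonZeroDivisors : φ.hom g ∈ nonZeroDivisors R'
  map_eq : I.map φ.hom = Ideal.span {φ.hom g}
  exists_lift : ∀ {T : CommRingCat.{u}} (ψ : R ⟶ T), ψ.hom g ∈ nonZeroDivisors T →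
    I.map ψ.hom = Ideal.span {ψ.hom g} → ∃ χ : R' ⟶ T, φ ≫ χ = ψ
  hom_ext : ∀ {T : CommRingCat.{u}} (χ χ' : R' ⟶ T), χ.hom (φ.hom g) ∈ nonZeroDivisors T →
    φ ≫ χ = φ ≫ χ' → χ = χ'

lemma IsBlowupChart.hom_ext_scheme {R R' : CommRingCat.{u}} {φ : R ⟶ R'} {I : Ideal R} {g : R}
    (h : IsBlowupChart φ I g) {T : Scheme.{u}} {a b : T ⟶ Spec R'}
    (ha : IsCartier ((idl (Ideal.span {φ.hom g})).comap a))
    (hab : a ≫ Spec.map φ = b ≫ Spec.map φ) : a = b := by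
  apply hom_ext_of_charts
  intro t
  obtain ⟨A, c, hc, x, ht, hx, hxc⟩ := isCartier_iff.mp ha t
  refine ⟨_, c, hc, ht, ?_⟩
  obtain ⟨α, hα⟩ := Spec.map_surjective (c ≫ a)
  obtain ⟨β, hβ⟩ := Spec.map_surjective (c ≫ b)
  rw [← hα, ← hβ]
  congr 1
  apply h.hom_ext
  · rw [← comap_comp, ← hα, comap_idl, Ideal.map_span, Set.image_singleton] at hxc
    exact mem_nonZeroDivisors_of_span_eq hx (idl_injective hxc)
  · apply Spec.map_injective
    rw [Spec.map_comp, Spec.map_comp, hα, hβ, Category.assoc, Category.assoc, hab]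

/-- The charts of a blow-up. -/
lemma IsBlowup.exists_chart {V W : Scheme.{u}} {I : V.IdealSheafData} {ρ : W ⟶ V}
    (hρ : IsBlowup I ρ) {R : CommRingCat.{u}} {j : Spec R ⟶ V} [IsOpenImmersion j] {K : Ideal R}
    (hI : I.comap j = idl K) {R' : CommRingCat.{u}} {φ : R ⟶ R'} {g : R}
    (h : IsBlowupChart φ K g) (hg : g ∈ K) :
    ∃ (j' : Spec R' ⟶ W) (_ : IsOpenImmersion j'), j' ≫ ρ = Spec.map φ ≫ j ∧
      ∀ {A : CommRingCat.{u}} (c : Spec A ⟶ W) [IsOpenImmersion c] (ψ : R ⟶ A),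
        c ≫ ρ = Spec.map ψ ≫ j → ψ.hom g ∈ nonZeroDivisors A →
        K.map ψ.hom = Ideal.span {ψ.hom g} → Set.range c ⊆ Set.range j' := by
  have hcart : ∀ {A : CommRingCat.{u}} (ψ : R ⟶ A), ψ.hom g ∈ nonZeroDivisors A →
      K.map ψ.hom = Ideal.span {ψ.hom g} → IsCartier (I.comap (Spec.map ψ ≫ j)) := by
    intro A ψ h1 h2
    rw [isCartier_iff, comap_comp, hI, comap_idl, h2]
    exact cartierAt_idl_span h1
  obtain ⟨j', hj', -⟩ := hρ.existsUnique_lift (Spec.map φ ≫ j)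
    (hcart φ h.mem_nonZeroDivisors h.map_eq)
  -- Any morphism to `W` along which `g` generates the inverse image of `K` factors through `j'`:
  -- the chart provides the factorization on rings, and uniqueness of lifts to `W` identifies the
  -- composite.
  have key : ∀ {A : CommRingCat.{u}} (c : Spec A ⟶ W) (ψ : R ⟶ A),
        c ≫ ρ = Spec.map ψ ≫ j → ψ.hom g ∈ nonZeroDivisors A →
        K.map ψ.hom = Ideal.span {ψ.hom g} → ∃ χ : R' ⟶ A, φ ≫ χ = ψ ∧ Spec.map χ ≫ j' = c := by
    intro A c ψ h1 h2 h3
    obtain ⟨χ, hχ⟩ := h.exists_lift ψ h2 h3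
    refine ⟨χ, hχ, ?_⟩
    obtain ⟨s, -, hs⟩ := hρ.existsUnique_lift (Spec.map ψ ≫ j) (hcart ψ h2 h3)
    rw [hs c h1]
    apply hs
    rw [Category.assoc, hj', ← hχ, Spec.map_comp, Category.assoc]
  refine ⟨j', ?_, hj', ?_⟩
  -- Near `j' p` some `s ∈ K` generates on a chart of `W`, and `g = s * y` there. Near `p` both `g`
  -- and `s` generate, so `y` is a unit; on the open set `D(y)` of that chart `g` generates too, and
  -- `key` inverts `j'` over it.
  · apply IsZariskiLocalAtTarget.of_forall_source_exists_preimage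
    intro p
    have hp : ρ (j' p) ∈ Set.range j := by
      rw [← Scheme.Hom.comp_apply, hj']
      exact ⟨_, rfl⟩
    obtain ⟨s, hs, A, c, hc, ψ, hpc, h1, h2, h3⟩ := hρ.exists_generator
      (S := (K : Set R)) (by rw [hI, Ideal.span_eq]) hp
    rw [Ideal.span_eq] at h3
    obtain ⟨y, hy⟩ : ∃ y, ψ.hom g = ψ.hom s * y :=
      Ideal.mem_span_singleton.mp (h3.le (Ideal.mem_map_of_mem _ hg))
    obtain ⟨r, hr, χ, hχ⟩ := exists_specAway_lift j' c p hpc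
    obtain ⟨p', rfl⟩ := (mem_range_specAway r p).mpr hr
    have hφ : φ ≫ CommRingCat.ofHom (algebraMap R' (Localization.Away r)) = ψ ≫ χ := by
      apply Spec.map_injective
      rw [← cancel_mono j, Spec.map_comp, Spec.map_comp, Category.assoc, Category.assoc, ← hj',
        ← h1, reassoc_of% hχ]
    have hyu : IsUnit (χ.hom y) := by
      have e1 : χ.hom (ψ.hom g) ∈ nonZeroDivisors (Localization.Away r) := by
        have := map_mem_nonZeroDivisors_of_isOpenImmersion
          (CommRingCat.ofHom (algebraMap R' (Localization.Away r))) h.mem_nonZeroDivisors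
        rwa [← RingHom.comp_apply, ← CommRingCat.hom_comp, hφ] at this
      have e2 : Ideal.span {χ.hom (ψ.hom g)} = Ideal.span {χ.hom (ψ.hom s)} := by
        rw [← Set.image_singleton (f := χ.hom) (a := ψ.hom s), ← Ideal.map_span, ← h3,
          Ideal.map_map, ← CommRingCat.hom_comp, ← hφ, CommRingCat.hom_comp, ← Ideal.map_map,
          h.map_eq, Ideal.map_span, Set.image_singleton, ← RingHom.comp_apply,
          ← CommRingCat.hom_comp, ← RingHom.comp_apply, ← CommRingCat.hom_comp, hφ]
      obtain ⟨z, hz⟩ := Ideal.mem_span_singleton.mp (e2.ge (Ideal.mem_span_singleton_self _))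
      refine IsUnit.of_mul_eq_one z ?_
      rw [← mul_cancel_left_mem_nonZeroDivisors e1]
      rw [hy, map_mul] at hz ⊢
      linear_combination (-χ.hom y) * hz
    have hq : y ∉ (Spec.map χ p').asIdeal := fun hmem ↦
      p'.isPrime.ne_top (Ideal.eq_top_of_isUnit_mem _ hmem hyu)
    obtain ⟨q, hq⟩ := (mem_range_specAway y _).mpr hq
    let θ : A ⟶ CommRingCat.of (Localization.Away y) :=
      CommRingCat.ofHom (algebraMap A (Localization.Away y))
    have hyu' : IsUnit (θ.hom y) := IsLocalization.Away.algebraMap_isUnit y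
    have hs' : θ.hom (ψ.hom s) ∈ nonZeroDivisors (Localization.Away y) :=
      map_mem_nonZeroDivisors_of_isOpenImmersion θ h2
    let o := specAway y ≫ c
    obtain ⟨τ, -, hτ⟩ := key o (ψ ≫ θ)
      (by rw [Category.assoc, h1, Spec.map_comp, Category.assoc])
      (by
        simp only [CommRingCat.hom_comp, RingHom.comp_apply, hy, map_mul]
        exact mul_mem hs' hyu'.mem_nonZeroDivisors)
      (by
        simp only [CommRingCat.hom_comp, RingHom.comp_apply, hy, map_mul]
        rw [← Ideal.map_map, h3, Ideal.map_span, Set.image_singleton,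
          Ideal.span_singleton_mul_right_unit hyu'])
    have hfst : pullback.fst j' o = pullback.snd j' o ≫ Spec.map τ := by
      apply h.hom_ext_scheme
      · exact (isCartier_iff.mpr (cartierAt_idl_span
          h.mem_nonZeroDivisors)).comap_of_isOpenImmersion _
      · rw [← cancel_mono j, Category.assoc, Category.assoc, ← hj', pullback.condition_assoc,
          ← hτ]
        simp only [Category.assoc]
    have hiso : IsIso (pullback.snd j' o) := by
      refine ⟨pullback.lift (Spec.map τ) (𝟙 _)
        (by rw [hτ, Category.id_comp]), ?_, pullback.lift_snd _ _ _⟩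
      apply pullback.hom_ext
      · rw [Category.assoc, pullback.lift_fst, hfst, Category.id_comp]
      · rw [Category.assoc, pullback.lift_snd, Category.id_comp]
        exact Category.comp_id _
    refine ⟨o.opensRange, ?_, ?_⟩
    · refine ⟨q, ?_⟩
      dsimp only [o]
      rw [Scheme.Hom.comp_apply, hq, ← Scheme.Hom.comp_apply, ← hχ, Scheme.Hom.comp_apply]
    · let i := IsOpenImmersion.isoOfRangeEq (j' ⁻¹ᵁ o.opensRange).ι (pullback.fst j' o) (by
        rw [IsOpenImmersion.range_pullbackFst, Scheme.Opens.range_ι])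
      have hi : i.hom ≫ pullback.fst j' o = (j' ⁻¹ᵁ o.opensRange).ι :=
        IsOpenImmersion.isoOfRangeEq_hom_fac _ _ _
      rw [← hi, Category.assoc, pullback.condition]
      infer_instance
  · rintro A c hc ψ h1 h2 h3 _ ⟨q, rfl⟩
    obtain ⟨χ, -, hχ⟩ := key c ψ h1 h2 h3
    rw [← hχ]
    exact ⟨_, rfl⟩

/-! ## Proper transforms -/

/-- Over an affine open set where the ideal is generated by `a`, the complement is the basic open
set of `a`. Quasi-compactness allows closures of subschemes of the complement to be computed in
charts. -/
lemma IsCartier.quasiCompact_ι {X : Scheme.{u}} {J : X.IdealSheafData} (h : IsCartier J) :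
    QuasiCompact (Scheme.Opens.ι (X := X) J.support.compl) := by
  let O : X.Opens := J.support.compl
  change QuasiCompact O.ι
  choose U hxU a ha hU using h
  have : ⨆ x, (U x).1 = ⊤ := by
    ext x
    simpa using ⟨x, hxU x⟩
  have h := instHasAffinePropertyQuasiCompactCompactSpaceCarrierCarrierCommRingCat
  refine (@HasAffineProperty.iff_of_iSup_eq_top _ _ h _ _ _ _ U this).mpr fun x ↦ ?_
  rw [← isCompact_univ_iff,
    (Scheme.Opens.ι _).isOpenEmbedding.isInducing.isCompact_iff,
    O.ι.isOpenEmbedding.isInducing.isCompact_iff, Set.image_univ,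
    Scheme.Opens.range_ι]
  have : O.ι '' (O.ι ⁻¹ᵁ (U x).1) = X.basicOpen (a x) := by
    ext y
    rw [← Scheme.Hom.coe_image, SetLike.mem_coe, Scheme.Hom.image_preimage_eq_opensRange_inf,
      Scheme.Opens.opensRange_ι]
    constructor
    · rintro ⟨hy1, hy2⟩
      by_contra hy
      refine hy1 ?_
      rw [SetLike.mem_coe, mem_support_iff_of_mem (U := U x) hy2, hU, Scheme.zeroLocus_span]
      simpa [Scheme.mem_zeroLocus_iff] using hy
    · intro hy
      have hy2 := X.basicOpen_le (a x) hy
      refine ⟨fun hy1 ↦ ?_, hy2⟩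
      rw [SetLike.mem_coe, mem_support_iff_of_mem (U := U x) hy2, hU, Scheme.zeroLocus_span] at hy1
      exact (Scheme.mem_zeroLocus_iff _ _ _).mp hy1 _ rfl hy
  rw [this]
  exact ((U x).2.basicOpen (a x)).isCompact

/-- In the chart the complement of the exceptional divisor is `D(f)`, and scheme-theoretic closure
from `D(f)` is contraction of ideals along the localization at `f`. -/
lemma properTransform_comap {V W : Scheme.{u}} {I P : V.IdealSheafData} {ρ : W ⟶ V}
    (hI : IsCartier (I.comap ρ)) {R R' : CommRingCat.{u}} {j : Spec R ⟶ V} {j' : Spec R' ⟶ W}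
    [IsOpenImmersion j'] {φ : R ⟶ R'} (hj : j' ≫ ρ = Spec.map φ ≫ j) {L : Ideal R}
    (hP : P.comap j = idl L) {f : R'} (hf : I.comap (j' ≫ ρ) = idl (Ideal.span {f})) :
    (properTransform I ρ P).comap j' =
      idl (((L.map φ.hom).map (algebraMap R' (Localization.Away f))).comap
        (algebraMap R' (Localization.Away f))) := by
  let O : W.Opens := ρ ⁻¹ᵁ I.support.compl
  have hO : O = (I.comap ρ).support.compl := by rw [support_comap]; rfl
  have : QuasiCompact O.ι := by
    have := IsCartier.quasiCompact_ι hI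
    rwa [← hO] at this
  have hmem : ∀ x, x ∈ Set.range (specAway f) ↔ j' x ∈ O := by
    intro x
    have h : x ∈ (idl (Ideal.span {f})).support ↔ j' x ∉ O := by
      rw [← hf, support_comap]
      exact not_not.symm
    rw [mem_range_specAway, ← not_iff_not, ← h, mem_support_idl, not_not,
      Ideal.span_singleton_le_iff_mem]
  have hrange : Set.range (specAway f ≫ j') ⊆ Set.range O.ι := by
    rintro _ ⟨x, rfl⟩
    rw [Scheme.Opens.range_ι, Scheme.Hom.comp_apply]
    exact (hmem _).mp ⟨x, rfl⟩
  let l := IsOpenImmersion.lift O.ι (specAway f ≫ j') hrange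
  have hl : l ≫ O.ι = specAway f ≫ j' := IsOpenImmersion.lift_fac _ _ _
  have : IsOpenImmersion l := by
    have : IsOpenImmersion (l ≫ O.ι) := by rw [hl]; infer_instance
    exact IsOpenImmersion.of_comp _ O.ι
  have hpb : IsPullback l (specAway f) O.ι j' := by
    refine IsOpenImmersion.isPullback _ _ _ _ hl.symm ?_
    ext x
    exact (by simp : x ∈ (j' ⁻¹ᵁ O.ι.opensRange) ↔ j' x ∈ O).trans (hmem x).symm
  have h := comap_map_of_isPullback hpb.flip (P.comap (O.ι ≫ ρ))
  refine h.trans ?_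
  rw [← comap_comp, reassoc_of% hl, hj, comap_comp, comap_comp, hP, comap_idl, comap_idl, map_idl]
  rfl

/-! ## Blow-ups of coordinate subspaces -/

section Coordinates

open MvPolynomial hiding comap_comp comap_id

variable {σ : Type} {k : Type u} [Field k]

/-- The ideal generated by the variables with index in `S`. -/
abbrev coordIdeal (k : Type u) [Field k] (S : Set σ) : Ideal (MvPolynomial σ k) :=
  Ideal.span (X '' S)

lemma coordIdeal_eq_ker (S : Set σ) [DecidablePred (· ∈ S)] :
    coordIdeal k S = RingHom.ker (aeval fun i ↦ if i ∈ S then 0 else X i :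
      MvPolynomial σ k →ₐ[k] MvPolynomial σ k) := by
  apply le_antisymm
  · rw [Ideal.span_le]
    rintro _ ⟨i, hi, rfl⟩
    simp [hi]
  · intro p hp
    have h : ∀ q : MvPolynomial σ k, q - (aeval fun i ↦ if i ∈ S then 0 else X i :
      MvPolynomial σ k →ₐ[k] MvPolynomial σ k) q ∈ coordIdeal k S := by
      intro q
      induction q using MvPolynomial.induction_on with
      | C a => simp [algebraMap_eq]
      | add p q hp hq =>
        rw [map_add, add_sub_add_comm]
        exact add_mem hp hq
      | mul_X p i hp =>
        rw [map_mul, aeval_X]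
        split_ifs with hi
        · rw [mul_zero, sub_zero]
          exact Ideal.mul_mem_left _ _ (Ideal.subset_span ⟨i, hi, rfl⟩)
        · rw [← sub_mul]
          exact Ideal.mul_mem_right _ _ hp
    rw [RingHom.mem_ker] at hp
    have := h p
    rwa [show _ = _ from hp, sub_zero] at this

lemma coordIdeal_isPrime (S : Set σ) : (coordIdeal k S).IsPrime := by
  classical
  rw [coordIdeal_eq_ker]
  exact RingHom.ker_isPrime _

lemma X_mem_coordIdeal_iff {S : Set σ} {i : σ} : (X i : MvPolynomial σ k) ∈ coordIdeal k S ↔ i ∈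
    S := by
  classical
  refine ⟨fun h ↦ ?_, fun h ↦ Ideal.subset_span ⟨i, h, rfl⟩⟩
  rw [coordIdeal_eq_ker] at h
  by_contra hi
  have : (aeval fun i ↦ if i ∈ S then 0 else X i : MvPolynomial σ k →ₐ[k] MvPolynomial σ k)
    (X i) = 0 := h
  simp [hi] at this

open Classical in
/-- The chart, at the variable with index `i`, of the blow-up of the locus where the variables with
index in `S` vanish. -/
def coordChart (k : Type u) [Field k] (S : Set σ) (i : σ) :
    MvPolynomial σ k →ₐ[k] MvPolynomial σ k :=
  aeval fun l ↦ if l ∈ S ∧ l ≠ i then X l * X i else X l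

@[simp]
lemma coordChart_self (S : Set σ) (i : σ) : coordChart k S i (X i) = X i := by
  simp [coordChart]

lemma coordChart_of_mem {S : Set σ} {i l : σ} (hl : l ∈ S) (h : l ≠ i) :
    coordChart k S i (X l) = X l * X i := by
  simp [coordChart, hl, h]

lemma coordChart_of_notMem {S : Set σ} {i l : σ} (hl : l ∉ S) :
    coordChart k S i (X l) = X l := by
  simp [coordChart, hl]

lemma map_coordChart {S : Set σ} {i : σ} (hi : i ∈ S) :
    (coordIdeal k S).map (coordChart k S i).toRingHom = coordIdeal k {i} := by
  rw [coordIdeal, coordIdeal, Set.image_singleton]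
  rw [Ideal.map_span]
  apply le_antisymm
  · rw [Ideal.span_le]
    rintro _ ⟨_, ⟨l, hl, rfl⟩, rfl⟩
    rw [SetLike.mem_coe, Ideal.mem_span_singleton]
    by_cases h : l = i
    · subst h; exact (coordChart_self S l).symm.dvd
    · exact ⟨X l, (coordChart_of_mem hl h).trans (mul_comm _ _)⟩
  · rw [Ideal.span_singleton_le_iff_mem]
    exact Ideal.subset_span ⟨_, ⟨i, hi, rfl⟩, coordChart_self S i⟩

lemma X_mem_nonZeroDivisors (i : σ) : (X i : MvPolynomial σ k) ∈ nonZeroDivisors _ :=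
  mem_nonZeroDivisors_of_ne_zero (X_ne_zero i)

/-- When `X i` generates the image of the ideal, the other variables in `S` are multiples of it; the
quotients are the images of the new variables, and they are unique because `X i` becomes regular. -/
lemma isBlowupChart_coordChart {S : Set σ} {i : σ} (hi : i ∈ S) :
    IsBlowupChart (R := .of (MvPolynomial σ k)) (R' := .of (MvPolynomial σ k))
      (CommRingCat.ofHom (coordChart k S i).toRingHom) (coordIdeal k S) (X i) := by
  classical
  have h1 : (coordChart k S i).toRingHom (X i) = X i := coordChart_self S i
  constructor
  · exact h1.symm ▸ X_mem_nonZeroDivisors i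
  · exact (map_coordChart hi).trans
      ((congrArg Ideal.span Set.image_singleton).trans (congrArg (fun x ↦ Ideal.span {x}) h1.symm))
  · intro T ψ h2 h3
    have : ∀ l : S, ∃ t, ψ.hom (X l.1) = ψ.hom (X i) * t := fun l ↦
      Ideal.mem_span_singleton.mp
        (h3.le (Ideal.mem_map_of_mem _ (Ideal.subset_span ⟨l.1, l.2, rfl⟩)))
    choose t ht using this
    refine ⟨CommRingCat.ofHom (eval₂Hom (ψ.hom.comp C)
      fun l ↦ if h : l ∈ S ∧ l ≠ i then t ⟨l, h.1⟩ else ψ.hom (X l)), ?_⟩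
    ext : 1
    apply MvPolynomial.ringHom_ext
    · intro a
      simp [coordChart, algebraMap_eq]
    · intro l
      by_cases hl : l ∈ S
      · by_cases hli : l = i
        · subst hli; simp
        · simp [coordChart_of_mem hl hli, hl, hli, ht ⟨l, hl⟩, mul_comm (t _)]
      · simp [coordChart_of_notMem hl, hl]
  · intro T χ χ' h2 h3
    have h4 : ∀ p, χ.hom (coordChart k S i p) = χ'.hom (coordChart k S i p) := fun p ↦
      congr($(h3).hom p)
    have h5 := h4 (X i)
    rw [coordChart_self] at h5
    ext : 1
    apply MvPolynomial.ringHom_ext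
    · intro a
      simpa [coordChart, algebraMap_eq] using h4 (C a)
    · intro l
      by_cases hl : l ∈ S
      · by_cases hli : l = i
        · subst hli; exact h5
        · have h6 := h4 (X l)
          rw [coordChart_of_mem hl hli, map_mul, map_mul, ← h5] at h6
          rw [CommRingCat.hom_ofHom] at h2
          erw [coordChart_self] at h2
          exact (mul_cancel_right_mem_nonZeroDivisors h2).mp h6
      · simpa [coordChart_of_notMem hl] using h4 (X l)

/-- The charts found are again affine spaces with the same set of coordinates, which is what permits
iteration. -/
lemma IsBlowup.exists_coordChart {V W : Scheme.{u}} {I : V.IdealSheafData} {ρ : W ⟶ V}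
    (hρ : IsBlowup I ρ) {j : Spec (.of (MvPolynomial σ k)) ⟶ V} [IsOpenImmersion j] {S : Set σ}
    (hI : I.comap j = idl (coordIdeal k S)) {w : W} (hw : ρ w ∈ Set.range j) :
    ∃ i ∈ S, ∃ (j' : Spec (.of (MvPolynomial σ k)) ⟶ W) (_ : IsOpenImmersion j'),
      w ∈ Set.range j' ∧ j' ≫ ρ = Spec.map (CommRingCat.ofHom (coordChart k S i).toRingHom) ≫ j ∧
      (I.comap ρ).comap j' = idl (coordIdeal k {i}) := by
  obtain ⟨_, ⟨i, hi, rfl⟩, A, c, hc, ψ, hw, h1, h2, h3⟩ := hρ.exists_generator hI hw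
  obtain ⟨j', hj', h4, h5⟩ := hρ.exists_chart hI (isBlowupChart_coordChart hi)
    (Ideal.subset_span ⟨i, hi, rfl⟩)
  refine ⟨i, hi, j', hj', h5 c ψ h1 h2 h3 hw, h4, ?_⟩
  rw [← comap_comp, h4, comap_comp, hI, comap_idl]
  exact congrArg _ (map_coordChart hi)

/-- Off the exceptional divisor `X i` is a unit. If `i ∈ T`, nothing is left there. Otherwise each
`X l` with `l ∈ T` becomes `X l * X i`, so the ideal of `T` is unchanged by inverting `X i`, and
being prime without `X i` it is recovered by contraction. -/
lemma properTransform_comap_coordChart {V W : Scheme.{u}} {I P : V.IdealSheafData} {ρ : W ⟶ V}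
    (hρ : IsBlowup I ρ) {j : Spec (.of (MvPolynomial σ k)) ⟶ V} {S T : Set σ} (hT : T ⊆ S)
    (hP : P.comap j = idl (coordIdeal k T)) {i : σ}
    {j' : Spec (.of (MvPolynomial σ k)) ⟶ W} [IsOpenImmersion j']
    (hj : j' ≫ ρ = Spec.map (CommRingCat.ofHom (coordChart k S i).toRingHom) ≫ j)
    (hI : (I.comap ρ).comap j' = idl (coordIdeal k {i})) :
    (i ∈ T → (properTransform I ρ P).comap j' = ⊤) ∧
    (i ∉ T → (properTransform I ρ P).comap j' = idl (coordIdeal k T)) := by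
  rw [← comap_comp] at hI
  rw [coordIdeal, Set.image_singleton] at hI
  rw [properTransform_comap hρ.isCartier hj hP hI]
  have hu : IsUnit (algebraMap (MvPolynomial σ k)
      (Localization.Away (X i : MvPolynomial σ k)) (X i)) := IsLocalization.Away.algebraMap_isUnit _
  constructor
  · intro hi
    rw [idl_eq_top, Ideal.comap_eq_top_iff]
    refine Ideal.eq_top_of_isUnit_mem _ (Ideal.mem_map_of_mem _ ?_) hu
    have := Ideal.mem_map_of_mem (coordChart k S i).toRingHom
      (Ideal.subset_span ⟨i, hi, rfl⟩ : (X i : MvPolynomial σ k) ∈ coordIdeal k T)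
    have h1 : (coordChart k S i).toRingHom (X i) = X i := coordChart_self S i
    rwa [h1] at this
  · intro hi
    congr 1
    have h1 : ((coordIdeal k T).map (coordChart k S i).toRingHom).map (algebraMap _
        (Localization.Away (X i : MvPolynomial σ k))) = (coordIdeal k T).map (algebraMap _
        (Localization.Away (X i : MvPolynomial σ k))) := by
      rw [Ideal.map_map, Ideal.map_span, Ideal.map_span]
      have h2 : ∀ l ∈ T, (coordChart k S i).toRingHom (X l) = X l * X i := fun l hl ↦
        coordChart_of_mem (hT hl) (by rintro rfl; exact hi hl)
      apply le_antisymm <;> rw [Ideal.span_le]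
      · rintro _ ⟨_, ⟨l, hl, rfl⟩, rfl⟩
        rw [RingHom.comp_apply, h2 l hl, map_mul]
        exact Ideal.mul_mem_right _ _ (Ideal.subset_span ⟨_, ⟨l, hl, rfl⟩, rfl⟩)
      · rintro _ ⟨_, ⟨l, hl, rfl⟩, rfl⟩
        rw [SetLike.mem_coe, ← Ideal.mul_unit_mem_iff_mem _ hu]
        refine Ideal.subset_span ⟨_, ⟨l, hl, rfl⟩, ?_⟩
        rw [RingHom.comp_apply, h2 l hl, map_mul]
    refine (congrArg _ h1).trans ?_
    have := coordIdeal_isPrime (k := k) T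
    apply IsLocalization.under_map_of_isPrime_disjoint (Submonoid.powers (X i : MvPolynomial σ k))
    · exact this
    · rw [Set.disjoint_left]
      rintro _ ⟨n, rfl⟩ h
      exact hi (X_mem_coordIdeal_iff.mp (this.mem_of_pow_mem n h))

end Coordinates

/-! ## Toric charts -/

section Toric

open MvPolynomial hiding comap_comp comap_id

/-- The coordinates on the charts: two rows of three variables each, and two more variables. -/
abbrev Coord : Type := Fin 2 × Fin 3 ⊕ Fin 2

variable (k : Type u) [Field k]

/-- The coordinate ring of the charts. -/
abbrev ChartRing : CommRingCat.{u} := .of (MvPolynomial Coord k)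

variable {k}

/-- The combinatorial data of a monomial map from a chart: in the row with index `r`, the variable
with index `j` is multiplied by the monomial with exponents `e r 0`, `e r 1` in the variables
`(0, o 0)`, `(1, o 1)` and, if `j = o r`, the variable itself is replaced by `1`. -/
structure ToricChart where
  o : Fin 2 → Option (Fin 3)
  e : Fin 2 → Fin 2 → ℕ
  -- An untouched row has no distinguished variable, so `var` is `1` and the exponents on it are
  -- mere bookkeeping. With the values of the identity matrix, the first blow-up in that row follows
  -- the same addition rule as all later ones.
  self_of_none : ∀ c, o c = none → e c c = 1
  rev_of_none : ∀ c, o c = none → e c.rev c = 0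
  -- Unimodularity ensures in the end that not all differences of exponents vanish.
  det : e 0 0 * e 1 1 = e 0 1 * e 1 0 + 1

namespace ToricChart

/-- The variable whose powers appear as factors, if any. -/
def var (k : Type u) [Field k] (s : ToricChart) (c : Fin 2) : MvPolynomial Coord k :=
  (s.o c).elim 1 fun j ↦ X (.inl (c, j))

/-- The monomial by which a row is multiplied. -/
def factor (k : Type u) [Field k] (s : ToricChart) (r : Fin 2) : MvPolynomial Coord k :=
  s.var k 0 ^ s.e r 0 * s.var k 1 ^ s.e r 1

/-- The variables, with the chosen ones replaced by `1`. -/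
def entry (k : Type u) [Field k] (s : ToricChart) (r : Fin 2) (j : Fin 3) : MvPolynomial Coord k :=
  if s.o r = some j then 1 else X (.inl (r, j))

/-- The monomial map. -/
def hom (k : Type u) [Field k] (s : ToricChart) : MvPolynomial Coord k →ₐ[k] MvPolynomial Coord k :=
  aeval (Sum.elim (fun i ↦ s.factor k i.1 * s.entry k i.1 i.2) (fun t ↦ X (.inr t)))

/-- The identity chart. -/
def init : ToricChart where
  o _ := none
  e r c := if r = c then 1 else 0
  self_of_none := by simp
  rev_of_none := by decide
  det := by simp

/-- The indices of the variables defining the center in a given row. -/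
def idx (s : ToricChart) (c : Fin 2) : Set Coord :=
  {i | ∃ j, (s.o c = none ∨ s.o c = some j) ∧ i = .inl (c, j)}

/-- The monomial map obtained after blowing up. -/
def blow (s : ToricChart) (ε : Fin 2) (j : Fin 3) : ToricChart where
  o := Function.update s.o ε (some j)
  -- In the new chart the equation of the other exceptional divisor, if there is one, acquires the
  -- new variable as a factor, so the exponents of both old variables are added up.
  e r c := if c = ε then s.e r 0 + s.e r 1 else s.e r c
  self_of_none c hc := by
    have h : c ≠ ε := by rintro rfl; simp at hc
    simp only [ne_eq, h, not_false_eq_true, Function.update_of_ne] at hc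
    simpa [h] using s.self_of_none c hc
  rev_of_none c hc := by
    have h : c ≠ ε := by rintro rfl; simp at hc
    simp only [ne_eq, h, not_false_eq_true, Function.update_of_ne] at hc
    simpa [h] using s.rev_of_none c hc
  det := by
    have := s.det
    fin_cases ε
    · simp; linear_combination this
    · simp; linear_combination this

lemma hom_init : init.hom k = AlgHom.id k _ := by
  ext i
  rcases i with ⟨r, j⟩ | t
  · simp [hom, init, factor, entry, var]
  · simp [hom]

lemma mem_idx {s : ToricChart} {c c' : Fin 2} {l : Fin 3} :
    (Sum.inl (c, l) : Coord) ∈ s.idx c' ↔ c = c' ∧ (s.o c = none ∨ s.o c = some l) := by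
  constructor
  · rintro ⟨j, h, hj⟩
    simp only [Sum.inl.injEq, Prod.mk.injEq] at hj
    obtain ⟨rfl, rfl⟩ := hj
    exact ⟨rfl, h⟩
  · rintro ⟨rfl, h⟩
    exact ⟨l, h, rfl⟩

lemma coordChart_X_inl (s : ToricChart) (ε : Fin 2) (j : Fin 3) (r : Fin 2) (l : Fin 3) :
    coordChart k (s.idx 0 ∪ s.idx 1) (.inl (ε, j)) (X (.inl (r, l))) =
      if (s.o r = none ∨ s.o r = some l) ∧ ¬ (r = ε ∧ l = j) then
        X (.inl (r, l)) * X (.inl (ε, j)) else X (.inl (r, l)) := by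
  have : (Sum.inl (r, l) : Coord) ∈ s.idx 0 ∪ s.idx 1 ↔ s.o r = none ∨ s.o r = some l := by
    rw [Set.mem_union, mem_idx, mem_idx]
    fin_cases r <;> simp
  simp [coordChart, this]

/-- A case check on which rows are untouched. In an untouched row every variable acquires the new
one as a factor; this contributes the exponent which the conventions on `none` had recorded in
advance. -/
lemma blow_hom (s : ToricChart) (ε : Fin 2) (j : Fin 3) (hj : s.o ε = none ∨ s.o ε = some j) :
    (coordChart k (s.idx 0 ∪ s.idx 1) (.inl (ε, j))).comp (s.hom k) = (s.blow ε j).hom k := by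
  have h0 := s.self_of_none 0
  have h1 := s.self_of_none 1
  have h0' := s.rev_of_none 0
  have h1' := s.rev_of_none 1
  apply MvPolynomial.algHom_ext
  intro i
  rcases i with ⟨r, l⟩ | t
  · simp only [AlgHom.comp_apply, hom, aeval_X, Sum.elim_inl, factor, entry, var, map_mul, map_pow]
    obtain rfl | rfl : ε = 0 ∨ ε = 1 := by fin_cases ε <;> simp
    all_goals
      obtain rfl | rfl : r = 0 ∨ r = 1 := by fin_cases r <;> simp
    all_goals
      rcases e0 : s.o 0 with _ | t0 <;> rcases e1 : s.o 1 with _ | t1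
    all_goals
      simp only [e0, e1, reduceCtorEq, false_or, true_or, Option.some.injEq, forall_const,
          false_imp_iff, Fin.rev_zero, Fin.reduceLast, Fin.reduceRev] at hj h0 h1 h0' h1'
    all_goals
      try subst hj
    all_goals
      simp only [e0, e1, blow, h0, h1, h0', h1', Option.elim_none, Option.elim_some,
          coordChart_X_inl, ne_eq, Function.update_self, zero_ne_one, one_ne_zero,
          not_false_eq_true,
         Function.update_of_ne, map_one, one_pow, ite_true, ite_false]
    all_goals
      split_ifs <;> simp_all [coordChart_X_inl]
    all_goals
      try rw [if_neg (Ne.symm ‹_›)]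
    all_goals try ring
  · simp [hom, coordChart, idx]

/-- The difference of the exponents of a variable in the `n`-th power of the first monomial and in
the `m`-th power of the second one. -/
def deg (s : ToricChart) (n m : ℕ) (c : Fin 2) : ℤ := n * s.e 0 c - m * s.e 1 c

/-- One subtraction of the Euclidean algorithm, when the two differences have opposite signs. -/
lemma deg_blow_self (s : ToricChart) (n m : ℕ) (ε : Fin 2) (j : Fin 3) :
    (s.blow ε j).deg n m ε = s.deg n m ε + s.deg n m ε.rev := by
  obtain rfl | rfl : ε = 0 ∨ ε = 1 := by fin_cases ε <;> simp
  · simp [deg, blow]; ring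
  · simp [deg, blow]; ring

lemma deg_blow_of_ne (s : ToricChart) (n m : ℕ) {ε c : Fin 2} (h : c ≠ ε) (j : Fin 3) :
    (s.blow ε j).deg n m c = s.deg n m c := by
  simp [deg, blow, h]

lemma idx_blow_self (s : ToricChart) (ε : Fin 2) (j : Fin 3) :
    (s.blow ε j).idx ε = {.inl (ε, j)} := by
  ext i
  simp [idx, blow]

lemma idx_blow_of_ne (s : ToricChart) {ε c : Fin 2} (h : c ≠ ε) (j : Fin 3) :
    (s.blow ε j).idx c = s.idx c := by
  ext i
  simp [idx, blow, h]

/-- The sign of the exponents in a row. -/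
def sgn (c : Fin 2) : ℤ := if c = 0 then 1 else -1

lemma sgn_rev (c : Fin 2) : sgn c.rev = - sgn c := by
  fin_cases c <;> simp [sgn]

lemma sgn_mul_sgn (c : Fin 2) : sgn c * sgn c = 1 := by
  fin_cases c <;> simp [sgn]

lemma rev_ne (c : Fin 2) : c.rev ≠ c := by
  fin_cases c <;> simp

lemma eq_or_eq_rev (c d : Fin 2) : d = c ∨ d = c.rev := by
  fin_cases c <;> fin_cases d <;> simp

lemma idx_union (s : ToricChart) (c : Fin 2) : s.idx c ∪ s.idx c.rev = s.idx 0 ∪ s.idx 1 := by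
  fin_cases c
  · rfl
  · exact Set.union_comm _ _

/-- After dividing by a power of a monomial, one row of the chart has an entry `1`, and the
monomial which multiplies it has exponents at most those of the other one. -/
def IsTerminal (s : ToricChart) (n m : ℕ) : Prop :=
  ∃ r, s.o r ≠ none ∧ ∀ c, sgn r * s.deg n m c ≤ 0

/-- The chart `j'` is mapped to the chart `j` compatibly with the monomial maps. -/
def Over (k : Type u) [Field k] (s s' : ToricChart) {V W : Scheme.{u}} (π : W ⟶ V)
    (j : Spec (ChartRing k) ⟶ V) (j' : Spec (ChartRing k) ⟶ W) : Prop :=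
  ∃ β : ChartRing k ⟶ ChartRing k, j' ≫ π = Spec.map β ≫ j ∧
    CommRingCat.ofHom (s.hom k).toRingHom ≫ β = CommRingCat.ofHom (s'.hom k).toRingHom

lemma Over.trans {s s' s'' : ToricChart} {V W T : Scheme.{u}} {π : W ⟶ V} {ρ : T ⟶ W}
    {j : Spec (ChartRing k) ⟶ V} {j' : Spec (ChartRing k) ⟶ W} {j'' : Spec (ChartRing k) ⟶ T}
    (h : Over k s s' π j j') (h' : Over k s' s'' ρ j' j'') : Over k s s'' (ρ ≫ π) j j'' := by
  obtain ⟨β, h1, h2⟩ := h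
  obtain ⟨β', h1', h2'⟩ := h'
  refine ⟨β ≫ β', ?_, by rw [reassoc_of% h2, h2']⟩
  rw [reassoc_of% h1', h1, Spec.map_comp, Category.assoc]

lemma Over.of_comp_eq {s s' : ToricChart} {V W T : Scheme.{u}} {π : W ⟶ V} {ρ : T ⟶ W}
    {j : Spec (ChartRing k) ⟶ V} {j' : Spec (ChartRing k) ⟶ W} {j'' : Spec (ChartRing k) ⟶ T}
    (h : Over k s s' π j j') (h' : j'' ≫ ρ = j') : Over k s s' (ρ ≫ π) j j'' := by
  obtain ⟨β, h1, h2⟩ := h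
  exact ⟨β, by rw [reassoc_of% h', h1], h2⟩

/-- In a chart at a variable of the row `r`, the exceptional divisor and the proper transform of `P`
are again the two coordinate subspaces attached to the rows, so the next center has the same shape.
In a chart at a variable of the other row the proper transform is empty, and the later centers miss
the chart. -/
lemma exists_chart_of_isBlowup {V W : Scheme.{u}} {B P : V.IdealSheafData} {ρ : W ⟶ V}
    (hρ : IsBlowup B ρ) (j : Spec (ChartRing k) ⟶ V) [IsOpenImmersion j] (s : ToricChart)
    (r : Fin 2) (hB : B.comap j = idl (coordIdeal k (s.idx 0 ∪ s.idx 1)))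
    (hP : P.comap j = idl (coordIdeal k (s.idx r.rev))) {w : W} (hw : ρ w ∈ Set.range j) :
    ∃ (j' : Spec (ChartRing k) ⟶ W) (_ : IsOpenImmersion j') (s' : ToricChart),
      w ∈ Set.range j' ∧ Over k s s' ρ j j' ∧
      ((s'.o r ≠ none ∧ (∀ n m, s'.deg n m r = s.deg n m r + s.deg n m r.rev) ∧
        (∀ n m, s'.deg n m r.rev = s.deg n m r.rev) ∧
        (B.comap ρ).comap j' = idl (coordIdeal k (s'.idx r)) ∧
        (properTransform B ρ P).comap j' = idl (coordIdeal k (s'.idx r.rev))) ∨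
      (s'.o r.rev ≠ none ∧ (∀ n m, s'.deg n m r = s.deg n m r) ∧
        (∀ n m, s'.deg n m r.rev = s.deg n m r + s.deg n m r.rev) ∧
        (properTransform B ρ P).comap j' = ⊤)) := by
  obtain ⟨i, hi, j', hj', hw, h1, h2⟩ := hρ.exists_coordChart hB hw
  obtain ⟨ε, l, hl, rfl⟩ : ∃ ε l, (s.o ε = none ∨ s.o ε = some l) ∧ i = .inl (ε, l) := by
    rcases hi with ⟨l, hl⟩ | ⟨l, hl⟩
    exacts [⟨0, l, hl⟩, ⟨1, l, hl⟩]
  have hsub : s.idx r.rev ⊆ s.idx 0 ∪ s.idx 1 := by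
    rw [← s.idx_union r]; exact Set.subset_union_right
  obtain ⟨h3, h4⟩ := properTransform_comap_coordChart hρ hsub hP h1 h2
  refine ⟨j', hj', s.blow ε l, hw, ⟨_, h1, ?_⟩, ?_⟩
  · rw [← CommRingCat.ofHom_comp]
    exact congrArg (fun f : _ →ₐ[k] _ ↦ CommRingCat.ofHom f.toRingHom) (s.blow_hom (k := k) ε l hl)
  rcases eq_or_eq_rev r ε with rfl | rfl
  · refine Or.inl ⟨by simp [blow], fun n m ↦ deg_blow_self _ _ _ _ _,
      fun n m ↦ deg_blow_of_ne _ _ _ (rev_ne _) _, ?_, ?_⟩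
    · rw [idx_blow_self, h2]
    · rw [idx_blow_of_ne _ (rev_ne _)]
      exact h4 fun h ↦ rev_ne _ (mem_idx.mp h).1.symm
  · refine Or.inr ⟨by simp [blow], fun n m ↦ deg_blow_of_ne _ _ _ (rev_ne _).symm _,
      fun n m ↦ ?_, ?_⟩
    · rw [deg_blow_self, Fin.rev_rev, add_comm]
    · exact h3 (mem_idx.mpr ⟨rfl, hl⟩)

end ToricChart

/-- All centers lie over `B`, so nothing changes over an open chart which misses `B`. -/
lemma IsDirectedBlowup.exists_lift {V W : Scheme.{u}} {B P : V.IdealSheafData} {l : ℕ} {π : W ⟶ V}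
    {E Q : W.IdealSheafData} (h : IsDirectedBlowup B P l π E Q) {U : Scheme.{u}} (j : U ⟶ V)
    [IsOpenImmersion j] (hB : B.comap j = ⊤) :
    ∃ (j' : U ⟶ W) (_ : IsOpenImmersion j'), j' ≫ π = j ∧
      (∀ w, π w ∈ Set.range j → w ∈ Set.range j') ∧ E.comap j' = ⊤ := by
  induction h with
  | one ρ hρ =>
    obtain ⟨j', hj', h1, h2⟩ := hρ.exists_lift j (hB ▸ isCartier_top)
    exact ⟨j', hj', h1, h2, by rw [← comap_comp, h1, hB]⟩
  | @succ l W₁ W₂ π E Q h ρ hρ ih =>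
    obtain ⟨j₁, hj₁, h1, h2, h3⟩ := ih
    have h4 : IsOpenImmersion j₁ := hj₁
    have h5 : (E ⊔ Q).comap j₁ = ⊤ := by
      rw [comap_sup, h3, top_sup_eq]
    obtain ⟨j', hj', h1', h2'⟩ := hρ.exists_lift j₁ (h5 ▸ isCartier_top)
    refine ⟨j', hj', by rw [reassoc_of% h1', h1], fun w hw ↦ h2' _ (h2 _ ?_), ?_⟩
    · rwa [Scheme.Hom.comp_apply] at hw
    · rw [← comap_comp, h1', h5]

lemma IsEuclideanBlowup.exists_lift {V W : Scheme.{u}} {B P : V.IdealSheafData} {n m : ℕ}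
    {π : W ⟶ V} (h : IsEuclideanBlowup n m B P π) {U : Scheme.{u}} (j : U ⟶ V)
    [IsOpenImmersion j] (hB : B.comap j = ⊤) :
    ∃ (j' : U ⟶ W) (_ : IsOpenImmersion j'), j' ≫ π = j ∧
      (∀ w, π w ∈ Set.range j → w ∈ Set.range j') := by
  induction h with
  | last hr h =>
    obtain ⟨j', hj', h1, h2, -⟩ := h.exists_lift j hB
    exact ⟨j', hj', h1, h2⟩
  | step hr h hσ ih =>
    obtain ⟨j₁, hj₁, h1, h2, h3⟩ := h.exists_lift j hB
    obtain ⟨j', hj', h1', h2'⟩ := ih j₁ (by rw [comap_sup, h3, top_sup_eq])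
    refine ⟨j', hj', by rw [reassoc_of% h1', h1], fun w hw ↦ h2' _ (h2 _ ?_)⟩
    rwa [Scheme.Hom.comp_apply] at hw

lemma comap_sup_eq_coordIdeal {V : Scheme.{u}} {E Q : V.IdealSheafData}
    {j : Spec (ChartRing k) ⟶ V} {s : ToricChart} {r : Fin 2}
    (hE : E.comap j = idl (coordIdeal k (s.idx r)))
    (hQ : Q.comap j = idl (coordIdeal k (s.idx r.rev))) :
    (E ⊔ Q).comap j = idl (coordIdeal k (s.idx 0 ∪ s.idx 1)) := by
  rw [comap_sup, hE, hQ, ← idl_sup, ← s.idx_union r, coordIdeal, coordIdeal, coordIdeal,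
    Set.image_union, Ideal.span_union]

open ToricChart

/-- Along the proper transform of `P`, `l` blow-ups replace the normalized differences `(N, -M)` by
`(N - l * M, -M)`. A chart which leaves the proper transform at some stage has two nonnegative
differences there, because `l * M ≤ N`; it is terminal and is not touched again. -/
lemma IsDirectedBlowup.exists_chart {V W : Scheme.{u}} {B P : V.IdealSheafData} {l : ℕ} {π : W ⟶ V}
    {E Q : W.IdealSheafData} (h : IsDirectedBlowup B P l π E Q) (j : Spec (ChartRing k) ⟶ V)
    [IsOpenImmersion j] (s : ToricChart) (r : Fin 2)
    (hB : B.comap j = idl (coordIdeal k (s.idx 0 ∪ s.idx 1)))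
    (hP : P.comap j = idl (coordIdeal k (s.idx r.rev))) {n m N M : ℕ}
    (hN : s.deg n m r = sgn r * N) (hM : s.deg n m r.rev = - sgn r * M) (hl : l * M ≤ N)
    {w : W} (hw : π w ∈ Set.range j) :
    ∃ (j' : Spec (ChartRing k) ⟶ W) (_ : IsOpenImmersion j') (s' : ToricChart),
      w ∈ Set.range j' ∧ Over k s s' π j j' ∧
      ((s'.o r ≠ none ∧ s'.deg n m r = sgn r * (N - l * M) ∧ s'.deg n m r.rev = - sgn r * M ∧
        E.comap j' = idl (coordIdeal k (s'.idx r)) ∧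
        Q.comap j' = idl (coordIdeal k (s'.idx r.rev))) ∨
      (s'.IsTerminal n m ∧ (E ⊔ Q).comap j' = ⊤)) := by
  -- If both differences have the sign of the row `r`, the monomial of the row `r.rev` is the
  -- smaller one.
  have hterm : ∀ {s' : ToricChart} {x y : ℤ}, s'.o r.rev ≠ none → s'.deg n m r = sgn r * x →
      s'.deg n m r.rev = sgn r * y → 0 ≤ x → 0 ≤ y → s'.IsTerminal n m := by
    intro s' x y h1 h2 h3 hx hy
    refine ⟨r.rev, h1, fun c ↦ ?_⟩
    have := sgn_mul_sgn r
    rcases eq_or_eq_rev r c with rfl | rfl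
    · rw [h2, sgn_rev]; linear_combination hx - x * this
    · rw [h3, sgn_rev]; linear_combination hy - y * this
  induction h with
  | one ρ hρ =>
    obtain ⟨j', hj', s', hw, ho, h | h⟩ := exists_chart_of_isBlowup hρ j s r hB hP hw
    · obtain ⟨h1, h2, h3, h4, h5⟩ := h
      refine ⟨j', hj', s', hw, ho, Or.inl ⟨h1, ?_, ?_, h4, h5⟩⟩
      · rw [h2, hN, hM]; push_cast; ring
      · rw [h3, hM]
    · obtain ⟨h1, h2, h3, h4⟩ := h
      refine ⟨j', hj', s', hw, ho, Or.inr ⟨?_, by rw [comap_sup, h4, sup_top_eq]⟩⟩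
      refine hterm (x := N) (y := N - M) h1 (by rw [h2, hN]) (by rw [h3, hN, hM]; ring)
        (by positivity) ?_
      rw [one_mul] at hl
      exact sub_nonneg.mpr (by exact_mod_cast hl)
  | @succ l W₁ W₂ π E Q h ρ hρ ih =>
    have hl' : l * M ≤ N := (Nat.mul_le_mul_right M (Nat.le_succ l)).trans hl
    rw [Scheme.Hom.comp_apply] at hw
    obtain ⟨j₁, hj₁, s₁, hw₁, ho₁, h₁ | h₁⟩ := ih hl' hw
    · obtain ⟨h1, h2, h3, h4, h5⟩ := h₁
      obtain ⟨j', hj', s', hw', ho', h' | h'⟩ := exists_chart_of_isBlowup hρ j₁ s₁ r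
        (comap_sup_eq_coordIdeal h4 h5) h5 hw₁
      · obtain ⟨h1', h2', h3', h4', h5'⟩ := h'
        refine ⟨j', hj', s', hw', ho₁.trans ho', Or.inl ⟨h1', ?_, ?_, h4', h5'⟩⟩
        · rw [h2', h2, h3]; push_cast; ring
        · rw [h3', h3]
      · obtain ⟨h1', h2', h3', h4'⟩ := h'
        refine ⟨j', hj', s', hw', ho₁.trans ho',
          Or.inr ⟨?_, by rw [comap_sup, h4', sup_top_eq]⟩⟩
        refine hterm (x := N - l * M) (y := N - (l + 1 : ℕ) * M) h1' (by rw [h2', h2])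
          (by rw [h3', h2, h3]; push_cast; ring) ?_ ?_
        · exact sub_nonneg.mpr (by exact_mod_cast hl')
        · exact sub_nonneg.mpr (by exact_mod_cast hl)
    · obtain ⟨h1, h2⟩ := h₁
      obtain ⟨j', hj', h3, h4⟩ := hρ.exists_lift j₁ (h2 ▸ isCartier_top)
      refine ⟨j', hj', s₁, h4 _ hw₁, ho₁.of_comp_eq h3, Or.inr ⟨h1, ?_⟩⟩
      rw [comap_sup, ← comap_comp, h3, h2, top_sup_eq]

/-- A directed blow-up leaves the remainder `N % M` as the difference for the row `r`. If it is zero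
the differences already have a common weak sign, with the row `r` having the smaller monomial;
otherwise the rows exchange their roles. -/
lemma IsEuclideanBlowup.exists_chart {V W : Scheme.{u}} {B P : V.IdealSheafData} {N M : ℕ}
    {π : W ⟶ V} (h : IsEuclideanBlowup N M B P π) (hM0 : 0 < M) (hMN : M ≤ N)
    (j : Spec (ChartRing k) ⟶ V) [IsOpenImmersion j] (s : ToricChart) (r : Fin 2)
    (hB : B.comap j = idl (coordIdeal k (s.idx 0 ∪ s.idx 1)))
    (hP : P.comap j = idl (coordIdeal k (s.idx r.rev))) {n m : ℕ}
    (hN : s.deg n m r = sgn r * N) (hM : s.deg n m r.rev = - sgn r * M)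
    {w : W} (hw : π w ∈ Set.range j) :
    ∃ (j' : Spec (ChartRing k) ⟶ W) (_ : IsOpenImmersion j') (s' : ToricChart),
      w ∈ Set.range j' ∧ Over k s s' π j j' ∧ s'.IsTerminal n m := by
  induction h generalizing s r with
  | @last N M V W B P π E Q hr h =>
    obtain ⟨j', hj', s', hw', ho', h' | h'⟩ :=
      h.exists_chart j s r hB hP hN hM (Nat.div_mul_le_self _ _) hw
    · refine ⟨j', hj', s', hw', ho', r, h'.1, fun c ↦ ?_⟩
      have h1 : (N : ℤ) - (N / M : ℕ) * M = 0 := by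
        rw [sub_eq_zero]
        exact_mod_cast (Nat.div_mul_cancel (Nat.dvd_of_mod_eq_zero hr)).symm
      have := sgn_mul_sgn r
      rcases eq_or_eq_rev r c with rfl | rfl
      · rw [h'.2.1, h1]; simp
      · rw [h'.2.2.1]
        have : (0 : ℤ) ≤ M := by positivity
        nlinarith
    · exact ⟨j', hj', s', hw', ho', h'.1⟩
  | @step N M V V' W B P π E Q σ hr h hσ ih =>
    rw [Scheme.Hom.comp_apply] at hw
    obtain ⟨j₁, hj₁, s₁, hw₁, ho₁, h₁ | h₁⟩ :=
      h.exists_chart j s r hB hP hN hM (Nat.div_mul_le_self _ _) hw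
    · obtain ⟨h1, h2, h3, h4, h5⟩ := h₁
      have h6 : (N : ℤ) - (N / M : ℕ) * M = (N % M : ℕ) := by
        rw [sub_eq_iff_eq_add]
        exact_mod_cast (Nat.mod_add_div' N M).symm
      -- The new direction is the exceptional divisor, attached to the row `r = r.rev.rev`; the data
      -- are now `(M, N % M)`, with opposite signs.
      obtain ⟨j', hj', s', hw', ho', ht⟩ := ih (Nat.pos_of_ne_zero hr) (Nat.mod_lt _ hM0).le j₁ s₁
        r.rev (comap_sup_eq_coordIdeal h4 h5) (by rw [Fin.rev_rev]; exact h4)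
        (by rw [h3, sgn_rev]) (by rw [Fin.rev_rev, h2, h6, sgn_rev, neg_neg]) hw₁
      exact ⟨j', hj', s', hw', ho₁.trans ho', ht⟩
    · obtain ⟨j', hj', h3, h4⟩ := hσ.exists_lift j₁ h₁.2
      exact ⟨j', hj', s₁, h4 _ hw₁, ho₁.of_comp_eq h3, h₁.1⟩

end Toric

/-! ## Morphisms to projective spaces -/

section ProjectiveSpace

open MvPolynomial hiding comap_comp comap_id algebraMap_apply
open HomogeneousLocalization

variable {k : Type u} [Field k] {ι : Type}

lemma ringHom_eq_pow_mul {R : Type*} [CommRing R] {φ φ' : MvPolynomial ι k →+* R} {t : R}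
    (hC : ∀ c, φ' (C c) = φ (C c)) (hX : ∀ i, φ' (X i) = t * φ (X i)) {n : ℕ}
    {p : MvPolynomial ι k} (hp : p.IsHomogeneous n) : φ' p = t ^ n * φ p := by
  rw [p.as_sum, map_sum, map_sum, Finset.mul_sum]
  refine Finset.sum_congr rfl fun a ha ↦ ?_
  rw [monomial_eq, map_mul, map_mul, hC, Finsupp.prod, map_prod, map_prod]
  have h1 : a.sum (fun _ e ↦ e) = n := by
    have := hp (mem_support_iff.mp ha)
    rw [← this, Finsupp.weight_apply]
    simp [Finsupp.sum]
  simp only [map_pow, hX, mul_pow, Finset.prod_mul_distrib, Finset.prod_pow_eq_pow_sum]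
  rw [← h1, Finsupp.sum]
  ring

lemma X_mem_homogeneousSubmodule (i : ι) : (X i : MvPolynomial ι k) ∈ (homogeneousSubmodule ι k)
    1 :=
  isHomogeneous_X k i

/-- A ring homomorphism which maps `f` to a unit can be evaluated at homogeneous fractions whose
denominator is a power of `f`. -/
def evalAway {R : Type u} [CommRing R] (φ : MvPolynomial ι k →+* R) {f : MvPolynomial ι k}
    (hu : IsUnit (φ f)) : Away (homogeneousSubmodule ι k) f →+* R :=
  (IsLocalization.Away.lift (S := Localization.Away f) f hu).comp
    (algebraMap (Away (homogeneousSubmodule ι k) f) (Localization.Away f))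

lemma evalAway_mk {R : Type u} [CommRing R] (φ : MvPolynomial ι k →+* R) {f : MvPolynomial ι k}
    (hu : IsUnit (φ f)) {d : ℕ} (hf : f ∈ (homogeneousSubmodule ι k) d) (n : ℕ)
        (x : MvPolynomial ι k)
    (hx : x ∈ (homogeneousSubmodule ι k) (n • d)) :
    φ f ^ n * evalAway φ hu (Away.mk (homogeneousSubmodule ι k) hf n x hx) = φ x := by
  rw [evalAway, RingHom.comp_apply, HomogeneousLocalization.algebraMap_apply, Away.val_mk]
  have h : algebraMap _ (Localization.Away f) (f ^ n) * Localization.mk x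
      (⟨f ^ n, n, rfl⟩ : Submonoid.powers f) =
      algebraMap _ (Localization.Away f) x := by
    rw [Localization.mk_eq_mk']
    exact IsLocalization.mk'_spec' (Localization.Away f) x (⟨f ^ n, n, rfl⟩ : Submonoid.powers f)
  have h2 := congrArg (IsLocalization.Away.lift (S := Localization.Away f) f hu) h
  rwa [map_mul, IsLocalization.Away.lift_eq, IsLocalization.Away.lift_eq, map_pow] at h2

lemma evalAway_unique {R : Type u} [CommRing R] (φ : MvPolynomial ι k →+* R)
    {f : MvPolynomial ι k} (hu : IsUnit (φ f)) {d : ℕ} (hf : f ∈ (homogeneousSubmodule ι k) d)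
    (ψ : Away (homogeneousSubmodule ι k) f →+* R)
    (h : ∀ n x (hx : x ∈ (homogeneousSubmodule ι k) (n • d)), φ f ^ n * ψ
        (Away.mk (homogeneousSubmodule ι k) hf n x hx) = φ x) :
    ψ = evalAway φ hu := by
  ext z
  obtain ⟨n, x, hx, rfl⟩ := Away.mk_surjective (homogeneousSubmodule ι k) hf z
  rw [← (hu.pow n).mul_right_inj, h, evalAway_mk]

/-- The morphism to projective space with given homogeneous coordinates, one of which (or a form in
which) is invertible. -/
def toProj {R : CommRingCat.{u}} (φ : MvPolynomial ι k →+* R) {f : MvPolynomial ι k} {d : ℕ}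
    (hf : f ∈ (homogeneousSubmodule ι k) d) (hd : 0 < d) (hu : IsUnit (φ f)) : Spec R ⟶
        ProjectiveSpace k ι :=
  Spec.map (CommRingCat.ofHom (evalAway φ hu)) ≫ Proj.awayι (homogeneousSubmodule ι k) f hf hd

lemma evalAway_awayMap {R : Type u} [CommRing R] (φ : MvPolynomial ι k →+* R)
    {f g x : MvPolynomial ι k} (hu : IsUnit (φ f)) {d e : ℕ} (hf : f ∈ (homogeneousSubmodule ι k) d)
    (hg : g ∈ (homogeneousSubmodule ι k) e) (hx : x = f * g) (hu' : IsUnit (φ x)) :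
    (evalAway φ hu').comp (awayMap (homogeneousSubmodule ι k) hg hx) = evalAway φ hu := by
  refine evalAway_unique φ hu hf _ fun n y hy ↦ ?_
  subst hx
  rw [RingHom.comp_apply, awayMap_mk (homogeneousSubmodule ι k) hg rfl n hf y hy, ←
      ((isUnit_of_mul_isUnit_right
    (map_mul φ f g ▸ hu')).pow n).mul_right_inj, ← mul_assoc, ← mul_pow, mul_comm (φ g), ← map_mul,
    evalAway_mk, map_mul, map_pow, mul_comm]

/-- Both morphisms factor through the affine chart where `f * g` is invertible. -/
lemma toProj_eq_toProj {R : CommRingCat.{u}} (φ : MvPolynomial ι k →+* R)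
    {f g : MvPolynomial ι k} {d e : ℕ} (hf : f ∈ (homogeneousSubmodule ι k) d) (hd : 0 < d)
        (hu : IsUnit (φ f))
    (hg : g ∈ (homogeneousSubmodule ι k) e) (he : 0 < e) (hv : IsUnit (φ g)) :
    toProj φ hf hd hu = toProj φ hg he hv := by
  have hw : IsUnit (φ (f * g)) := by rw [map_mul]; exact hu.mul hv
  rw [toProj, toProj, ← evalAway_awayMap φ hu hf hg rfl hw,
    ← evalAway_awayMap φ hv hg hf (mul_comm f g) hw, CommRingCat.ofHom_comp, CommRingCat.ofHom_comp,
    Spec.map_comp, Spec.map_comp, Category.assoc, Category.assoc, Proj.SpecMap_awayMap_awayι,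
    Proj.SpecMap_awayMap_awayι]
  rfl

lemma specMap_toProj {R S : CommRingCat.{u}} (ψ : R ⟶ S) (φ : MvPolynomial ι k →+* R)
    {f : MvPolynomial ι k} {d : ℕ} (hf : f ∈ (homogeneousSubmodule ι k) d) (hd : 0 < d)
        (hu : IsUnit (φ f)) :
    Spec.map ψ ≫ toProj φ hf hd hu = toProj (ψ.hom.comp φ) hf hd (hu.map ψ.hom) := by
  rw [toProj, toProj, ← Category.assoc, ← Spec.map_comp]
  congr 2
  ext : 1
  refine evalAway_unique _ _ hf _ fun n y hy ↦ ?_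
  rw [CommRingCat.hom_comp, RingHom.comp_apply, RingHom.comp_apply, RingHom.comp_apply, ← map_pow,
    ← map_mul, CommRingCat.hom_ofHom, evalAway_mk]

lemma toProj_congr {R : CommRingCat.{u}} {φ φ' : MvPolynomial ι k →+* R} {t : R} (ht : IsUnit t)
    (hC : ∀ c, φ' (C c) = φ (C c)) (hX : ∀ i, φ' (X i) = t * φ (X i))
    {f : MvPolynomial ι k} {d : ℕ} (hf : f ∈ (homogeneousSubmodule ι k) d) (hd : 0 < d)
        (hu : IsUnit (φ f))
    (hu' : IsUnit (φ' f)) : toProj φ' hf hd hu' = toProj φ hf hd hu := by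
  rw [toProj, toProj]
  congr 3
  refine evalAway_unique _ _ hf _ fun n y hy ↦ ?_
  have h := evalAway_mk φ' hu' hf n y hy
  rw [ringHom_eq_pow_mul hC hX hy, ringHom_eq_pow_mul hC hX hf, mul_pow, ← pow_mul, smul_eq_mul,
    mul_comm n d, mul_assoc] at h
  exact (ht.pow _).mul_right_injective h

lemma toProj_mem_basicOpen {R : CommRingCat.{u}} (φ : MvPolynomial ι k →+* R)
    {f : MvPolynomial ι k} {d : ℕ} (hf : f ∈ (homogeneousSubmodule ι k) d) (hd : 0 < d)
        (hu : IsUnit (φ f))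
    {g : MvPolynomial ι k} {e : ℕ} (hg : g ∈ (homogeneousSubmodule ι k) e) (he : 0 < e) (x : Spec R)
        :
    toProj φ hf hd hu x ∈ Proj.basicOpen (homogeneousSubmodule ι k) g ↔ φ g ∉ x.asIdeal := by
  rw [toProj, Scheme.Hom.comp_apply]
  have h := Proj.awayι_preimage_basicOpen (homogeneousSubmodule ι k) hf hd hg he
  have h2 (y) : Proj.awayι (homogeneousSubmodule ι k) f hf hd y ∈ Proj.basicOpen
      (homogeneousSubmodule ι k) g ↔
      Away.isLocalizationElem hf hg ∉ y.asIdeal :=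
    (SetLike.ext_iff.mp h y)
  rw [h2]
  change evalAway φ hu _ ∉ x.asIdeal ↔ _
  rw [not_iff_not, ← Ideal.unit_mul_mem_iff_mem _ (hu.pow e), Away.isLocalizationElem]
  rw [evalAway_mk, map_pow]
  exact x.isPrime.pow_mem_iff_mem _ hd

/-- The quotients of the homogeneous coordinates by one of them. -/
def dehom (k : Type u) [Field k] {ι : Type} (i : ι) :
    MvPolynomial ι k →+* Away (MvPolynomial.homogeneousSubmodule ι k) (X i) :=
  eval₂Hom ((fromZeroRingHom _ _).comp
      (algebraMap k (MvPolynomial.homogeneousSubmodule ι k 0)))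
    fun j ↦ Away.mk _ (X_mem_homogeneousSubmodule i) 1 (X j)
      (by simpa using isHomogeneous_X k j)

lemma dehom_X_self (i : ι) : dehom k i (X i) = 1 := by
  rw [dehom, eval₂Hom_X']
  ext
  rw [Away.val_mk, val_one]
  exact Localization.mk_self (⟨X i ^ 1, 1, rfl⟩ : Submonoid.powers (X i : MvPolynomial ι k)) ▸
    congrArg₂ _ (pow_one _).symm rfl

lemma evalAway_dehom (i : ι) :
    evalAway (dehom k i) (f := X i) (by rw [dehom_X_self]; exact isUnit_one) = RingHom.id _ := by
  symm
  refine evalAway_unique _ _ (X_mem_homogeneousSubmodule i) _ fun n x hx ↦ ?_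
  rw [dehom_X_self, one_pow, one_mul, RingHom.id_apply]
  have hu : IsUnit (algebraMap (MvPolynomial ι k) (Localization.Away (X i : MvPolynomial ι k))
      (X i)) :=
    IsLocalization.Away.algebraMap_isUnit _
  obtain ⟨t, ht⟩ := hu.exists_left_inv
  have h := ringHom_eq_pow_mul (φ := algebraMap (MvPolynomial ι k)
      (Localization.Away (X i : MvPolynomial ι k)))
    (φ' := (algebraMap (Away (homogeneousSubmodule ι k) (X i : MvPolynomial ι k))
        (Localization.Away (X i : MvPolynomial ι k))).comp (dehom k i)) (t := t)
    (fun c ↦ by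
      rw [RingHom.comp_apply, dehom, eval₂Hom_C]
      rfl)
    (fun j ↦ by
      rw [RingHom.comp_apply, dehom, eval₂Hom_X', HomogeneousLocalization.algebraMap_apply,
          Away.val_mk,
        ← hu.mul_right_inj, ← mul_assoc, mul_comm _ t, ht, one_mul, Localization.mk_eq_mk']
      simp only [pow_one]
      exact IsLocalization.mk'_spec' (Localization.Away (X i : MvPolynomial ι k)) (X j)
        (⟨X i, 1, pow_one _⟩ : Submonoid.powers _)) hx
  ext
  rw [RingHom.comp_apply, HomogeneousLocalization.algebraMap_apply] at h
  rw [h, Away.val_mk, ← (hu.pow n).mul_right_inj, ← mul_assoc, smul_eq_mul, mul_one,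
    ← mul_pow, mul_comm _ t, ht, one_pow, one_mul, Localization.mk_eq_mk', ← map_pow]
  exact IsLocalization.mk'_spec' (Localization.Away (X i : MvPolynomial ι k)) x
    (⟨X i ^ n, n, rfl⟩ : Submonoid.powers _)

lemma awayι_eq_toProj (i : ι) :
    Proj.awayι (homogeneousSubmodule ι k) (X i : MvPolynomial ι k) (X_mem_homogeneousSubmodule i)
        one_pos =
      toProj (R := .of (Away (homogeneousSubmodule ι k) (X i : MvPolynomial ι k))) (dehom k i)
          (X_mem_homogeneousSubmodule i) one_pos
        (by rw [dehom_X_self]; exact isUnit_one) := by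
  unfold toProj
  rw [evalAway_dehom]
  exact ((congrArg (· ≫ _) (Spec.map_id _)).trans (Category.id_comp _)).symm

lemma exists_mem_basicOpen_X (x : ProjectiveSpace k ι) :
    ∃ i, x ∈ Proj.basicOpen (homogeneousSubmodule ι k) (X i) := by
  have h := Proj.iSup_basicOpen_eq_top' (homogeneousSubmodule ι k)
      (fun i ↦ (X i : MvPolynomial ι k))
    (fun i ↦ ⟨1, isHomogeneous_X k i⟩) (by
      rw [eq_top_iff]
      intro p _
      induction p using MvPolynomial.induction_on with
      | C a =>
        exact Subalgebra.algebraMap_mem (Algebra.adjoin ((homogeneousSubmodule ι k) 0) _)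
            ⟨C a, isHomogeneous_C _ _⟩
      | add p q hp hq => exact add_mem (hp trivial) (hq trivial)
      | mul_X p i hp => exact mul_mem (hp trivial) (Algebra.subset_adjoin ⟨i, rfl⟩))
  have : x ∈ (⨆ i, Proj.basicOpen (homogeneousSubmodule ι k) (X i : MvPolynomial ι k)) := h ▸
      trivial
  simpa using this

/-- Locally, every morphism to projective space is given by homogeneous coordinates. -/
lemma exists_toProj {T : Scheme.{u}} (p : T ⟶ ProjectiveSpace k ι) (t : T) :
    ∃ (A : CommRingCat.{u}) (c : Spec A ⟶ T) (_ : IsOpenImmersion c)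
      (φ : MvPolynomial ι k →+* A) (i : ι) (hu : IsUnit (φ (X i))), t ∈ Set.range c ∧
      c ≫ p = toProj φ (X_mem_homogeneousSubmodule i) one_pos hu := by
  obtain ⟨R, d, hd, x, rfl⟩ := exists_chart t
  obtain ⟨i, hi⟩ := exists_mem_basicOpen_X (p (d x))
  rw [← Proj.opensRange_awayι (homogeneousSubmodule ι k) (X i : MvPolynomial ι k)
      (X_mem_homogeneousSubmodule i) one_pos] at hi
  obtain ⟨r, hr, ψ, hψ⟩ := exists_specAway_lift (d ≫ p)
    (Proj.awayι (homogeneousSubmodule ι k) (X i : MvPolynomial ι k) (X_mem_homogeneousSubmodule i)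
        one_pos) x hi
  obtain ⟨q, rfl⟩ := (mem_range_specAway r x).mpr hr
  refine ⟨_, specAway r ≫ d, inferInstance, ψ.hom.comp (dehom k i), i, ?_, ⟨q, rfl⟩, ?_⟩
  · rw [RingHom.comp_apply, dehom_X_self, map_one]; exact isUnit_one
  · rw [Category.assoc, hψ, awayι_eq_toProj, specMap_toProj]

/-- As `χ f` is a unit, the piece of the glued morphism over the chart of `f` is defined on all of
`Y`. -/
lemma fromOfGlobalSections_eq {Y : Scheme.{u}} (χ : MvPolynomial ι k →+* Γ(Y, ⊤))
    (hχ : (HomogeneousIdeal.irrelevant (homogeneousSubmodule ι k)).toIdeal.map χ = ⊤)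
        {f : MvPolynomial ι k} {d : ℕ}
    (hf : f ∈ (homogeneousSubmodule ι k) d) (hd : 0 < d) (hu : IsUnit (χ f)) :
    Proj.fromOfGlobalSections (homogeneousSubmodule ι k) χ hχ = Y.toSpecΓ ≫ toProj χ hf hd hu := by
  have htop : Y.basicOpen (χ f) = ⊤ := Scheme.basicOpen_of_isUnit _ hu
  have : IsIso (Y.basicOpen (χ f)).ι := by
    rw [htop]; exact (Scheme.topIso Y).isIso_hom
  rw [← cancel_epi (Y.basicOpen (χ f)).ι]
  have h1 := congr($(Proj.fromOfGlobalSections_resLE (homogeneousSubmodule ι k) χ hχ hd hf) ≫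
      (Proj.basicOpen (homogeneousSubmodule ι k) f).ι)
  rw [Scheme.Hom.resLE_comp_ι] at h1
  rw [h1, toProj, Proj.toBasicOpenOfGlobalSections]
  simp only [Category.assoc, Proj.basicOpenIsoSpec_inv_ι]
  have h2 : ∀ h, (IsLocalization.map (M := .powers f) (T := .powers (χ f)) (Localization.Away (χ f))
      χ h).comp (algebraMap (Away (homogeneousSubmodule ι k) f) (Localization.Away f)) =
      (algebraMap Γ(Y, ⊤) (Localization.Away (χ f))).comp (evalAway χ hu) := by
    intro h
    rw [evalAway, ← RingHom.comp_assoc]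
    congr 1
    apply IsLocalization.ringHom_ext (.powers f)
    rw [IsLocalization.map_comp, RingHom.comp_assoc, IsLocalization.Away.lift_comp]
  rw [h2, CommRingCat.ofHom_comp, Spec.map_comp, Category.assoc]
  let D : (Spec Γ(Y, ⊤)).Opens := PrimeSpectrum.basicOpen (χ f)
  have h3 : (basicOpenIsoSpecAway (χ f)).hom ≫
      Spec.map (CommRingCat.ofHom (algebraMap Γ(Y, ⊤) (Localization.Away (χ f)))) =
      D.ι :=
    IsOpenImmersion.isoOfRangeEq_hom_fac D.ι _ _
  have h4 := Y.toSpecΓ_preimage_basicOpen (χ f)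
  have h5 : (Y.isoOfEq h4).inv ≫ Y.toSpecΓ ∣_ PrimeSpectrum.basicOpen (χ f) ≫
      (basicOpenIsoSpecAway (χ f)).hom ≫
      Spec.map (CommRingCat.ofHom (algebraMap Γ(Y, ⊤) (Localization.Away (χ f)))) =
      (Y.basicOpen (χ f)).ι ≫ Y.toSpecΓ := by
    refine (congrArg (fun t ↦ (Y.isoOfEq h4).inv ≫ Y.toSpecΓ ∣_ PrimeSpectrum.basicOpen (χ f) ≫ t)
      h3).trans ?_
    refine (congrArg ((Y.isoOfEq h4).inv ≫ ·) (morphismRestrict_ι _ _)).trans ?_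
    rw [← Category.assoc, Scheme.isoOfEq_inv_ι]
  have h6 := congr($h5 ≫ Spec.map (CommRingCat.ofHom (evalAway χ hu)) ≫ Proj.awayι
      (homogeneousSubmodule ι k) f hf hd)
  simp only [Category.assoc] at h6
  exact h6

end ProjectiveSpace

/-! ### Ideal sheaves on projective space generated by forms -/

section Forms

open MvPolynomial hiding comap_comp comap_id algebraMap_apply
open HomogeneousLocalization

variable {k : Type u} [Field k] {ι : Type}

lemma dehom_eq_mk (i : ι) (n : ℕ) {x : MvPolynomial ι k}
    (hx : x ∈ homogeneousSubmodule ι k (n • 1)) :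
    dehom k i x = Away.mk _ (X_mem_homogeneousSubmodule i) n x hx := by
  have hu : IsUnit (dehom k i (X i)) := by rw [dehom_X_self]; exact isUnit_one
  have h := evalAway_mk (dehom k i) hu (X_mem_homogeneousSubmodule i) n x hx
  rw [evalAway_dehom, dehom_X_self, one_pow, one_mul] at h
  exact h.symm

lemma pow_mul_evalAway_dehom {R : Type u} [CommRing R] (φ : MvPolynomial ι k →+* R) (i : ι)
    (hu : IsUnit (φ (X i))) {n : ℕ} {x : MvPolynomial ι k} (hx : x ∈ homogeneousSubmodule ι k n) :
    φ (X i) ^ n * evalAway φ hu (dehom k i x) = φ x := by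
  have hx' : x ∈ homogeneousSubmodule ι k (n • 1) := by simpa using hx
  rw [dehom_eq_mk i n hx', evalAway_mk]

lemma isUnit_of_toProj_eq {R : CommRingCat.{u}} {φ φ' : MvPolynomial ι k →+* R}
    {f g x : MvPolynomial ι k} {d e c : ℕ} {hf : f ∈ homogeneousSubmodule ι k d} {hd : 0 < d}
    {hu : IsUnit (φ f)} {hg : g ∈ homogeneousSubmodule ι k e} {he : 0 < e} {hv : IsUnit (φ' g)}
    (h : toProj φ hf hd hu = toProj φ' hg he hv) (hx : x ∈ homogeneousSubmodule ι k c) (hc : 0 < c)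
    (hxu : IsUnit (φ x)) : IsUnit (φ' x) := by
  by_contra hn
  obtain ⟨M, hM, hxM⟩ := exists_max_ideal_of_mem_nonunits hn
  let p : Spec R := ⟨M, hM.isPrime⟩
  have h1 := (toProj_mem_basicOpen φ hf hd hu hx hc p)
  rw [h, toProj_mem_basicOpen φ' hg he hv hx hc p] at h1
  exact h1.mpr (fun h2 ↦ hM.ne_top (Ideal.eq_top_of_isUnit_mem _ h2 hxu)) hxM

lemma span_range_mul_unit {R E : Type*} [CommRing R] {t : R} (ht : IsUnit t) (y : E → R) :
    Ideal.span (Set.range fun a ↦ t * y a) = Ideal.span (Set.range y) := by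
  apply le_antisymm <;> rw [Ideal.span_le] <;> rintro _ ⟨a, rfl⟩
  · exact Ideal.mul_mem_left _ _ (Ideal.subset_span ⟨a, rfl⟩)
  · rw [SetLike.mem_coe, ← Ideal.unit_mul_mem_iff_mem _ ht]
    exact Ideal.subset_span ⟨a, rfl⟩

/-- For either choice of coordinates, the values of the forms are the dehomogenized values times the
`n`-th power of a unit. This is the compatibility on overlaps needed to glue the ideals. -/
lemma span_range_eq_of_toProj_eq {R : CommRingCat.{u}} {φ φ' : MvPolynomial ι k →+* R}
    {i : ι} {g : MvPolynomial ι k} {e : ℕ} {hu : IsUnit (φ (X i))}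
    {hg : g ∈ homogeneousSubmodule ι k e} {he : 0 < e} {hv : IsUnit (φ' g)}
    (h : toProj φ (X_mem_homogeneousSubmodule i) one_pos hu = toProj φ' hg he hv) {E : Type*}
    {n : ℕ} {F : E → MvPolynomial ι k} (hF : ∀ a, F a ∈ homogeneousSubmodule ι k n) :
    Ideal.span (Set.range fun a ↦ φ (F a)) = Ideal.span (Set.range fun a ↦ φ' (F a)) := by
  have hw := isUnit_of_toProj_eq h (X_mem_homogeneousSubmodule i) one_pos hu
  rw [toProj_eq_toProj φ' hg he hv (X_mem_homogeneousSubmodule i) one_pos hw, toProj, toProj,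
    cancel_mono] at h
  have h1 : evalAway φ hu = evalAway φ' hw := congr($(Spec.map_injective h).hom)
  have h2 : (fun a ↦ φ (F a)) = fun a ↦ φ (X i) ^ n * evalAway φ hu (dehom k i (F a)) := by
    ext a; rw [pow_mul_evalAway_dehom φ i hu (hF a)]
  have h3 : (fun a ↦ φ' (F a)) = fun a ↦ φ' (X i) ^ n * evalAway φ hu (dehom k i (F a)) := by
    ext a; rw [h1, pow_mul_evalAway_dehom φ' i hw (hF a)]
  rw [h2, h3, span_range_mul_unit (hu.pow n), span_range_mul_unit (hw.pow n)]

lemma comap_eq_comap_iff_of_isIso {X Y : Scheme.{u}} (e : X ⟶ Y) [IsIso e]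
    {I J : Y.IdealSheafData} : I.comap e = J.comap e ↔ I = J := by
  refine ⟨fun h ↦ ?_, fun h ↦ h ▸ rfl⟩
  have := congrArg (fun K ↦ K.comap (inv e)) h
  simpa only [← comap_comp, IsIso.inv_hom_id, comap_id] using this

/-- The ideal sheaf on projective space generated by forms of the same degree. -/
lemma exists_idealSheaf_of_forms [Finite ι] {E : Type*} {n : ℕ} {F : E → MvPolynomial ι k}
    (hF : ∀ a, F a ∈ homogeneousSubmodule ι k n) :
    ∃ b : (ProjectiveSpace k ι).IdealSheafData, ∀ {R : CommRingCat.{u}}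
      (φ : MvPolynomial ι k →+* R) (i : ι) (hu : IsUnit (φ (X i))),
      b.comap (toProj φ (X_mem_homogeneousSubmodule i) one_pos hu) =
        idl (Ideal.span (Set.range fun a ↦ φ (F a))) := by
  have key : ∀ (i : ι) {R : CommRingCat.{u}} (ψ : CommRingCat.of (Away _ (X i)) ⟶ R),
      (idl (R := .of (Away _ (X i))) (Ideal.span (Set.range fun a ↦ dehom k i (F a)))).comap
        (Spec.map ψ) =
      idl (Ideal.span (Set.range fun a ↦ ψ.hom.comp (dehom k i) (F a))) := by
    intro i R ψ
    rw [comap_idl, Ideal.map_span, ← Set.range_comp]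
    rfl
  obtain ⟨b, hb⟩ := exists_glued_ideal
    (fun i ↦ Proj.awayι (homogeneousSubmodule ι k) (X i) (X_mem_homogeneousSubmodule i) one_pos)
    (fun i ↦ idl (R := .of (Away _ (X i))) (Ideal.span (Set.range fun a ↦ dehom k i (F a)))) (by
      intro i j
      let e := Proj.pullbackAwayιIso (homogeneousSubmodule ι k) (X_mem_homogeneousSubmodule i)
        one_pos (X_mem_homogeneousSubmodule j) one_pos rfl
      rw [← comap_eq_comap_iff_of_isIso e.inv, ← comap_comp, ← comap_comp]
      have h1 : e.inv ≫ pullback.fst _ _ = _ := Proj.pullbackAwayιIso_inv_fst ..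
      have h2 : e.inv ≫ pullback.snd _ _ = _ := Proj.pullbackAwayιIso_inv_snd ..
      have h3 := (Category.assoc _ _ _).trans ((congrArg (e.inv ≫ ·) pullback.condition).trans
        (Category.assoc _ _ _).symm)
      rw [h1, h2, awayι_eq_toProj, awayι_eq_toProj, specMap_toProj, specMap_toProj] at h3
      rw [h1, h2, key, key]
      exact congrArg idl (span_range_eq_of_toProj_eq h3 hF))
  refine ⟨b, fun φ i hu ↦ ?_⟩
  rw [toProj, comap_comp, hb, key]
  congr 1
  rw [← span_range_mul_unit (hu.pow n)]
  congr 2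
  ext a
  exact pow_mul_evalAway_dehom φ i hu (hF a)

end Forms

/-! ### Affine charts of the space of matrices -/

section MatrixChart

open MvPolynomial hiding comap_comp comap_id algebraMap_apply
open HomogeneousLocalization

variable (k : Type u) [Field k]

/-- The normalized row. -/
def unitRow (l : Fin 3) : MvPolynomial Coord k := ![1, X (.inr 0), X (.inr 1)] l

/-- The other two rows, written as the sum of a multiple of the normalized row and a vector whose
first coordinate vanishes. -/
def otherRow (ρ : Fin 2) (l : Fin 3) : MvPolynomial Coord k :=
  X (.inl (ρ, 0)) * unitRow k l + if l = 0 then 0 else X (.inl (ρ, l))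

/-- The coordinates of the chart where the entry `(r, i₀)` equals `1`. -/
def matrixCoord (r i₀ : Fin 3) : MvPolynomial (Fin 3 × Fin 3) k →+* MvPolynomial Coord k :=
  (aeval fun i ↦ if i.1 = r then unitRow k (Equiv.swap 0 i₀ i.2) else
    otherRow k (if i.1 = 0 then 0 else 1) (Equiv.swap 0 i₀ i.2) :
    MvPolynomial (Fin 3 × Fin 3) k →ₐ[k] MvPolynomial Coord k).toRingHom

lemma matrixCoord_C (r i₀ : Fin 3) (c : k) : matrixCoord k r i₀ (C c) = C c :=
  (aeval_C _ c).trans rfl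

lemma matrixCoord_X (r i₀ i j : Fin 3) : matrixCoord k r i₀ (X (i, j)) =
    if i = r then unitRow k (Equiv.swap 0 i₀ j) else
      otherRow k (if i = 0 then 0 else 1) (Equiv.swap 0 i₀ j) :=
  aeval_X _ _

lemma matrixCoord_X_self (r i₀ : Fin 3) : matrixCoord k r i₀ (X (r, i₀)) = 1 := by
  rw [matrixCoord_X, if_pos rfl, Equiv.swap_apply_right]
  rfl

lemma isUnit_matrixCoord_X_self (r i₀ : Fin 3) : IsUnit (matrixCoord k r i₀ (X (r, i₀))) := by
  rw [matrixCoord_X_self]; exact isUnit_one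

/-- The chart of the space of matrices where the entry `(r, i₀)` equals `1`. -/
def matrixChart (r i₀ : Fin 3) : Spec (ChartRing k) ⟶ MatrixSpace k :=
  toProj (R := ChartRing k) (matrixCoord k r i₀) (X_mem_homogeneousSubmodule (r, i₀)) one_pos
    (isUnit_matrixCoord_X_self k r i₀)

variable {k}

/-- Two nonzero indices of rows which are not equal. -/
structure IsRowPair (q r : Fin 3) : Prop where
  ne_zero_left : q ≠ 0
  ne_zero_right : r ≠ 0
  ne : q ≠ r

lemma IsRowPair.eq {q r : Fin 3} (h : IsRowPair q r) {i : Fin 3} (h1 : i ≠ r) (h2 : i ≠ 0) :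
    i = q := by
  obtain ⟨h3, h4, h5⟩ := h
  revert q r i; decide

lemma matrixCoord_surjective {q r : Fin 3} (h : IsRowPair q r) (i₀ : Fin 3) :
    Function.Surjective (evalAway (matrixCoord k r i₀) (isUnit_matrixCoord_X_self k r i₀)) := by
  let S := (evalAway (matrixCoord k r i₀) (isUnit_matrixCoord_X_self k r i₀)).range
  have hS : ∀ {n : ℕ} {x} (_ : x ∈ homogeneousSubmodule (Fin 3 × Fin 3) k n),
      matrixCoord k r i₀ x ∈ S := by
    intro n x hx
    refine ⟨dehom k (r, i₀) x, ?_⟩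
    have := pow_mul_evalAway_dehom (matrixCoord k r i₀) (r, i₀) (isUnit_matrixCoord_X_self k r i₀)
      hx
    rwa [matrixCoord_X_self, one_pow, one_mul] at this
  have hX : ∀ i j, matrixCoord k r i₀ (X (i, Equiv.swap 0 i₀ j)) ∈ S := fun i j ↦
    hS (X_mem_homogeneousSubmodule _)
  have hu : ∀ l, unitRow k l ∈ S := fun l ↦ by
    have := hX r l
    rwa [matrixCoord_X, if_pos rfl, Equiv.swap_apply_self] at this
  have ho : ∀ ρ l, otherRow k ρ l ∈ S := fun ρ l ↦ by
    have := hX (if ρ = 0 then 0 else q) l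
    rw [matrixCoord_X, Equiv.swap_apply_self] at this
    fin_cases ρ
    · simpa [h.ne_zero_right.symm] using this
    · simpa [h.ne, h.ne_zero_left] using this
  have h0 : ∀ ρ, X (.inl (ρ, 0)) ∈ S := fun ρ ↦ by
    have := ho ρ 0
    simpa [otherRow, unitRow] using this
  suffices ∀ p, p ∈ S from this
  intro p
  induction p using MvPolynomial.induction_on with
  | C a =>
    rw [← matrixCoord_C k r i₀ a]
    exact hS (isHomogeneous_C _ _)
  | add p q hp hq => exact add_mem hp hq
  | mul_X p i hp =>
    refine mul_mem hp ?_
    rcases i with ⟨ρ, l⟩ | t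
    · by_cases hl : l = 0
      · subst hl; exact h0 ρ
      · have := sub_mem (ho ρ l) (mul_mem (h0 ρ) (hu l))
        rwa [otherRow, if_neg hl, add_sub_cancel_left] at this
    · have := hu t.succ
      fin_cases t <;> exact this

lemma matrixCoord_injective {q r : Fin 3} (h : IsRowPair q r) (i₀ : Fin 3) :
    Function.Injective (evalAway (matrixCoord k r i₀) (isUnit_matrixCoord_X_self k r i₀)) := by
  let D : Fin 3 → Fin 3 → Away (homogeneousSubmodule (Fin 3 × Fin 3) k) (X (r, i₀)) :=
    fun i j ↦ dehom k (r, i₀) (X (i, Equiv.swap 0 i₀ j))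
  let row : Fin 2 → Fin 3 := fun ρ ↦ if ρ = 0 then 0 else q
  -- The inverse on coordinates: from an entry of another row, subtract the entry of the normalized
  -- row times the leading entry.
  let η : MvPolynomial Coord k →+* Away (homogeneousSubmodule (Fin 3 × Fin 3) k) (X (r, i₀)) :=
    eval₂Hom ((dehom k (r, i₀)).comp C) (Sum.elim (fun i ↦
      if i.2 = 0 then D (row i.1) 0 else D (row i.1) i.2 - D (row i.1) 0 * D r i.2)
      fun t ↦ D r t.succ)
  have hDr : D r 0 = 1 := by
    dsimp only [D]; rw [Equiv.swap_apply_left, dehom_X_self]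
  have hu : ∀ l, η (unitRow k l) = D r l := by
    intro l
    fin_cases l
    · exact (map_one η).trans hDr.symm
    · simp [unitRow, η]
    · simp [unitRow, η]
  have ho : ∀ ρ l, η (otherRow k ρ l) = D (row ρ) l := by
    intro ρ l
    rw [otherRow, map_add, map_mul, hu]
    by_cases hl : l = 0
    · subst hl; simp [η, hDr]
    · simp [η, hl]
  have hη : η.comp (matrixCoord k r i₀) = dehom k (r, i₀) := by
    apply MvPolynomial.ringHom_ext
    · intro c
      simp [matrixCoord_C, η]
    · rintro ⟨i, j⟩
      have hD : ∀ i, D i (Equiv.swap 0 i₀ j) = dehom k (r, i₀) (X (i, j)) := by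
        intro i; dsimp only [D]; rw [Equiv.swap_apply_self]
      rw [RingHom.comp_apply, matrixCoord_X]
      split_ifs with h1 h2
      · rw [hu, hD, h1]
      · rw [ho, hD, h2]; rfl
      · rw [ho, hD, h.eq h1 h2]; rfl
  rw [injective_iff_map_eq_zero]
  intro z hz
  obtain ⟨n, x, hx, rfl⟩ := Away.mk_surjective _ (X_mem_homogeneousSubmodule _) z
  have h1 := evalAway_mk (matrixCoord k r i₀) (isUnit_matrixCoord_X_self k r i₀)
    (X_mem_homogeneousSubmodule _) n x hx
  rw [hz, mul_zero] at h1
  rw [← dehom_eq_mk, ← hη, RingHom.comp_apply, ← h1, map_zero]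

lemma isOpenImmersion_matrixChart {q r : Fin 3} (h : IsRowPair q r) (i₀ : Fin 3) :
    IsOpenImmersion (matrixChart k r i₀) ∧ ∀ x, x ∈ Set.range (matrixChart k r i₀) ↔
      x ∈ Proj.basicOpen (homogeneousSubmodule (Fin 3 × Fin 3) k) (X (r, i₀)) := by
  let e := RingEquiv.ofBijective
    (evalAway (matrixCoord k r i₀) (isUnit_matrixCoord_X_self k r i₀))
    ⟨matrixCoord_injective h i₀, matrixCoord_surjective h i₀⟩
  let E : CommRingCat.of (Away (homogeneousSubmodule (Fin 3 × Fin 3) k) (X (r, i₀))) ≅ ChartRing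
      k :=
    e.toCommRingCatIso
  have h1 : matrixChart k r i₀ = Spec.map E.hom ≫ Proj.awayι _ (X (r, i₀))
    (X_mem_homogeneousSubmodule _) one_pos := rfl
  have h2 : IsIso (Spec.map E.hom) := inferInstance
  refine ⟨by rw [h1]; infer_instance, fun x ↦ ?_⟩
  rw [← Proj.opensRange_awayι _ (X (r, i₀)) (X_mem_homogeneousSubmodule _) one_pos, h1]
  constructor
  · rintro ⟨y, rfl⟩
    exact ⟨Spec.map E.hom y, rfl⟩
  · rintro ⟨y, rfl⟩
    refine ⟨inv (Spec.map E.hom) y, ?_⟩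
    rw [← Scheme.Hom.comp_apply, IsIso.inv_hom_id_assoc]

lemma vanishingRows_comap {R : CommRingCat.{u}} {φ : MvPolynomial (Fin 3 × Fin 3) k →+* R}
    {i : Fin 3 × Fin 3} {hu : IsUnit (φ (X i))}
    [IsOpenImmersion (toProj φ (X_mem_homogeneousSubmodule i) one_pos hu)] {s : Set (Fin 3)}
    {L : Ideal R} (hL : L.IsRadical)
    (h : ∀ M : Ideal R, L ≤ M ↔ ∀ i ∈ s, ∀ j, φ (X (i, j)) ∈ M) :
    (vanishingRows k s).comap (toProj φ (X_mem_homogeneousSubmodule i) one_pos hu) = idl L := by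
  rw [vanishingRows, comap_vanishingIdeal]
  refine vanishingIdeal_eq_idl hL fun x ↦ ?_
  rw [h]
  have h1 : ∀ g : MvPolynomial (Fin 3 × Fin 3) k, g ∈ homogeneousSubmodule _ k 1 →
    (g ∈ (toProj φ (X_mem_homogeneousSubmodule i) one_pos hu x).asHomogeneousIdeal ↔
      φ g ∈ x.asIdeal) := fun g hg ↦ by
    rw [← not_iff_not]
    exact toProj_mem_basicOpen φ (X_mem_homogeneousSubmodule i) one_pos hu hg one_pos x
  constructor
  · intro hx i' hi' j
    exact (h1 _ (X_mem_homogeneousSubmodule _)).mp (hx ⟨i', hi', j, rfl⟩)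
  · rintro hx _ ⟨i', hi', j, rfl⟩
    exact (h1 _ (X_mem_homogeneousSubmodule _)).mpr (hx i' hi' j)

/-- The passage from the entries of a row to its three coordinates is unitriangular over the chart;
hence the loci of vanishing rows are coordinate subspaces. -/
lemma otherRow_mem_iff {M : Ideal (MvPolynomial Coord k)} {ρ : Fin 2} {i₀ : Fin 3} :
    (∀ j, otherRow k ρ (Equiv.swap 0 i₀ j) ∈ M) ↔ ∀ j, X (.inl (ρ, j)) ∈ M := by
  constructor
  · intro h
    have h' : ∀ j, otherRow k ρ j ∈ M := fun j ↦ by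
      simpa using h (Equiv.swap 0 i₀ j)
    have h0 : X (.inl (ρ, 0)) ∈ M := by simpa [otherRow, unitRow] using h' 0
    intro j
    by_cases hj : j = 0
    · rwa [hj]
    · have := sub_mem (h' j) (M.mul_mem_right (unitRow k j) h0)
      rwa [otherRow, if_neg hj, add_sub_cancel_left] at this
  · intro h j
    refine add_mem (M.mul_mem_right _ (h 0)) ?_
    split_ifs
    exacts [zero_mem _, h _]

lemma coordIdeal_le_iff {S : Set Coord} {M : Ideal (MvPolynomial Coord k)} :
    coordIdeal k S ≤ M ↔ ∀ i ∈ S, X i ∈ M := by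
  rw [coordIdeal, Ideal.span_le, Set.image_subset_iff]
  rfl

/-- In this chart `B` and `P` are the initial coordinate subspaces of the toric procedure. The locus
over the other point is absent, because the row `r` has an entry `1`. -/
lemma vanishingRows_comap_matrixChart {q r : Fin 3} (h : IsRowPair q r) (i₀ : Fin 3) :
    (vanishingRows k {0, q}).comap (matrixChart k r i₀) =
      idl (coordIdeal k (ToricChart.init.idx 0 ∪ ToricChart.init.idx 1)) ∧
    (vanishingRows k {q}).comap (matrixChart k r i₀) = idl (coordIdeal k (ToricChart.init.idx 1)) ∧
    (vanishingRows k {0, r}).comap (matrixChart k r i₀) = ⊤ := by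
  have : IsOpenImmersion (toProj (R := ChartRing k) (matrixCoord k r i₀)
      (X_mem_homogeneousSubmodule (r, i₀)) one_pos (isUnit_matrixCoord_X_self k r i₀)) :=
    (isOpenImmersion_matrixChart h i₀).1
  have h0 : ∀ j, matrixCoord k r i₀ (X (0, j)) = otherRow k 0 (Equiv.swap 0 i₀ j) := fun j ↦ by
    rw [matrixCoord_X, if_neg h.ne_zero_right.symm, if_pos rfl]
  have hq : ∀ j, matrixCoord k r i₀ (X (q, j)) = otherRow k 1 (Equiv.swap 0 i₀ j) := fun j ↦ by
    rw [matrixCoord_X, if_neg h.ne, if_neg h.ne_zero_left]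
  refine ⟨vanishingRows_comap (coordIdeal_isPrime _).isRadical fun M ↦ ?_,
    vanishingRows_comap (coordIdeal_isPrime _).isRadical fun M ↦ ?_,
    (vanishingRows_comap (L := ⊤) (fun _ _ ↦ trivial) fun M ↦ ?_).trans idl_top⟩
  · refine coordIdeal_le_iff.trans ?_
    have h1 : (∀ i ∈ ({0, q} : Set (Fin 3)), ∀ j, matrixCoord k r i₀ (X (i, j)) ∈ M) ↔
        (∀ j, X (.inl (0, j)) ∈ M) ∧ ∀ j, X (.inl (1, j)) ∈ M := by
      rw [← otherRow_mem_iff (i₀ := i₀), ← otherRow_mem_iff (i₀ := i₀)]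
      simp [h0, hq]
    refine Iff.trans ?_ h1.symm
    constructor
    · intro h2
      exact ⟨fun j ↦ h2 _ (Or.inl ⟨j, Or.inl rfl, rfl⟩), fun j ↦ h2 _ (Or.inr ⟨j, Or.inl rfl, rfl⟩)⟩
    · rintro ⟨h2, h3⟩ _ (⟨j, -, rfl⟩ | ⟨j, -, rfl⟩)
      exacts [h2 j, h3 j]
  · refine coordIdeal_le_iff.trans ?_
    have h1 : (∀ i ∈ ({q} : Set (Fin 3)), ∀ j, matrixCoord k r i₀ (X (i, j)) ∈ M) ↔
        ∀ j, X (.inl (1, j)) ∈ M := by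
      rw [← otherRow_mem_iff (i₀ := i₀)]
      simp [hq]
    refine Iff.trans ?_ h1.symm
    constructor
    · exact fun h2 j ↦ h2 _ ⟨j, Or.inl rfl, rfl⟩
    · rintro h2 _ ⟨j, -, rfl⟩
      exact h2 j
  · rw [top_le_iff]
    refine ⟨fun hM _ _ _ ↦ hM ▸ trivial, fun hM ↦ ?_⟩
    have := hM r (by simp) i₀
    rw [matrixCoord_X_self] at this
    exact (Ideal.eq_top_iff_one _).mpr this

end MatrixChart

/-! ## Regular lifts of the rational map -/

/-- The equalizer is a closed subscheme, by separatedness, and it contains `D(b)`, which is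
schematically dense since `b` is regular. -/
lemma ext_of_specAway {A : CommRingCat.{u}} {b : A} (hb : b ∈ nonZeroDivisors A) {Y : Scheme.{u}}
    [Y.IsSeparated] {f g : Spec A ⟶ Y} (h : specAway b ≫ f = specAway b ≫ g) : f = g := by
  let s := terminal.from Y
  let l : Spec A ⟶ pullback s s := pullback.lift f g (Subsingleton.elim _ _)
  let i := pullback.fst l (pullback.diagonal s)
  have hi : IsClosedImmersion i := inferInstance
  have hf : i ≫ f = i ≫ g := by
    have h1 : i ≫ l = pullback.snd l (pullback.diagonal s) ≫ pullback.diagonal s :=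
      pullback.condition
    have h2 := congr($h1 ≫ pullback.fst s s)
    have h3 := congr($h1 ≫ pullback.snd s s)
    simp only [l, Category.assoc, pullback.lift_fst, pullback.lift_snd, pullback.diagonal_fst,
      pullback.diagonal_snd] at h2 h3
    rw [h2, h3]
  have hl : specAway b ≫ l = (specAway b ≫ f) ≫ pullback.diagonal s := by
    apply pullback.hom_ext
    · rw [Category.assoc, Category.assoc, Category.assoc, pullback.diagonal_fst, Category.comp_id]
      exact congr(specAway b ≫ $(pullback.lift_fst _ _ _))
    · rw [Category.assoc, Category.assoc, Category.assoc, pullback.diagonal_snd, Category.comp_id,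
        h]
      exact congr(specAway b ≫ $(pullback.lift_snd _ _ _))
  have h1 : pullback.lift (specAway b) (specAway b ≫ f) hl ≫ i = specAway b := pullback.lift_fst _ _
      _
  have h2 : i.ker = ⊥ := by
    have h3 : i.ker ≤ (specAway b).ker := by
      rw [← h1]
      exact Scheme.Hom.le_ker_comp _ _
    have h4 : (idl ⊥ : (Spec (CommRingCat.of (Localization.Away b))).IdealSheafData) = ⊥ :=
      (idlIso _).map_bot
    have h5 : (idl ⊥ : (Spec A).IdealSheafData) = ⊥ := (idlIso _).map_bot
    rw [← Scheme.IdealSheafData.map_bot (specAway b)] at h3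
    replace h3 := h3.trans ((congrArg (fun K ↦ K.map (specAway b)) h4.symm).trans (map_idl _ _)).le
    rw [← le_bot_iff, ← h5]
    refine h3.trans (idl_le_idl.mpr fun x hx ↦ ?_)
    obtain ⟨⟨_, n, rfl⟩, hn⟩ := (IsLocalization.map_eq_zero_iff (Submonoid.powers b)
      (Localization.Away b) x).mp hx
    exact (mem_nonZeroDivisors_iff_left.mp (pow_mem hb n)) _ hn
  have h3 : IsIso i := IsClosedImmersion.isIso_iff_ker_eq_bot.mpr h2
  rwa [cancel_epi] at hf

section RegularLift

open MvPolynomial hiding comap_comp comap_id algebraMap_apply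
open HomogeneousLocalization

variable {k : Type u} [Field k] {F : MvPolynomial (Fin 3) k} {d : ℕ}

/-- Testing on arbitrary `T` instead of preimages makes stability under composition and locality on
the source immediate. -/
lemma isRegularLift_iff {hF : F.IsHomogeneous d} {W : Scheme.{u}} {π : W ⟶ MatrixSpace k}
    {f : W ⟶ CurveSpace k d} : IsRegularLift hF π f ↔ ∀ (a : Exponent d) {T : Scheme.{u}}
        (t : T ⟶ W)
      (o : T ⟶ (orbitOpen F a.1).toScheme), t ≫ π = o ≫ (orbitOpen F a.1).ι →
      t ≫ f = o ≫ orbitMap hF a := by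
  constructor
  · intro h a T t o hto
    let l := (isPullback_morphismRestrict π (orbitOpen F a.1)).lift o t hto.symm
    have h1 : l ≫ π ∣_ orbitOpen F a.1 = o := IsPullback.lift_fst _ _ _ _
    have h2 : l ≫ (π ⁻¹ᵁ orbitOpen F a.1).ι = t := IsPullback.lift_snd _ _ _ _
    rw [← h1, ← h2, Category.assoc, Category.assoc, h a]
  · exact fun h a ↦ h a _ _ (morphismRestrict_ι _ _).symm

lemma IsRegularLift.comp {hF : F.IsHomogeneous d} {W T : Scheme.{u}} {π : W ⟶ MatrixSpace k}
    {f : W ⟶ CurveSpace k d} (h : IsRegularLift hF π f) (j : T ⟶ W) :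
    IsRegularLift hF (j ≫ π) (j ≫ f) := by
  rw [isRegularLift_iff] at h ⊢
  intro a S t o hto
  simpa using h a (t ≫ j) o (by simpa using hto)

lemma IsRegularLift.of_charts {hF : F.IsHomogeneous d} {W : Scheme.{u}} {π : W ⟶ MatrixSpace k}
    {f : W ⟶ CurveSpace k d} (h : ∀ x : W, ∃ (U : Scheme.{u}) (c : U ⟶ W) (_ : IsOpenImmersion c),
      x ∈ Set.range c ∧ IsRegularLift hF (c ≫ π) (c ≫ f)) : IsRegularLift hF π f := by
  rw [isRegularLift_iff]
  intro a T t o hto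
  apply hom_ext_of_charts
  intro x
  obtain ⟨U, c, hc, hx, h⟩ := h (t x)
  rw [isRegularLift_iff] at h
  refine ⟨_, pullback.fst t c, inferInstance, ?_, ?_⟩
  · rwa [IsOpenImmersion.range_pullbackFst]
  · rw [← Category.assoc, pullback.condition, Category.assoc]
    refine (h a (pullback.snd t c) (pullback.fst t c ≫ o) ?_).trans (Category.assoc _ _ _)
    rw [← Category.assoc, ← pullback.condition, Category.assoc, hto, Category.assoc]

/-- The homogeneous coordinates of a curve, as functions of those of a matrix. -/
def curveCoord (F : MvPolynomial (Fin 3) k) (d : ℕ) {R : Type u} [CommRing R]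
    (φ : MvPolynomial (Fin 3 × Fin 3) k →+* R) : MvPolynomial (Exponent d) k →+* R :=
  eval₂Hom (φ.comp C) fun a ↦ φ (orbitCoeff F a.1)

lemma curveCoord_X {R : Type u} [CommRing R] (φ : MvPolynomial (Fin 3 × Fin 3) k →+* R)
    (a : Exponent d) : curveCoord F d φ (X a) = φ (orbitCoeff F a.1) := by
  simp [curveCoord]

lemma evalAway_fromZeroRingHom {ι : Type} {R : Type u} [CommRing R] (φ : MvPolynomial ι k →+* R)
    {f : MvPolynomial ι k} (hu : IsUnit (φ f)) (x : homogeneousSubmodule ι k 0) :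
    evalAway φ hu (fromZeroRingHom _ _ x) = φ x := by
  rw [evalAway, RingHom.comp_apply, HomogeneousLocalization.algebraMap_apply]
  exact IsLocalization.Away.lift_eq f hu x.1

lemma isUnit_orbitCoeff (hF : F.IsHomogeneous d) (hd : 0 < d) {a : Exponent d} {R : CommRingCat.{u}}
    {φ : MvPolynomial (Fin 3 × Fin 3) k →+* R} {i : Fin 3 × Fin 3} {hu : IsUnit (φ (X i))}
    {o : Spec R ⟶ (orbitOpen F a.1).toScheme}
    (ho : o ≫ (orbitOpen F a.1).ι = toProj φ (X_mem_homogeneousSubmodule i) one_pos hu) :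
    IsUnit (φ (orbitCoeff F a.1)) := by
  by_contra hn
  obtain ⟨M, hM, hxM⟩ := exists_max_ideal_of_mem_nonunits hn
  let p : Spec R := ⟨M, hM.isPrime⟩
  refine (toProj_mem_basicOpen φ (X_mem_homogeneousSubmodule i) one_pos hu
    (orbitCoeff_mem hF a.1) hd p).mp ?_ hxM
  rw [← ho, Scheme.Hom.comp_apply]
  exact (o p).2

lemma comp_orbitMap (hF : F.IsHomogeneous d) (hd : 0 < d) {a : Exponent d} {R : CommRingCat.{u}}
    {φ : MvPolynomial (Fin 3 × Fin 3) k →+* R} {i : Fin 3 × Fin 3} {hu : IsUnit (φ (X i))}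
    {o : Spec R ⟶ (orbitOpen F a.1).toScheme}
    (ho : o ≫ (orbitOpen F a.1).ι = toProj φ (X_mem_homogeneousSubmodule i) one_pos hu)
    (hv : IsUnit (curveCoord F d φ (X a))) :
    o ≫ orbitMap hF a = toProj (curveCoord F d φ) (X_mem_homogeneousSubmodule a) one_pos hv := by
  have hau := isUnit_orbitCoeff hF hd ho
  have hX : IsUnit (orbitRatioHom hF a.1 (X a)) := by
    rw [orbitRatioHom, eval₂Hom_X', orbitRatio_self]; exact isUnit_one
  let κ : Γ((orbitOpen F a.1).toScheme, ⊤) ⟶ R := o.appTop ≫ (Scheme.ΓSpecIso R).hom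
  have hκ : o ≫ (orbitOpen F a.1).toScheme.toSpecΓ = Spec.map κ := by
    rw [Scheme.toSpecΓ_naturality, Spec.map_comp, SpecMap_ΓSpecIso_hom]
  -- The pull-back of degree zero fractions along `o` is their evaluation at `φ`: both define the
  -- same morphism to the chart of `orbitCoeff F a`, whose inclusion is a monomorphism.
  have hev : κ.hom.comp (awayToOrbitOpen F a.1) = evalAway φ hau := by
    have h1 : Spec.map (CommRingCat.ofHom (κ.hom.comp (awayToOrbitOpen F a.1))) ≫
        Proj.awayι _ (orbitCoeff F a.1) (orbitCoeff_mem hF a.1) hd =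
        toProj φ (orbitCoeff_mem hF a.1) hd hau := by
      rw [← toProj_eq_toProj φ (X_mem_homogeneousSubmodule i) one_pos hu, ← ho]
      have h2 : CommRingCat.ofHom (κ.hom.comp (awayToOrbitOpen F a.1)) =
          Proj.awayToSection _ (orbitCoeff F a.1) ≫ (orbitOpen F a.1).topIso.inv ≫ κ := rfl
      rw [h2, Spec.map_comp, Spec.map_comp, ← hκ]
      simp only [Category.assoc]
      congr 1
      rw [Proj.awayι]
      have h3 : (orbitOpen F a.1).toScheme.toSpecΓ ≫ Spec.map (orbitOpen F a.1).topIso.inv ≫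
          Spec.map (Proj.awayToSection _ (orbitCoeff F a.1)) =
          (Proj.basicOpenIsoSpec _ (orbitCoeff F a.1) (orbitCoeff_mem hF a.1) hd).hom := by
        rw [Proj.basicOpenIsoSpec_hom, Proj.basicOpenToSpec, Scheme.Opens.toSpecΓ, Category.assoc]
      have h4 := congr($h3 ≫ (Proj.basicOpenIsoSpec _ (orbitCoeff F a.1)
        (orbitCoeff_mem hF a.1) hd).inv ≫ (orbitOpen F a.1).ι)
      rw [Iso.hom_inv_id_assoc] at h4
      simpa only [Category.assoc] using h4
    rw [toProj, cancel_mono] at h1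
    exact congr($(Spec.map_injective h1).hom)
  rw [orbitMap, fromOfGlobalSections_eq _ _ (X_mem_homogeneousSubmodule a) one_pos hX,
    ← Category.assoc, hκ, specMap_toProj]
  symm
  refine toProj_congr hau (fun c ↦ ?_) (fun b ↦ ?_) _ _ _ _
  · rw [curveCoord, eval₂Hom_C, RingHom.comp_apply, RingHom.comp_apply, orbitRatioHom, eval₂Hom_C]
    simp only [RingHom.comp_apply]
    rw [← RingHom.comp_apply κ.hom, hev, evalAway_fromZeroRingHom]
    rfl
  · rw [curveCoord_X, RingHom.comp_apply, orbitRatioHom, eval₂Hom_X', orbitRatio,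
      ← RingHom.comp_apply κ.hom, hev]
    have := evalAway_mk φ hau (orbitCoeff_mem hF a.1) 1 (orbitCoeff F b)
      (by simpa using orbitCoeff_mem hF b)
    rwa [pow_one, eq_comm] at this

/-- Locally the base ideal is generated by a regular element `y`. Where `y` is invertible, some
coefficient is a unit near each point, so both lifts coincide with c there; density of `D(y)` does
the rest. -/
lemma IsRegularLift.unique {hF : F.IsHomogeneous d} (hd : 0 < d)
    {b : (MatrixSpace k).IdealSheafData}
    (hb : ∀ {R : CommRingCat.{u}} (φ : MvPolynomial (Fin 3 × Fin 3) k →+* R) (i : Fin 3 × Fin 3)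
      (hu : IsUnit (φ (X i))), b.comap (toProj φ (X_mem_homogeneousSubmodule i) one_pos hu) =
        idl (Ideal.span (Set.range fun a : Exponent d ↦ φ (orbitCoeff F a.1))))
    {W : Scheme.{u}} {π : W ⟶ MatrixSpace k} (hπ : IsCartier (b.comap π))
    {f g : W ⟶ CurveSpace k d} (hf : IsRegularLift hF π f) (hg : IsRegularLift hF π g) : f = g := by
  apply hom_ext_of_charts
  intro x
  obtain ⟨A, c, hc, φ, i, hu, ⟨p, rfl⟩, hcπ⟩ := exists_toProj π x
  have hK : (b.comap π).comap c =
      idl (Ideal.span (Set.range fun a : Exponent d ↦ φ (orbitCoeff F a.1))) := by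
    rw [← comap_comp, hcπ, hb]
  obtain ⟨r, hr, y, hy, hJ⟩ := (isCartier_iff.mp hπ (c p)).exists_specAway hK
  refine ⟨_, specAway r ≫ c, inferInstance, ?_, ?_⟩
  · obtain ⟨q, rfl⟩ := (mem_range_specAway r p).mpr hr
    exact ⟨q, rfl⟩
  refine ext_of_specAway (A := .of (Localization.Away r)) hy ?_
  apply hom_ext_of_charts
  intro q
  have hun : IsUnit (algebraMap (Localization.Away r) (Localization.Away y) y) :=
    IsLocalization.Away.algebraMap_isUnit y
  have h1 : ∃ a : Exponent d, algebraMap _ (Localization.Away y)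
      (algebraMap A (Localization.Away r) (φ (orbitCoeff F a.1))) ∉ q.asIdeal := by
    by_contra! hn
    have h2 : Ideal.span {y} ≤ q.asIdeal.comap (algebraMap _ (Localization.Away y)) := by
      rw [← hJ, Ideal.map_span, Ideal.span_le]
      rintro _ ⟨_, ⟨a, rfl⟩, rfl⟩
      exact hn a
    exact q.2.ne_top (Ideal.eq_top_of_isUnit_mem _ (h2 (Ideal.mem_span_singleton_self y)) hun)
  obtain ⟨a, ha⟩ := h1
  let t := specAway (R := .of (Localization.Away r)) y ≫ specAway r ≫ c
  have ht : t ≫ π = toProj (((algebraMap _ (Localization.Away y)).comp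
      (algebraMap A (Localization.Away r))).comp φ) (X_mem_homogeneousSubmodule i) one_pos
      (hu.map ((algebraMap _ (Localization.Away y)).comp
          (algebraMap A (Localization.Away r)))) := by
    simp only [t, Category.assoc, hcπ]
    rw [specAway, specAway, specMap_toProj, specMap_toProj]
    rfl
  have hq : t q ∈ π ⁻¹ᵁ orbitOpen F a.1 := by
    change π (t q) ∈ orbitOpen F a.1
    rw [← Scheme.Hom.comp_apply, ht]
    exact (toProj_mem_basicOpen _ (X_mem_homogeneousSubmodule i) one_pos _ (orbitCoeff_mem hF a.1)
      hd q).mpr ha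
  let U := t ⁻¹ᵁ π ⁻¹ᵁ orbitOpen F a.1
  refine ⟨_, U.ι, inferInstance, by simpa [U] using hq, ?_⟩
  let o := t ∣_ (π ⁻¹ᵁ orbitOpen F a.1) ≫ π ∣_ orbitOpen F a.1
  have ho : (U.ι ≫ t) ≫ π = o ≫ (orbitOpen F a.1).ι := by
    simp only [o, Category.assoc, morphismRestrict_ι, morphismRestrict_ι_assoc, U]
  have h3 := (isRegularLift_iff.mp hf a (U.ι ≫ t) o ho).trans
    (isRegularLift_iff.mp hg a (U.ι ≫ t) o ho).symm
  simpa only [t, Category.assoc] using h3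

/-- The `z a` are homogeneous coordinates of a point everywhere, as one of them is a unit. Where c
is defined `y` is invertible, and the factor `y` does not affect the point. -/
lemma exists_isRegularLift_chart (hF : F.IsHomogeneous d) (hd : 0 < d) {R : CommRingCat.{u}}
    {φ : MvPolynomial (Fin 3 × Fin 3) k →+* R} {i : Fin 3 × Fin 3} (hu : IsUnit (φ (X i)))
    {y : R} (z : Exponent d → R) (hz : ∀ a, φ (orbitCoeff F a.1) = y * z a) {a₀ : Exponent d}
    (ha₀ : IsUnit (z a₀)) :
    ∃ l : Spec R ⟶ CurveSpace k d,
      IsRegularLift hF (toProj φ (X_mem_homogeneousSubmodule i) one_pos hu) l := by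
  let Φ : MvPolynomial (Exponent d) k →+* R := eval₂Hom (φ.comp C) z
  have hΦ : ∀ a, Φ (X a) = z a := fun a ↦ by simp [Φ]
  have hv : IsUnit (Φ (X a₀)) := by rwa [hΦ]
  refine ⟨toProj Φ (X_mem_homogeneousSubmodule a₀) one_pos hv, isRegularLift_iff.mpr ?_⟩
  intro a T t o hto
  apply hom_ext_of_charts
  intro x
  obtain ⟨S, j, hj, p, rfl⟩ := exists_chart x
  refine ⟨_, j, hj, ⟨p, rfl⟩, ?_⟩
  obtain ⟨ψ, hψ⟩ := Spec.map_surjective (j ≫ t)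
  have ho : (j ≫ o) ≫ (orbitOpen F a.1).ι =
      toProj (ψ.hom.comp φ) (X_mem_homogeneousSubmodule i) one_pos (hu.map ψ.hom) := by
    rw [Category.assoc, ← hto, ← Category.assoc, ← hψ, specMap_toProj]
  have hau := isUnit_orbitCoeff hF hd ho
  have hyu : IsUnit (ψ.hom y) := by
    rw [RingHom.comp_apply, hz, map_mul] at hau
    exact isUnit_of_mul_isUnit_left hau
  have hza : IsUnit ((ψ.hom.comp Φ) (X a)) := by
    rw [RingHom.comp_apply, hz, map_mul] at hau
    rw [RingHom.comp_apply, hΦ]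
    exact isUnit_of_mul_isUnit_right hau
  have hcc : IsUnit (curveCoord F d (ψ.hom.comp φ) (X a)) := by rwa [curveCoord_X]
  rw [← Category.assoc, ← Category.assoc, comp_orbitMap hF hd ho hcc, ← hψ, specMap_toProj,
    toProj_eq_toProj (ψ.hom.comp Φ) (X_mem_homogeneousSubmodule a₀) one_pos _
      (X_mem_homogeneousSubmodule a) one_pos hza]
  symm
  refine toProj_congr hyu (fun c ↦ ?_) (fun b ↦ ?_) _ _ _ _
  · simp [curveCoord, Φ]
  · rw [curveCoord_X, RingHom.comp_apply, RingHom.comp_apply, hΦ, hz, map_mul]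

/-- If the ideal generated by the coordinates of the rational map becomes invertible, then the
rational map becomes regular. -/
lemma exists_isRegularLift (hF : F.IsHomogeneous d) (hd : 0 < d)
    {b : (MatrixSpace k).IdealSheafData}
    (hb : ∀ {R : CommRingCat.{u}} (φ : MvPolynomial (Fin 3 × Fin 3) k →+* R) (i : Fin 3 × Fin 3)
      (hu : IsUnit (φ (X i))), b.comap (toProj φ (X_mem_homogeneousSubmodule i) one_pos hu) =
        idl (Ideal.span (Set.range fun a : Exponent d ↦ φ (orbitCoeff F a.1))))
    {W : Scheme.{u}} {π : W ⟶ MatrixSpace k} (hπ : IsCartier (b.comap π)) :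
    ∃ f : W ⟶ CurveSpace k d, IsRegularLift hF π f := by
  have hloc : ∀ x : W, ∃ U : W.Opens, x ∈ U ∧ ∃ l : U.toScheme ⟶ CurveSpace k d,
      IsRegularLift hF (U.ι ≫ π) l := by
    intro x
    suffices h : ∃ (R : CommRingCat.{u}) (c : Spec R ⟶ W) (_ : IsOpenImmersion c),
        x ∈ Set.range c ∧ ∃ l : Spec R ⟶ CurveSpace k d, IsRegularLift hF (c ≫ π) l by
      obtain ⟨R, c, hc, hx, l, hl⟩ := h
      refine ⟨c.opensRange, hx, c.isoOpensRange.inv ≫ l, ?_⟩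
      have := hl.comp c.isoOpensRange.inv
      rwa [← Category.assoc, Scheme.Hom.isoOpensRange_inv_comp] at this
    obtain ⟨A, c, hc, φ, i, hu, ⟨p, rfl⟩, hcπ⟩ := exists_toProj π x
    have hK : (b.comap π).comap c =
        idl (Ideal.span (Set.range fun a : Exponent d ↦ φ (orbitCoeff F a.1))) := by
      rw [← comap_comp, hcπ, hb]
    obtain ⟨r, hr, y, hy, hJ⟩ := (isCartier_iff.mp hπ (c p)).exists_specAway hK
    rw [Ideal.map_span, ← Set.range_comp] at hJ
    have hmem : ∀ a : Exponent d, ∃ z, algebraMap A (Localization.Away r) (φ (orbitCoeff F a.1)) =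
        y * z := fun a ↦ Ideal.mem_span_singleton.mp (hJ.le (Ideal.subset_span ⟨a, rfl⟩))
    choose z hz using hmem
    -- The regular generator `y` can be cancelled from `(y) = (y) · (z a)`.
    have hone : Ideal.span (Set.range z) = ⊤ := by
      have h1 : y ∈ Ideal.span {y} * Ideal.span (Set.range z) := by
        have h2 := Ideal.mem_span_singleton_self y
        rw [← hJ] at h2
        refine Ideal.span_le.mpr ?_ h2
        rintro _ ⟨a, rfl⟩
        rw [Function.comp_apply, hz]
        exact Ideal.mul_mem_mul (Ideal.mem_span_singleton_self y) (Ideal.subset_span ⟨a, rfl⟩)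
      obtain ⟨t, ht, hty⟩ := Ideal.mem_span_singleton_mul.mp h1
      have : t = 1 := by
        rw [← mul_cancel_left_mem_nonZeroDivisors hy, hty, mul_one]
      rwa [Ideal.eq_top_iff_one, ← this]
    obtain ⟨q, rfl⟩ := (mem_range_specAway r p).mpr hr
    have h1 : ∃ a, z a ∉ q.asIdeal := by
      by_contra! hn
      refine q.2.ne_top (top_le_iff.mp (hone.ge.trans ?_))
      rw [Ideal.span_le]
      rintro _ ⟨a, rfl⟩
      exact hn a
    obtain ⟨a₀, ha₀⟩ := h1
    obtain ⟨q', rfl⟩ := (mem_range_specAway (R := .of (Localization.Away r)) (z a₀) q).mpr ha₀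
    refine ⟨_, specAway (R := .of (Localization.Away r)) (z a₀) ≫ specAway r ≫ c, inferInstance,
      ⟨q', rfl⟩, ?_⟩
    let ψ : A →+* Localization.Away (z a₀) :=
      (algebraMap (Localization.Away r) (Localization.Away (z a₀))).comp
        (algebraMap A (Localization.Away r))
    have ht : (specAway (R := .of (Localization.Away r)) (z a₀) ≫ specAway r ≫ c) ≫ π =
        toProj (ψ.comp φ) (X_mem_homogeneousSubmodule i) one_pos (hu.map ψ) := by
      simp only [Category.assoc, hcπ]
      rw [specAway, specAway, specMap_toProj, specMap_toProj]
      rfl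
    rw [ht]
    refine exists_isRegularLift_chart hF hd _ (y := algebraMap _ _ y)
      (fun a ↦ algebraMap _ (Localization.Away (z a₀)) (z a)) (fun a ↦ ?_) (a₀ := a₀)
      (IsLocalization.Away.algebraMap_isUnit (z a₀))
    rw [← map_mul, ← hz]
    rfl
  choose U hxU l hl using hloc
  have hU : IsOpenCover U := IsOpenCover.mk (by
    rw [eq_top_iff]
    exact fun x _ ↦ Opens.mem_iSup.mpr ⟨x, hxU x⟩)
  let 𝒰 := W.openCoverOfIsOpenCover U hU
  -- Restricted to an overlap, the local lifts are lifts of the same map with invertible base ideal,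
  -- hence equal.
  have hcomp : ∀ x y, pullback.fst (𝒰.f x) (𝒰.f y) ≫ l x = pullback.snd (𝒰.f x) (𝒰.f y) ≫ l y := by
    intro x y
    have h1 := (hl x).comp (pullback.fst (𝒰.f x) (𝒰.f y))
    have h2 := (hl y).comp (pullback.snd (𝒰.f x) (𝒰.f y))
    replace h1 := (congrArg (fun t ↦ IsRegularLift hF t _) (Category.assoc _ _ _)).mpr h1
    replace h2 := (congrArg (fun t ↦ IsRegularLift hF t _) (Category.assoc _ _ _)).mpr h2
    have h3 : pullback.snd (𝒰.f x) (𝒰.f y) ≫ (U y).ι = pullback.fst (𝒰.f x) (𝒰.f y) ≫ (U x).ι :=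
      pullback.condition.symm
    replace h2 := (congrArg (fun t ↦ IsRegularLift hF (t ≫ π) _) h3).mp h2
    refine IsRegularLift.unique hd hb ?_ h1 h2
    rw [comap_comp]
    have h4 : IsOpenImmersion (pullback.fst (U x).ι (U y).ι) := inferInstance
    have h5 : IsOpenImmersion (pullback.fst (U x).ι (U y).ι ≫ (U x).ι) := inferInstance
    exact @IsCartier.comap_of_isOpenImmersion _ _ _ hπ _ h5
  refine ⟨𝒰.glueMorphisms l hcomp, IsRegularLift.of_charts fun x ↦ ⟨_, (U x).ι, inferInstance, ?_,
      ?_⟩⟩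
  · simpa using hxU x
  · have : (U x).ι ≫ 𝒰.glueMorphisms l hcomp = l x := 𝒰.ι_glueMorphisms l hcomp x
    rw [this]
    exact hl x

end RegularLift

/-! ## Smoothness of the centers -/

/-- An open chart of a closed subscheme. -/
lemma exists_chart_subscheme {V : Scheme.{u}} {Z : V.IdealSheafData} {R S : CommRingCat.{u}}
    (c : Spec R ⟶ V) [IsOpenImmersion c] {ψ : R ⟶ S} (hψ : Function.Surjective ψ.hom)
    (hZ : Z.comap c = idl (RingHom.ker ψ.hom)) :
    ∃ (g : Spec S ⟶ Z.subscheme) (_ : IsOpenImmersion g),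
      g ≫ Z.subschemeι = Spec.map ψ ≫ c ∧
      ∀ z, Z.subschemeι z ∈ Set.range c → z ∈ Set.range g := by
  have : IsClosedImmersion (Spec.map ψ) := IsClosedImmersion.spec_of_surjective ψ hψ
  have hker : (pullback.fst c Z.subschemeι).ker = (Spec.map ψ).ker := by
    have h1 : (idl ⊥ : (Spec S).IdealSheafData) = ⊥ := (idlIso _).map_bot
    have h2 := (Scheme.IdealSheafData.map_bot (Spec.map ψ)).symm.trans
      ((congrArg (fun K ↦ K.map (Spec.map ψ)) h1.symm).trans (map_idl _ _))
    exact hZ.trans h2.symm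
  let l := IsClosedImmersion.lift (pullback.fst c Z.subschemeι) (Spec.map ψ) hker.le
  have hl : IsIso l := IsClosedImmersion.isIso_lift _ _ hker
  refine ⟨l ≫ pullback.snd c Z.subschemeι, inferInstance, ?_, fun z hz ↦ ?_⟩
  · rw [Category.assoc, ← pullback.condition, ← Category.assoc, IsClosedImmersion.lift_fac]
  · have h1 : z ∈ Set.range (pullback.snd c Z.subschemeι) := by
      rw [IsOpenImmersion.range_pullbackSnd]; exact hz
    obtain ⟨t, rfl⟩ := h1
    refine ⟨inv l t, ?_⟩
    rw [← Scheme.Hom.comp_apply, IsIso.inv_hom_id_assoc]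

lemma isZariskiLocalAtSource_smoothOfRelativeDimension (n : ℕ) :
    IsZariskiLocalAtSource (@SmoothOfRelativeDimension.{u} n) :=
  have := instHasRingHomPropertySmoothOfRelativeDimensionLocallyIsStandardSmoothOfRelativeDimension.{u} n
  HasRingHomProperty.instIsZariskiLocalAtSource

lemma smoothOfRelativeDimension_of_charts {n : ℕ} {X Y : Scheme.{u}} {f : X ⟶ Y}
    (h : ∀ x : X, ∃ (U : Scheme.{u}) (g : U ⟶ X) (_ : IsOpenImmersion g), x ∈ Set.range g ∧
      SmoothOfRelativeDimension n (g ≫ f)) : SmoothOfRelativeDimension n f := by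
  choose U g hg hx h using h
  have := isZariskiLocalAtSource_smoothOfRelativeDimension.{u} n
  rw [IsZariskiLocalAtSource.iff_of_iSup_eq_top (P := @SmoothOfRelativeDimension.{u} n)
    (U := fun x ↦ (g x).opensRange)
    (eq_top_iff.mpr fun x _ ↦ Opens.mem_iSup.mpr ⟨x, hx x⟩)]
  intro x
  have h1 : (g x).opensRange.ι ≫ f = (g x).isoOpensRange.inv ≫ g x ≫ f := by
    rw [← Category.assoc, Scheme.Hom.isoOpensRange_inv_comp]
  rw [h1]
  exact IsZariskiLocalAtSource.comp (P := @SmoothOfRelativeDimension.{u} n) (h x) _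

/-- A closed subscheme is smooth if it is so in charts. -/
lemma smooth_subscheme_of_charts {n : ℕ} {V Y : Scheme.{u}} {Z : V.IdealSheafData} (f : V ⟶ Y)
    (h : ∀ x ∈ Z.support, ∃ (R S : CommRingCat.{u}) (c : Spec R ⟶ V) (_ : IsOpenImmersion c)
      (ψ : R ⟶ S), Function.Surjective ψ.hom ∧ x ∈ Set.range c ∧
      Z.comap c = idl (RingHom.ker ψ.hom) ∧ SmoothOfRelativeDimension n (Spec.map ψ ≫ c ≫ f)) :
    SmoothOfRelativeDimension n (Z.subschemeι ≫ f) := by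
  apply smoothOfRelativeDimension_of_charts
  intro z
  have hz : Z.subschemeι z ∈ Z.support := by
    rw [← SetLike.mem_coe, ← Z.range_subschemeι]; exact ⟨z, rfl⟩
  obtain ⟨R, S, c, hc, ψ, hψ, hx, hZ, hs⟩ := h _ hz
  obtain ⟨g, hg, h1, h2⟩ := exists_chart_subscheme c hψ hZ
  refine ⟨_, g, hg, h2 z hx, ?_⟩
  rwa [← Category.assoc, h1, Category.assoc]

/-! ### Translated subtori in coordinate subspaces: reducedness and smoothness -/

section TorusIdeal

open MvPolynomial hiding comap_comp comap_id algebraMap_apply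

variable {k : Type u} [Field k] {σ : Type}

/-- Setting some of the variables equal to zero. -/
def killVars (k : Type u) [Field k] (T : Set σ) : MvPolynomial σ k →ₐ[k] MvPolynomial σ k :=
  open scoped Classical in aeval fun i ↦ if i ∈ T then 0 else X i

lemma killVars_of_mem {T : Set σ} {i : σ} (hi : i ∈ T) : killVars k T (X i) = 0 := by
  simp [killVars, hi]

lemma killVars_of_notMem {T : Set σ} {i : σ} (hi : i ∉ T) : killVars k T (X i) = X i := by
  simp [killVars, hi]

lemma sub_killVars_mem (T : Set σ) (f : MvPolynomial σ k) :
    f - killVars k T f ∈ coordIdeal k T := by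
  rw [← Ideal.Quotient.eq]
  have : (Ideal.Quotient.mkₐ k (coordIdeal k T)).comp (killVars k T) =
      Ideal.Quotient.mkₐ k (coordIdeal k T) := by
    apply MvPolynomial.algHom_ext
    intro i
    by_cases hi : i ∈ T
    · rw [AlgHom.comp_apply, killVars_of_mem hi, map_zero, eq_comm]
      exact Ideal.Quotient.eq_zero_iff_mem.mpr (Ideal.subset_span ⟨i, hi, rfl⟩)
    · rw [AlgHom.comp_apply, killVars_of_notMem hi]
  exact congr($this f).symm

lemma X_dvd_iff_killVars {i : σ} {f : MvPolynomial σ k} : X i ∣ f ↔ killVars k {i} f = 0 := by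
  constructor
  · rintro ⟨g, rfl⟩
    rw [map_mul, killVars_of_mem (Set.mem_singleton i), zero_mul]
  · intro h
    have := sub_killVars_mem {i} f
    rwa [h, sub_zero, coordIdeal, Set.image_singleton, Ideal.mem_span_singleton] at this

/-- The equation of a translated subtorus of a torus of dimension two. -/
def torusEq (a b : σ) (p q : ℕ) (γ : k) : MvPolynomial σ k := X a ^ p * X b ^ q - C γ

lemma killVars_torusEq {a b : σ} {T : Set σ} (ha : a ∉ T) (hb : b ∉ T) (p q : ℕ) (γ : k) :
    killVars k T (torusEq a b p q γ) = torusEq a b p q γ := by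
  have : killVars k T (C γ) = C γ := (killVars k T).commutes γ
  rw [torusEq, map_sub, map_mul, map_pow, map_pow, killVars_of_notMem ha, killVars_of_notMem hb,
    this]

lemma torusEq_comm (a b : σ) (p q : ℕ) (γ : k) : torusEq a b p q γ = torusEq b a q p γ := by
  rw [torusEq, torusEq, mul_comm]

/-- The ideal of a translated subtorus in a coordinate subspace. -/
def torusIdeal (a b : σ) (p q : ℕ) (γ : k) (T : Set σ) : Ideal (MvPolynomial σ k) :=
  Ideal.span (Set.range fun o : Option T ↦ o.elim (torusEq a b p q γ) fun t ↦ X t.1)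

lemma torusIdeal_comm (a b : σ) (p q : ℕ) (γ : k) (T : Set σ) :
    torusIdeal a b p q γ T = torusIdeal b a q p γ T := by
  rw [torusIdeal, torusIdeal, torusEq_comm]

lemma torusIdeal_eq_sup (a b : σ) (p q : ℕ) (γ : k) (T : Set σ) :
    torusIdeal a b p q γ T = Ideal.span {torusEq a b p q γ} ⊔ coordIdeal k T := by
  rw [coordIdeal, ← Ideal.span_union, torusIdeal]
  congr 1
  ext f
  constructor
  · rintro ⟨_ | t, rfl⟩
    · exact Or.inl rfl
    · exact Or.inr ⟨t, t.2, rfl⟩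
  · rintro (rfl | ⟨t, ht, rfl⟩)
    · exact ⟨none, rfl⟩
    · exact ⟨some ⟨t, ht⟩, rfl⟩

lemma torusEq_mem_torusIdeal (a b : σ) (p q : ℕ) (γ : k) (T : Set σ) :
    torusEq a b p q γ ∈ torusIdeal a b p q γ T := Ideal.subset_span ⟨none, rfl⟩

lemma X_mem_torusIdeal (a b : σ) (p q : ℕ) (γ : k) {T : Set σ} {t : σ} (ht : t ∈ T) :
    X t ∈ torusIdeal a b p q γ T := Ideal.subset_span ⟨some ⟨t, ht⟩, rfl⟩

lemma mem_torusIdeal_iff {a b : σ} {T : Set σ} (ha : a ∉ T) (hb : b ∉ T) (p q : ℕ) (γ : k)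
    {f : MvPolynomial σ k} :
    f ∈ torusIdeal a b p q γ T ↔ torusEq a b p q γ ∣ killVars k T f := by
  constructor
  · intro h
    have : torusIdeal a b p q γ T ≤ (Ideal.span {torusEq a b p q γ}).comap (killVars k T) := by
      rw [torusIdeal, Ideal.span_le]
      rintro _ ⟨_ | t, rfl⟩
      · rw [SetLike.mem_coe, Ideal.mem_comap]
        change killVars k T (torusEq a b p q γ) ∈ _
        rw [killVars_torusEq ha hb]
        exact Ideal.mem_span_singleton_self _
      · rw [SetLike.mem_coe, Ideal.mem_comap]
        change killVars k T (X t.1) ∈ _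
        rw [killVars_of_mem t.2]
        exact zero_mem _
    exact Ideal.mem_span_singleton.mp (this h)
  · intro h
    rw [torusIdeal_eq_sup, ← sub_add_cancel f (killVars k T f), add_comm]
    exact Submodule.add_mem_sup (Ideal.mem_span_singleton.mpr h) (sub_killVars_mem T f)

/-- On the zero locus of the equation this derivative equals the constant `p * γ`, a unit in
characteristic zero when `p` and `γ` are nonzero. Both reducedness and smoothness rest on it. -/
lemma X_mul_pderiv_torusEq {a b : σ} (hab : a ≠ b) (p q : ℕ) (γ : k) :
    X a * pderiv a (torusEq a b p q γ) = C (p : k) * (torusEq a b p q γ + C γ) := by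
  have h : pderiv a (torusEq a b p q γ) = (p : MvPolynomial σ k) * X a ^ (p - 1) * X b ^ q := by
    simp [torusEq, pderiv_X_of_ne hab.symm, Derivation.leibniz]
    ring
  rw [h, torusEq, sub_add_cancel, C_eq_coe_nat]
  rcases p with _ | p
  · simp
  · rw [Nat.add_sub_cancel]; ring

variable [CharZero k]

/-- A factor whose square divides the equation also divides its derivative, hence the nonzero
constant `p * γ`. -/
lemma torusEq_squarefree {a b : σ} (hab : a ≠ b) {p q : ℕ} {γ : k} (hp : p ≠ 0) (hγ : γ ≠ 0) :
    Squarefree (torusEq a b p q γ) := by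
  rintro g ⟨f, hf⟩
  have h1 : g ∣ pderiv a (torusEq a b p q γ) := by
    rw [hf, Derivation.leibniz, Derivation.leibniz]
    simp only [smul_eq_mul]
    exact ⟨g * pderiv a f + 2 * f * pderiv a g, by ring⟩
  have h2 : g ∣ C ((p : k) * γ) := by
    have h3 := X_mul_pderiv_torusEq hab p q γ
    have h4 : (C ((p : k) * γ) : MvPolynomial σ k) =
        X a * pderiv a (torusEq a b p q γ) - C (p : k) * torusEq a b p q γ := by
      rw [h3, C_mul]; ring
    rw [h4]
    exact dvd_sub (h1.mul_left _) (Dvd.dvd.mul_left ⟨g * f, by rw [hf, mul_assoc]⟩ _)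
  exact isUnit_of_dvd_unit h2 ((isUnit_iff_ne_zero.mpr
    (mul_ne_zero (Nat.cast_ne_zero.mpr hp) hγ)).map C)

lemma torusIdeal_isRadical {a b : σ} (hab : a ≠ b) {T : Set σ} (ha : a ∉ T) (hb : b ∉ T) {p q : ℕ}
    {γ : k} (hpq : p ≠ 0 ∨ q ≠ 0) (hγ : γ ≠ 0) : (torusIdeal a b p q γ T).IsRadical := by
  wlog hp : p ≠ 0 generalizing a b p q
  · rw [torusIdeal_comm]
    exact this hab.symm hb ha hpq.symm (by tauto)
  rintro f ⟨n, hn⟩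
  rw [mem_torusIdeal_iff ha hb, map_pow] at hn
  rw [mem_torusIdeal_iff ha hb]
  exact (torusEq_squarefree hab hp hγ).isRadical n _ hn

/-- The Jacobian matrix with respect to `a` and the variables in `T` is diagonal, with entries `1`
and the derivative of the torus equation, which is a unit modulo the ideal. -/
lemma isStandardSmooth_quotient_torusIdeal [Finite σ] {a b : σ} (hab : a ≠ b) {T : Set σ}
    (ha : a ∉ T) (hb : b ∉ T) {p q : ℕ} {γ : k} (hpq : p ≠ 0 ∨ q ≠ 0) (hγ : γ ≠ 0) :
    Algebra.IsStandardSmoothOfRelativeDimension (Nat.card σ - (T.ncard + 1)) k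
      (MvPolynomial σ k ⧸ torusIdeal a b p q γ T) := by
  classical
  wlog hp : p ≠ 0 generalizing a b p q
  · rw [torusIdeal_comm]
    exact this hab.symm hb ha hpq.symm (by tauto)
  have := Fintype.ofFinite T
  let v : Option T → MvPolynomial σ k := fun o ↦ o.elim (torusEq a b p q γ) fun t ↦ X t.1
  let i : Option T → σ := fun o ↦ o.elim a fun t ↦ t.1
  have hi : Function.Injective i := by
    rintro (_ | t) (_ | t') h
    · rfl
    · exact absurd t'.2 (by rwa [← show a = t'.1 from h])
    · exact absurd t.2 (by rwa [show t.1 = a from h])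
    · rw [Subtype.ext (show t.1 = t'.1 from h)]
  let P := Algebra.PreSubmersivePresentation.naive (R := k) (v := v) i hi
  have hP : P.jacobiMatrix = Matrix.diagonal fun o : Option T ↦ pderiv (i o) (v o) := by
    ext o o' : 1
    have : P.jacobiMatrix o o' = pderiv (i o) (v o') :=
      Algebra.PreSubmersivePresentation.jacobiMatrix_naive i hi _ _ o o'
    rw [this]
    rcases eq_or_ne o o' with rfl | h
    · rw [Matrix.diagonal_apply_eq]
    · rw [Matrix.diagonal_apply_ne _ h]
      rcases o' with _ | t'
      · rcases o with _ | t
        · exact absurd rfl h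
        · have h1 : (t : σ) ≠ a := fun h ↦ ha (h ▸ t.2)
          have h2 : (t : σ) ≠ b := fun h ↦ hb (h ▸ t.2)
          simp [i, v, torusEq, pderiv_X_of_ne h1.symm, pderiv_X_of_ne h2.symm,
            Derivation.leibniz]
      · exact pderiv_X_of_ne fun h' ↦ h (hi h'.symm)
  have hunit : IsUnit P.jacobian := by
    rw [P.jacobian_eq_jacobiMatrix_det, hP, Matrix.det_diagonal, Fintype.prod_option]
    have h1 : ∏ t : T, pderiv (i (some t)) (v (some t)) = 1 :=
      Finset.prod_eq_one fun t _ ↦ pderiv_X_self _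
    rw [h1, mul_one]
    change IsUnit (Ideal.Quotient.mk (Ideal.span (Set.range v)) (pderiv a (torusEq a b p q γ)))
    have h2 := congr(Ideal.Quotient.mk (Ideal.span (Set.range v)) $(X_mul_pderiv_torusEq hab p q γ))
    have h3 : Ideal.Quotient.mk (Ideal.span (Set.range v)) (torusEq a b p q γ) = 0 :=
      Ideal.Quotient.eq_zero_iff_mem.mpr (Ideal.subset_span ⟨none, rfl⟩)
    rw [map_mul, map_mul, map_add, h3, zero_add, ← map_mul, ← map_mul, ← C_mul] at h2
    refine isUnit_of_mul_isUnit_right (x := Ideal.Quotient.mk _ (X a)) ?_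
    rw [← map_mul, h2]
    exact ((isUnit_iff_ne_zero.mpr (mul_ne_zero (Nat.cast_ne_zero.mpr hp) hγ)).map C).map _
  refine Algebra.SubmersivePresentation.isStandardSmoothOfRelativeDimension
    (P := { P with jacobian_isUnit := hunit }) ?_
  rw [Algebra.Presentation.dimension]
  congr 1
  rw [Finite.card_option]
  rfl

lemma smoothOfRelativeDimension_quotient_torusIdeal [Finite σ] {a b : σ} (hab : a ≠ b) {T : Set σ}
    (ha : a ∉ T) (hb : b ∉ T) {p q : ℕ} {γ : k} (hpq : p ≠ 0 ∨ q ≠ 0) (hγ : γ ≠ 0) {n : ℕ}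
    (hn : Nat.card σ - (T.ncard + 1) = n) {S : CommRingCat.{u}} {ψ : MvPolynomial σ k →+* S}
    (hψ : Function.Surjective ψ) (hker : RingHom.ker ψ = torusIdeal a b p q γ T) :
    SmoothOfRelativeDimension n (Spec.map (CommRingCat.ofHom (ψ.comp C))) := by
  have h1 : (algebraMap k (MvPolynomial σ k ⧸ torusIdeal a b p q γ
      T)).IsStandardSmoothOfRelativeDimension n := by
    rw [RingHom.isStandardSmoothOfRelativeDimension_algebraMap, ← hn]
    exact isStandardSmooth_quotient_torusIdeal hab ha hb hpq hγ
  let e : (MvPolynomial σ k ⧸ torusIdeal a b p q γ T) ≃+* S :=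
    (Ideal.quotEquivOfEq hker.symm).trans (RingHom.quotientKerEquivOfSurjective hψ)
  have h2 : Spec.map (CommRingCat.ofHom (ψ.comp C)) = Spec.map e.toCommRingCatIso.hom ≫
      Spec.map (CommRingCat.ofHom (algebraMap k (MvPolynomial σ k ⧸ torusIdeal a b p q γ T))) := by
    rw [← Spec.map_comp]
    rfl
  have := isZariskiLocalAtSource_smoothOfRelativeDimension.{u} n
  have := instHasRingHomPropertySmoothOfRelativeDimensionLocallyIsStandardSmoothOfRelativeDimension.{u} n
  rw [h2]
  refine IsZariskiLocalAtSource.comp (P := @SmoothOfRelativeDimension.{u} n) ?_ _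
  rw [HasRingHomProperty.Spec_iff (P := @SmoothOfRelativeDimension.{u} n)]
  exact RingHom.locally_of (RingHom.isStandardSmoothOfRelativeDimension_respectsIso) _ h1

end TorusIdeal

/-! ## The blow-up of a translated subtorus -/

section TorusChart

open MvPolynomial hiding comap_comp comap_id algebraMap_apply

variable {k : Type u} [Field k] {σ : Type}

/-- The equation of the chart of the blow-up of a translated subtorus: the additional variable is
the quotient of the equation of the subtorus by the equation of the exceptional divisor. -/
def torusRel (a b : σ) (p q : ℕ) (γ : k) (y : σ) : MvPolynomial (Option σ) k :=
  torusEq (some a) (some b) p q γ - X (some y) * X none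

/-- The coordinate ring of the chart. -/
def TorusChartRing (a b : σ) (p q : ℕ) (γ : k) (y : σ) : CommRingCat.{u} :=
  .of (MvPolynomial (Option σ) k ⧸ Ideal.span {torusRel a b p q γ y})

/-- The residue classes of the polynomials in the variables of the chart. -/
def torusMk (a b : σ) (p q : ℕ) (γ : k) (y : σ) :
    MvPolynomial (Option σ) k →+* TorusChartRing a b p q γ y := Ideal.Quotient.mk _

lemma torusMk_surjective (a b : σ) (p q : ℕ) (γ : k) (y : σ) :
    Function.Surjective (torusMk a b p q γ y) := Ideal.Quotient.mk_surjective

lemma torusMk_eq_zero_iff {a b : σ} {p q : ℕ} {γ : k} {y : σ} {f : MvPolynomial (Option σ) k} :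
    torusMk a b p q γ y f = 0 ↔ torusRel a b p q γ y ∣ f :=
  Ideal.Quotient.eq_zero_iff_mem.trans Ideal.mem_span_singleton

lemma torusMk_torusEq (a b : σ) (p q : ℕ) (γ : k) (y : σ) :
    torusMk a b p q γ y (torusEq (some a) (some b) p q γ) =
      torusMk a b p q γ y (X (some y)) * torusMk a b p q γ y (X none) := by
  rw [← map_mul, ← sub_eq_zero, ← map_sub, torusMk_eq_zero_iff, torusRel]

/-- The chart of the blow-up of a translated subtorus. -/
def torusChart (a b : σ) (p q : ℕ) (γ : k) (T : Set σ) (y : σ) :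
    MvPolynomial σ k →+* TorusChartRing a b p q γ y :=
  (torusMk a b p q γ y).comp
    (((rename some).comp (coordChart k T y) : MvPolynomial σ k →ₐ[k] MvPolynomial (Option σ) k) :
      MvPolynomial σ k →+* MvPolynomial (Option σ) k)

lemma torusChart_C (a b : σ) (p q : ℕ) (γ : k) (T : Set σ) (y : σ) (c : k) :
    torusChart a b p q γ T y (C c) = torusMk a b p q γ y (C c) := by
  simp [torusChart, coordChart, algebraMap_eq]

lemma torusChart_X_self (a b : σ) (p q : ℕ) (γ : k) (T : Set σ) (y : σ) :
    torusChart a b p q γ T y (X y) = torusMk a b p q γ y (X (some y)) := by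
  simp [torusChart]

lemma torusChart_X_of_mem (a b : σ) (p q : ℕ) (γ : k) {T : Set σ} {y i : σ} (hi : i ∈ T)
    (h : i ≠ y) : torusChart a b p q γ T y (X i) =
      torusMk a b p q γ y (X (some y)) * torusMk a b p q γ y (X (some i)) := by
  simp [torusChart, coordChart_of_mem hi h, mul_comm]

lemma torusChart_X_of_notMem (a b : σ) (p q : ℕ) (γ : k) {T : Set σ} {y i : σ} (hi : i ∉ T) :
    torusChart a b p q γ T y (X i) = torusMk a b p q γ y (X (some i)) := by
  simp [torusChart, coordChart_of_notMem hi]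

lemma torusChart_torusEq {a b : σ} (p q : ℕ) (γ : k) {T : Set σ} {y : σ} (ha : a ∉ T) (hb : b ∉ T) :
    torusChart a b p q γ T y (torusEq a b p q γ) =
      torusMk a b p q γ y (X (some y)) * torusMk a b p q γ y (X none) := by
  rw [← torusMk_torusEq, torusEq, torusEq, map_sub, map_mul, map_pow, map_pow, torusChart_C,
    torusChart_X_of_notMem a b p q γ ha, torusChart_X_of_notMem a b p q γ hb]
  simp only [map_sub, map_mul, map_pow]

lemma torusEq_ne_zero {a b : σ} {p q : ℕ} {γ : k} (hpq : p ≠ 0 ∨ q ≠ 0) (hγ : γ ≠ 0) :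
    torusEq a b p q γ ≠ 0 := by
  intro h
  have := congr(constantCoeff $h)
  have h1 : (0 : k) ^ p * 0 ^ q = 0 := by
    rcases hpq with h | h <;> simp [h]
  simp only [torusEq, map_sub, map_mul, map_pow, constantCoeff_X, constantCoeff_C, map_zero, h1,
    zero_sub, neg_eq_zero] at this
  exact hγ this

lemma not_X_dvd_torusEq {a b i : σ} {p q : ℕ} {γ : k} (ha : a ≠ i) (hb : b ≠ i)
    (hpq : p ≠ 0 ∨ q ≠ 0) (hγ : γ ≠ 0) : ¬ X i ∣ torusEq a b p q γ := by
  rw [X_dvd_iff_killVars, killVars_torusEq (by simpa using ha) (by simpa using hb)]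
  exact torusEq_ne_zero hpq hγ

lemma killVars_torusRel {a b y : σ} (ha : a ≠ y) (hb : b ≠ y) (p q : ℕ) (γ : k) :
    killVars k {some y} (torusRel a b p q γ y) = torusEq (some a) (some b) p q γ := by
  rw [torusRel, map_sub, killVars_torusEq (by simpa using ha) (by simpa using hb), map_mul,
    killVars_of_mem (Set.mem_singleton _), zero_mul, sub_zero]

/-- The exceptional divisor of the chart is regular, also together with another coordinate. -/
lemma torusMk_X_dvd {a b y : σ} (ha : a ≠ y) (hb : b ≠ y) {p q : ℕ} {γ : k}
    {g s : MvPolynomial (Option σ) k}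
    (hg : ∀ f, killVars k {some y} g ∣ torusEq (some a) (some b) p q γ * f →
      killVars k {some y} g ∣ f) (hg0 : killVars k {some y} g ≠ 0)
    (h : torusMk a b p q γ y (X (some y)) ∣ torusMk a b p q γ y (g * s)) :
    torusMk a b p q γ y (X (some y)) ∣ torusMk a b p q γ y s := by
  obtain ⟨t, ht⟩ := h
  obtain ⟨t, rfl⟩ := torusMk_surjective a b p q γ y t
  rw [← map_mul, ← sub_eq_zero, ← map_sub, torusMk_eq_zero_iff] at ht
  obtain ⟨f, hf⟩ := ht
  have h1 := congr(killVars k {some y} $hf)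
  rw [map_sub, map_mul, map_mul, map_mul, killVars_of_mem (Set.mem_singleton _), zero_mul, sub_zero,
    killVars_torusRel ha hb] at h1
  -- Modulo the exceptional variable the relation of the chart is the torus equation, so the
  -- hypothesis on `g` allows `g` to be cancelled: `s` is a multiple of the torus equation, which
  -- the exceptional variable divides in the chart ring.
  obtain ⟨f', hf'⟩ := hg _ ⟨_, h1.symm⟩
  rw [hf', mul_left_comm, mul_right_inj' hg0] at h1
  have h2 := sub_killVars_mem {some y} s
  rw [coordIdeal, Set.image_singleton, Ideal.mem_span_singleton, h1] at h2
  obtain ⟨z, hz⟩ := h2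
  rw [sub_eq_iff_eq_add] at hz
  rw [hz, map_add, map_mul, map_mul, torusMk_torusEq]
  exact dvd_add ⟨_, rfl⟩ ⟨torusMk a b p q γ y (X none) * torusMk a b p q γ y f', by ring⟩

/-- If `X (some y) * s` is the relation times `f`, setting that variable to zero shows that it
divides `f`, since the relation becomes a nonzero torus equation. Cancelling it leaves `s` a
multiple of the relation. -/
lemma torusMk_X_mem_nonZeroDivisors {a b y : σ} (ha : a ≠ y) (hb : b ≠ y) {p q : ℕ} {γ : k}
    (hpq : p ≠ 0 ∨ q ≠ 0) (hγ : γ ≠ 0) :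
    torusMk a b p q γ y (X (some y)) ∈ nonZeroDivisors (TorusChartRing a b p q γ y) := by
  rw [mem_nonZeroDivisors_iff_left]
  intro s hs
  obtain ⟨s, rfl⟩ := torusMk_surjective a b p q γ y s
  rw [← map_mul, torusMk_eq_zero_iff] at hs
  obtain ⟨f, hf⟩ := hs
  rw [torusMk_eq_zero_iff]
  have h1 := congr(killVars k {some y} $hf)
  rw [map_mul, map_mul, killVars_of_mem (Set.mem_singleton _), zero_mul, killVars_torusRel ha hb,
    eq_comm, mul_eq_zero, or_iff_right (torusEq_ne_zero hpq hγ), ← X_dvd_iff_killVars] at h1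
  obtain ⟨f', rfl⟩ := h1
  rw [mul_left_comm, mul_right_inj' (X_ne_zero _)] at hf
  exact ⟨f', hf⟩

lemma map_torusIdeal_torusChart {a b y : σ} {T : Set σ} (ha : a ∉ T) (hb : b ∉ T) (hy : y ∈ T)
    (p q : ℕ) (γ : k) : (torusIdeal a b p q γ T).map (torusChart a b p q γ T y) =
      Ideal.span {torusChart a b p q γ T y (X y)} := by
  apply le_antisymm
  · rw [torusIdeal, Ideal.map_span, Ideal.span_le]
    rintro _ ⟨_, ⟨_ | t, rfl⟩, rfl⟩
    · change torusChart a b p q γ T y (torusEq a b p q γ) ∈ _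
      rw [SetLike.mem_coe, Ideal.mem_span_singleton, torusChart_torusEq p q γ ha hb,
          torusChart_X_self]
      exact ⟨_, rfl⟩
    · change torusChart a b p q γ T y (X t.1) ∈ _
      rw [SetLike.mem_coe, Ideal.mem_span_singleton]
      by_cases h : t.1 = y
      · rw [h]
      · rw [torusChart_X_of_mem a b p q γ t.2 h, torusChart_X_self]
        exact ⟨_, rfl⟩
  · rw [Ideal.span_singleton_le_iff_mem]
    exact Ideal.mem_map_of_mem _ (X_mem_torusIdeal a b p q γ hy)

/-- As for coordinate subspaces, with the variable `none` in the role of the quotient of the torus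
equation by `y`; the relation of the chart records exactly this. -/
lemma isBlowupChart_torusChart {a b y : σ} {T : Set σ} (ha : a ∉ T) (hb : b ∉ T) (hy : y ∈ T)
    {p q : ℕ} {γ : k} (hpq : p ≠ 0 ∨ q ≠ 0) (hγ : γ ≠ 0) :
    IsBlowupChart (R := .of (MvPolynomial σ k)) (R' := TorusChartRing a b p q γ y)
      (CommRingCat.ofHom (S := TorusChartRing a b p q γ y) (torusChart a b p q γ T y))
          (torusIdeal a b p q γ T) (X y) := by
  classical
  have hay : a ≠ y := fun h ↦ ha (h ▸ hy)
  have hby : b ≠ y := fun h ↦ hb (h ▸ hy)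
  have h1 : torusChart a b p q γ T y (X y) ∈ nonZeroDivisors (TorusChartRing a b p q γ y) := by
    rw [torusChart_X_self]
    exact torusMk_X_mem_nonZeroDivisors hay hby hpq hγ
  refine ⟨h1, map_torusIdeal_torusChart ha hb hy p q γ, fun {S} ψ h2 h3 ↦ ?_,
    fun {S} χ χ' h2 h3 ↦ ?_⟩
  · have hm : ∀ f ∈ torusIdeal a b p q γ T, ∃ z, ψ.hom f = ψ.hom (X y) * z := fun f hf ↦
      Ideal.mem_span_singleton.mp (h3.le (Ideal.mem_map_of_mem _ hf))
    obtain ⟨t₀, ht₀⟩ := hm _ (torusEq_mem_torusIdeal a b p q γ T)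
    have : ∀ i : T, ∃ z, ψ.hom (X i.1) = ψ.hom (X y) * z := fun i ↦
      hm _ (X_mem_torusIdeal a b p q γ i.2)
    choose t ht using this
    let χ₀ : MvPolynomial (Option σ) k →+* S := eval₂Hom (ψ.hom.comp C) fun o ↦ o.elim t₀
      fun i ↦ if h : i ∈ T ∧ i ≠ y then t ⟨i, h.1⟩ else ψ.hom (X i)
    have hC : ∀ c, χ₀ (C c) = ψ.hom (C c) := fun c ↦ by simp [χ₀]
    have hn : χ₀ (X none) = t₀ := by simp [χ₀]
    have hs1 : ∀ i, i ∉ T → χ₀ (X (some i)) = ψ.hom (X i) := fun i hi ↦ by simp [χ₀, hi]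
    have hs2 : χ₀ (X (some y)) = ψ.hom (X y) := by simp [χ₀]
    have hs3 : ∀ i (hi : i ∈ T), i ≠ y → χ₀ (X (some i)) = t ⟨i, hi⟩ := fun i hi h ↦ by
      simp [χ₀, hi, h]
    have hker : ∀ f ∈ Ideal.span {torusRel a b p q γ y}, χ₀ f = 0 := by
      intro f hf
      obtain ⟨g, rfl⟩ := Ideal.mem_span_singleton.mp hf
      have h4 : χ₀ (torusRel a b p q γ y) = 0 := by
        rw [torusRel, torusEq]
        rw [torusEq] at ht₀
        simp only [map_sub, map_mul, map_pow] at ht₀ ⊢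
        rw [hs1 a ha, hs1 b hb, hC, hs2, hn, ← ht₀, sub_self]
      rw [map_mul, h4, zero_mul]
    let χ : TorusChartRing a b p q γ y →+* S := Ideal.Quotient.lift _ χ₀ hker
    have hχ : ∀ f, χ (torusMk a b p q γ y f) = χ₀ f := fun f ↦ Ideal.Quotient.lift_mk _ _ _
    refine ⟨CommRingCat.ofHom (R := TorusChartRing a b p q γ y) χ, ?_⟩
    ext : 1
    change χ.comp (torusChart a b p q γ T y) = ψ.hom
    apply MvPolynomial.ringHom_ext
    · intro c
      rw [RingHom.comp_apply, torusChart_C, hχ, hC]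
    · intro i
      rw [RingHom.comp_apply]
      by_cases hi : i ∈ T
      · by_cases hiy : i = y
        · rw [hiy, torusChart_X_self, hχ, hs2]
        · rw [torusChart_X_of_mem a b p q γ hi hiy, map_mul, hχ, hχ, hs2, hs3 i hi hiy]
          exact (ht ⟨i, hi⟩).symm
      · rw [torusChart_X_of_notMem a b p q γ hi, hχ, hs1 i hi]
  · have h4 : ∀ f, χ.hom (torusChart a b p q γ T y f) = χ'.hom (torusChart a b p q γ T y f) :=
      fun f ↦ congr($(h3).hom f)
    have h5 := h4 (X y)
    replace h2 : χ.hom (torusChart a b p q γ T y (X y)) ∈ nonZeroDivisors S := h2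
    rw [torusChart_X_self] at h2 h5
    ext : 1
    apply Ideal.Quotient.ringHom_ext
    change χ.hom.comp (torusMk a b p q γ y) = χ'.hom.comp (torusMk a b p q γ y)
    apply MvPolynomial.ringHom_ext
    · intro c
      simpa only [torusChart_C, RingHom.comp_apply] using h4 (C c)
    · rintro (_ | i)
      · have h6 := h4 (torusEq a b p q γ)
        rw [torusChart_torusEq p q γ ha hb, map_mul, map_mul, ← h5] at h6
        exact (mul_cancel_left_mem_nonZeroDivisors h2).mp h6
      · by_cases hi : i ∈ T
        · by_cases hiy : i = y
          · rw [hiy]; exact h5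
          · have h6 := h4 (X i)
            rw [torusChart_X_of_mem a b p q γ hi hiy, map_mul, map_mul, ← h5] at h6
            exact (mul_cancel_left_mem_nonZeroDivisors h2).mp h6
        · simpa only [torusChart_X_of_notMem a b p q γ hi, RingHom.comp_apply] using h4 (X i)

/-- The ideal obtained from the ideal of a translated subtorus by squaring some of the generators,
namely the variables in `Y`. -/
def thickIdeal (a b : σ) (p q : ℕ) (γ : k) (W Y : Set σ) : Ideal (MvPolynomial σ k) :=
  torusIdeal a b p q γ W ⊔ coordIdeal k Y ^ 2

lemma thickIdeal_le (a b : σ) (p q : ℕ) (γ : k) (W Y : Set σ) :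
    thickIdeal a b p q γ W Y ≤ torusIdeal a b p q γ (W ∪ Y) := by
  rw [thickIdeal, torusIdeal_eq_sup, torusIdeal_eq_sup]
  refine sup_le (sup_le le_sup_left (le_sup_of_le_right ?_)) (le_sup_of_le_right ?_)
  · exact Ideal.span_mono (Set.image_mono Set.subset_union_left)
  · exact (Ideal.pow_le_self two_ne_zero).trans
      (Ideal.span_mono (Set.image_mono Set.subset_union_right))

lemma thickIdeal_le_iff_of_isPrime (a b : σ) (p q : ℕ) (γ : k) (W Y : Set σ)
    {P : Ideal (MvPolynomial σ k)} (hP : P.IsPrime) :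
    thickIdeal a b p q γ W Y ≤ P ↔ torusIdeal a b p q γ (W ∪ Y) ≤ P := by
  refine ⟨fun h ↦ ?_, (thickIdeal_le a b p q γ W Y).trans⟩
  obtain ⟨h1, h2⟩ := sup_le_iff.mp h
  replace h2 := hP.le_of_pow_le h2
  rw [torusIdeal_eq_sup] at h1 ⊢
  obtain ⟨h1, h3⟩ := sup_le_iff.mp h1
  refine sup_le h1 ?_
  rw [coordIdeal, Set.image_union, Ideal.span_union]
  exact sup_le h3 h2

/-- The coordinates vanishing on the center of the second blow-up. -/
def exceptionalVars (W : Set σ) (y : σ) : Set (Option σ) := insert none (some '' insert y W)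

/-- The torus equation and the variables in `W` become `y` times `none` and `y` times the new
variables, while the ideal of `Y` becomes `(y)`, so that its square is `y · (y)`. The common factor
`y` leaves `none`, `W` and `y` as generators. -/
lemma map_thickIdeal {a b y : σ} {W Y : Set σ} (ha : a ∉ W ∪ Y) (hb : b ∉ W ∪ Y) (hy : y ∈ Y)
    (hyW : y ∉ W) (p q : ℕ) (γ : k) :
    (thickIdeal a b p q γ W Y).map (torusChart a b p q γ (W ∪ Y) y) =
      Ideal.span {torusChart a b p q γ (W ∪ Y) y (X y)} *
        (coordIdeal k (exceptionalVars W y)).map (torusMk a b p q γ y) := by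
  have hY : (coordIdeal k Y).map (torusChart a b p q γ (W ∪ Y) y) =
      Ideal.span {torusChart a b p q γ (W ∪ Y) y (X y)} := by
    apply le_antisymm
    · rw [← map_torusIdeal_torusChart ha hb (Or.inr hy), torusIdeal_eq_sup]
      exact Ideal.map_mono (le_sup_of_le_right
        (Ideal.span_mono (Set.image_mono Set.subset_union_right)))
    · rw [Ideal.span_singleton_le_iff_mem]
      exact Ideal.mem_map_of_mem _ (Ideal.subset_span ⟨y, hy, rfl⟩)
  have hW : (torusIdeal a b p q γ W).map (torusChart a b p q γ (W ∪ Y) y) =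
      Ideal.span {torusChart a b p q γ (W ∪ Y) y (X y)} *
        (coordIdeal k (insert none (some '' W))).map (torusMk a b p q γ y) := by
    rw [coordIdeal, Ideal.map_span, Ideal.span_mul_span', torusIdeal, Ideal.map_span,
      torusChart_X_self]
    congr 1
    ext f
    constructor
    · rintro ⟨_, ⟨_ | t, rfl⟩, rfl⟩
      · exact ⟨_, rfl, _, ⟨_, ⟨none, Or.inl rfl, rfl⟩, rfl⟩, (torusChart_torusEq p q γ ha hb).symm⟩
      · exact ⟨_, rfl, _, ⟨_, ⟨some t.1, Or.inr ⟨_, t.2, rfl⟩, rfl⟩, rfl⟩,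
          (torusChart_X_of_mem a b p q γ (Or.inl t.2) (fun (h : t.1 = y) ↦ hyW (h ▸ t.2))).symm⟩
    · rintro ⟨_, rfl, _, ⟨_, ⟨_, rfl | ⟨t, ht, rfl⟩, rfl⟩, rfl⟩, rfl⟩
      · exact ⟨_, ⟨none, rfl⟩, torusChart_torusEq p q γ ha hb⟩
      · exact ⟨_, ⟨some ⟨t, ht⟩, rfl⟩,
          torusChart_X_of_mem a b p q γ (Or.inl ht) (fun (h : t = y) ↦ hyW (h ▸ ht))⟩
  rw [thickIdeal, Ideal.map_sup, Ideal.map_pow, hY, hW, pow_two, ← Ideal.mul_sup]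
  congr 1
  have : exceptionalVars W y = insert none (some '' W) ∪ {some y} := by
    rw [exceptionalVars, Set.image_insert_eq, Set.insert_comm, Set.union_singleton]
  rw [this, coordIdeal, coordIdeal, Set.image_union, Ideal.span_union, Ideal.map_sup,
    torusChart_X_self, Set.image_singleton, Ideal.map_span (torusMk a b p q γ y) {_},
    Set.image_singleton]

/-- The relation differs from the torus equation by a multiple of `X none`. Consequently the second
center is again a translated subtorus of a coordinate subspace, and the earlier results on these
apply. -/
lemma ker_sup_coordIdeal {a b y : σ} (p q : ℕ) (γ : k) (W : Set σ) :
    RingHom.ker (torusMk a b p q γ y) ⊔ coordIdeal k (exceptionalVars W y) =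
      torusIdeal (some a) (some b) p q γ (exceptionalVars W y) := by
  have h1 : RingHom.ker (torusMk a b p q γ y) = Ideal.span {torusRel a b p q γ y} :=
    Ideal.mk_ker
  have h2 : X (some y) * X none ∈ coordIdeal k (exceptionalVars W y) :=
    Ideal.mul_mem_left _ _ (Ideal.subset_span ⟨none, Or.inl rfl, rfl⟩)
  rw [h1, torusIdeal_eq_sup]
  apply le_antisymm
  · refine sup_le ?_ le_sup_right
    rw [Ideal.span_singleton_le_iff_mem, torusRel]
    exact sub_mem (Ideal.mem_sup_left (Ideal.mem_span_singleton_self _)) (Ideal.mem_sup_right h2)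
  · refine sup_le ?_ le_sup_right
    rw [Ideal.span_singleton_le_iff_mem,
      ← sub_add_cancel (torusEq (some a) (some b) p q γ) (X (some y) * X none)]
    exact add_mem (Ideal.mem_sup_left (Ideal.mem_span_singleton_self _)) (Ideal.mem_sup_right h2)

lemma comap_map_coordIdeal {a b y : σ} (p q : ℕ) (γ : k) (W : Set σ) :
    ((coordIdeal k (exceptionalVars W y)).map (torusMk a b p q γ y)).comap (torusMk a b p q γ y) =
      torusIdeal (some a) (some b) p q γ (exceptionalVars W y) := by
  rw [Ideal.comap_map_of_surjective' _ (torusMk_surjective a b p q γ y), sup_comm,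
      ker_sup_coordIdeal]

end TorusChart

/-! ## Principalization of an ideal by two blow-ups -/

/-- If `K = (b)` near `p`, write `f = b y` and `g = b z`. From `f z = g y` and regularity of the
pair, `f` divides `y`, so cancelling `f` in `f = b y` makes `b` a unit, against `K ≤ p`. -/
lemma not_cartierAt_of_regular {A : CommRingCat.{u}} {K : Ideal A} {f g : A} (hf : f ∈ K)
    (hg : g ∈ K) (hf0 : f ∈ nonZeroDivisors A) (hfg : ∀ s, f ∣ g * s → f ∣ s) {p : Spec A}
    (hK : K ≤ p.asIdeal) : ¬ CartierAt (idl K) p := by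
  intro hc
  obtain ⟨r, hr, b, hb, hab⟩ := CartierAt.exists_specAway (j := 𝟙 _) hc (comap_id _)
  obtain ⟨q, rfl⟩ := (mem_range_specAway r p).mpr hr
  let ι := algebraMap A (Localization.Away r)
  have hmem : ∀ x ∈ K, ∃ y, ι x = b * y := fun x hx ↦
    Ideal.mem_span_singleton.mp (hab.le (Ideal.mem_map_of_mem _ hx))
  obtain ⟨y, hy⟩ := hmem f hf
  obtain ⟨z, hz⟩ := hmem g hg
  have hf1 : ι f ∈ nonZeroDivisors (Localization.Away r) :=
    map_mem_nonZeroDivisors_of_isOpenImmersion (CommRingCat.ofHom ι) hf0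
  have hrel : ι f * z = ι g * y := by rw [hy, hz]; ring
  obtain ⟨i, y₀, hy₀⟩ := IsLocalization.Away.surj r y
  obtain ⟨j, z₀, hz₀⟩ := IsLocalization.Away.surj r z
  have h1 : ι (f * z₀ * r ^ i) = ι (g * y₀ * r ^ j) := by
    simp only [map_mul, map_pow]
    have h2 : ι z₀ = z * ι r ^ j := hz₀.symm
    have h3 : ι y₀ = y * ι r ^ i := hy₀.symm
    rw [h2, h3]
    linear_combination ι r ^ i * ι r ^ j * hrel
  obtain ⟨⟨_, n, rfl⟩, hn⟩ := (IsLocalization.eq_iff_exists (Submonoid.powers r) _).mp h1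
  obtain ⟨w, hw⟩ := hfg (y₀ * r ^ j * r ^ n) ⟨z₀ * r ^ i * r ^ n, by
    linear_combination -hn⟩
  have hru : IsUnit (ι r) := IsLocalization.Away.algebraMap_isUnit r
  have hyw : ι f ∣ y := by
    rw [← (hru.pow (i + j + n)).dvd_mul_right]
    refine ⟨ι w, ?_⟩
    have h2 := congr(ι $hw)
    simp only [map_mul, map_pow] at h2
    have h3 : ι y₀ = y * ι r ^ i := hy₀.symm
    rw [h3] at h2
    rw [← h2]; ring
  obtain ⟨t, ht⟩ := hyw
  have hbu : b * t = 1 := by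
    have h2 : ι f * (b * t) = ι f * 1 := by
      linear_combination -b * ht - hy
    exact (mul_cancel_left_mem_nonZeroDivisors hf1).mp h2
  have hb1 : b ∈ q.asIdeal := by
    have : b ∈ K.map (algebraMap A (Localization.Away r)) := hab ▸ Ideal.mem_span_singleton_self b
    exact (Ideal.map_le_iff_le_comap.mpr hK) this
  exact q.2.ne_top (Ideal.eq_top_of_isUnit_mem _ hb1 (IsUnit.of_mul_eq_one _ hbu))

lemma CartierAt.of_span_mul {A : CommRingCat.{u}} {K : Ideal A} {μ : A}
    (hμ : μ ∈ nonZeroDivisors A) {p : Spec A} (h : CartierAt (idl (Ideal.span {μ} * K)) p) :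
    CartierAt (idl K) p := by
  obtain ⟨r, hr, b, hb, hab⟩ := CartierAt.exists_specAway (j := 𝟙 _) h (comap_id _)
  let ι := algebraMap A (Localization.Away r)
  have hμ1 : ι μ ∈ nonZeroDivisors (Localization.Away r) :=
    map_mem_nonZeroDivisors_of_isOpenImmersion (CommRingCat.ofHom ι) hμ
  rw [Ideal.map_mul, Ideal.map_span, Set.image_singleton] at hab
  obtain ⟨c, hc, hbc⟩ := Ideal.mem_span_singleton_mul.mp (hab.ge (Ideal.mem_span_singleton_self b))
  refine cartierAt_of_specAway (j := 𝟙 _) (K := K) (comap_id _) hr (b := c) ?_ ?_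
  · rw [← hbc] at hb
    exact (mul_mem_nonZeroDivisors.mp hb).2
  · refine le_antisymm (fun x hx ↦ ?_) ((Ideal.span_singleton_le_iff_mem _).mpr hc)
    obtain ⟨t, ht⟩ := Ideal.mem_span_singleton.mp
      (hab.le (Ideal.mul_mem_mul (Ideal.mem_span_singleton_self _) hx))
    rw [Ideal.mem_span_singleton]
    refine ⟨t, (mul_cancel_left_mem_nonZeroDivisors hμ1).mp ?_⟩
    rw [ht, ← hbc, mul_assoc]

lemma cartierAt_of_not_le {V : Scheme.{u}} {J : V.IdealSheafData} {A : CommRingCat.{u}}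
    {c : Spec A ⟶ V} [IsOpenImmersion c] {K : Ideal A} {μ : A} (hμ : μ ∈ nonZeroDivisors A)
    (hJ : J.comap c = idl (Ideal.span {μ} * K)) {p : Spec A} (hp : ¬ K ≤ p.asIdeal) :
    CartierAt J (c p) := by
  obtain ⟨r, hr, hrp⟩ := Set.not_subset.mp hp
  refine cartierAt_of_specAway hJ hrp (b := algebraMap A _ μ)
    (map_mem_nonZeroDivisors_of_isOpenImmersion
      (CommRingCat.ofHom (algebraMap A (Localization.Away r))) hμ) ?_
  have h1 : K.map (algebraMap A (Localization.Away r)) = ⊤ :=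
    Ideal.eq_top_of_isUnit_mem _ (Ideal.mem_map_of_mem _ hr)
      (IsLocalization.Away.algebraMap_isUnit r)
  rw [Ideal.map_mul, h1, Ideal.mul_top, Ideal.map_span, Set.image_singleton]

/-- The reduced closed subscheme where an ideal is not invertible. -/
def nonCartierIdeal {V : Scheme.{u}} (J : V.IdealSheafData) : V.IdealSheafData :=
  vanishingIdeal ⟨{x | CartierAt J x}ᶜ, (isOpen_cartierAt J).isClosed_compl⟩

lemma mem_support_nonCartierIdeal {V : Scheme.{u}} {J : V.IdealSheafData} {x : V} :
    x ∈ (nonCartierIdeal J).support ↔ ¬ CartierAt J x := by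
  change x ∈ (vanishingIdeal _).support ↔ _
  rfl

/-- Off the zero locus of `K` the ideal is generated by `μ`; on it, `K` contains a regular pair and
cannot be principal. So the non-invertible locus is the zero locus of `K`. -/
lemma comap_nonCartierIdeal {V : Scheme.{u}} {J : V.IdealSheafData} {A : CommRingCat.{u}}
    {c : Spec A ⟶ V} [IsOpenImmersion c] {K K' : Ideal A} {μ f g : A} (hμ : μ ∈ nonZeroDivisors A)
    (hJ : J.comap c = idl (Ideal.span {μ} * K)) (hf : f ∈ K) (hg : g ∈ K)
    (hf0 : f ∈ nonZeroDivisors A) (hfg : ∀ s, f ∣ g * s → f ∣ s) (hK' : K'.IsRadical)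
    (h : ∀ p : Ideal A, p.IsPrime → (K ≤ p ↔ K' ≤ p)) :
    (nonCartierIdeal J).comap c = idl K' := by
  rw [nonCartierIdeal, comap_vanishingIdeal]
  refine vanishingIdeal_eq_idl hK' fun x ↦ ?_
  rw [← h _ x.2]
  change ¬ CartierAt J (c x) ↔ _
  refine ⟨fun hx ↦ ?_, fun hx hx' ↦ ?_⟩
  · by_contra hn
    exact hx (cartierAt_of_not_le hμ hJ hn)
  · rw [← cartierAt_comap_iff, hJ] at hx'
    exact not_cartierAt_of_regular hf hg hf0 hfg hx (hx'.of_span_mul hμ)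

/-- Non-zero-divisors remain such on a blow-up. -/
lemma IsBlowup.map_mem_nonZeroDivisors {V W : Scheme.{u}} {I : V.IdealSheafData} {ρ : W ⟶ V}
    (hρ : IsBlowup I ρ) {R A : CommRingCat.{u}} {j : Spec R ⟶ V} [IsOpenImmersion j]
    {c : Spec A ⟶ W} [IsOpenImmersion c] {ψ : R ⟶ A} (h : c ≫ ρ = Spec.map ψ ≫ j) {μ : R}
    (hμ : μ ∈ nonZeroDivisors R) : ψ.hom μ ∈ nonZeroDivisors A := by
  have hp := (IsPullback.of_hasPullback ρ j)
  have hb := hρ.of_isPullback hp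
  let l : Spec A ⟶ pullback ρ j := pullback.lift c (Spec.map ψ) h
  have hl1 : l ≫ pullback.fst ρ j = c := pullback.lift_fst _ _ _
  have hl2 : l ≫ pullback.snd ρ j = Spec.map ψ := pullback.lift_snd _ _ _
  have : IsOpenImmersion (l ≫ pullback.fst ρ j) := by rw [hl1]; infer_instance
  have hl : IsOpenImmersion l := IsOpenImmersion.of_comp _ (pullback.fst ρ j)
  refine mem_nonZeroDivisors_of_cartierAt fun p ↦ ?_
  have h1 : (idl (Ideal.span {ψ.hom μ})) = ((idl (Ideal.span {μ})).comap (pullback.snd ρ j)).comap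
      l := by
    rw [← comap_comp, hl2, comap_idl, Ideal.map_span, Set.image_singleton]
  rw [h1, cartierAt_comap_iff]
  exact hb.cartierAt_comap (cartierAt_idl_span hμ _)

/-- Blowing up an ideal which agrees with `J` up to an invertible factor wherever `J` is not
invertible makes `J` invertible. -/
lemma IsBlowup.isCartier_comap {V W : Scheme.{u}} {I J : V.IdealSheafData} {ρ : W ⟶ V}
    (hρ : IsBlowup I ρ) (h : ∀ x, CartierAt J x ∨ ∃ (A : CommRingCat.{u}) (c : Spec A ⟶ V)
      (_ : IsOpenImmersion c) (μ : A) (K : Ideal A), x ∈ Set.range c ∧ μ ∈ nonZeroDivisors A ∧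
        J.comap c = idl (Ideal.span {μ} * K) ∧ I.comap c = idl K) : IsCartier (J.comap ρ) := by
  rw [isCartier_iff]
  intro w
  obtain hx | ⟨A, c, hc, μ, K, hx, hμ, hJ, hI⟩ := h (ρ w)
  · exact hρ.cartierAt_comap hx
  rw [← Ideal.span_eq K] at hI
  obtain ⟨s, hs, B, d, hd, ψ, ⟨p, rfl⟩, hψ, hs0, hsK⟩ := hρ.exists_generator hI hx
  refine ⟨B, d, hd, ψ.hom μ * ψ.hom s, ⟨p, rfl⟩,
    mul_mem (hρ.map_mem_nonZeroDivisors hψ hμ) hs0, ?_⟩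
  rw [← comap_comp, hψ, comap_comp, hJ, comap_idl, Ideal.map_mul, Ideal.map_span,
    Set.image_singleton, ← Ideal.span_singleton_mul_span_singleton, ← hsK, Ideal.span_eq]

/-! ### The residual ideal and its two blow-ups -/

section TwoBlowups

open MvPolynomial hiding comap_comp comap_id algebraMap_apply

variable {k : Type u} [Field k]

/-- The first variable of a row. -/
def headVar (r : Fin 2) : Coord := .inl (r, 0)

/-- The variables of a row other than the first one. -/
def tailVars (r : Fin 2) : Set Coord := {.inl (r, 1), .inl (r, 2)}

lemma mem_tailVars {r r' : Fin 2} {l : Fin 3} :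
    (Sum.inl (r', l) : Coord) ∈ tailVars r ↔ r' = r ∧ l ≠ 0 := by
  simp only [tailVars, Set.mem_insert_iff, Set.mem_singleton_iff, Sum.inl.injEq, Prod.mk.injEq,
    ← and_or_left]
  refine and_congr_right fun _ ↦ ?_
  revert l; decide

lemma head_notMem_tailVars (r ε : Fin 2) :
    headVar r ∉ tailVars ε.rev ∪ tailVars ε := by
  simp [headVar, mem_tailVars]

lemma headVar_ne : headVar 0 ≠ headVar 1 := by simp [headVar]

lemma disjoint_tailVars {ε : Fin 2} {y : Coord} (hy : y ∈ tailVars ε) : y ∉ tailVars ε.rev := by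
  rcases hy with rfl | rfl <;> rw [mem_tailVars] <;> revert ε <;> decide

lemma ncard_tailVars (ε : Fin 2) : (tailVars ε.rev ∪ tailVars ε).ncard = 4 := by
  have : tailVars ε.rev ∪ tailVars ε =
      (({.inl (ε.rev, 1), .inl (ε.rev, 2), .inl (ε, 1), .inl (ε, 2)} : Finset Coord) : Set
          Coord) := by
    ext i; simp [tailVars]; tauto
  rw [this, Set.ncard_coe_finset]
  clear this
  revert ε; decide

lemma ncard_exceptionalVars {ε : Fin 2} {y : Coord} (hy : y ∈ tailVars ε) :
    (exceptionalVars (tailVars ε.rev) y).ncard = 4 := by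
  have : exceptionalVars (tailVars ε.rev) y =
      (({none, some y, some (.inl (ε.rev, 1)), some (.inl (ε.rev, 2))} : Finset (Option Coord)) :
        Set (Option Coord)) := by
    simp [exceptionalVars, tailVars, Set.image_insert_eq]
  rw [this, Set.ncard_coe_finset]
  clear this
  rcases hy with rfl | rfl <;> revert ε <;> decide

/-- The equations of the indeterminacies in a chart. -/
abbrev residualIdeal (p q : ℕ) (γ : k) (ε : Fin 2) : Ideal (MvPolynomial Coord k) :=
  thickIdeal (headVar 0) (headVar 1) p q γ (tailVars ε.rev) (tailVars ε)

/-- Near `x`, the ideal `J` is the product of an invertible ideal and of the ideal obtained from the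
one of a translated subtorus by squaring some of the generators. -/
def IsResidualAt {V : Scheme.{u}} (J : V.IdealSheafData) (f : V ⟶ Spec (.of k)) (x : V) : Prop :=
  ∃ (c : Spec (ChartRing k) ⟶ V) (_ : IsOpenImmersion c), x ∈ Set.range c ∧
    c ≫ f = Spec.map (CommRingCat.ofHom (C : k →+* MvPolynomial Coord k)) ∧
    ∃ (ε : Fin 2) (p q : ℕ) (γ : k) (μ : ChartRing k), (p ≠ 0 ∨ q ≠ 0) ∧ γ ≠ 0 ∧ μ ≠ 0 ∧
      J.comap c = idl (Ideal.span {μ} * residualIdeal p q γ ε)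

/-- The coordinate ring of a chart of the first blow-up. -/
abbrev ExceptionalRing (p q : ℕ) (γ : k) (y : Coord) : CommRingCat.{u} :=
  TorusChartRing (headVar 0) (headVar 1) p q γ y

/-- The ideal of the indeterminacies in a chart of the first blow-up. -/
abbrev exceptionalIdeal (p q : ℕ) (γ : k) (ε : Fin 2) (y : Coord) :
    Ideal (ExceptionalRing p q γ y) :=
  (coordIdeal k (exceptionalVars (tailVars ε.rev) y)).map
    (torusMk (headVar 0) (headVar 1) p q γ y)

/-- Near `x`, the ideal `J` is the product of an invertible ideal and of the ideal of a smooth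
subvariety of the exceptional divisor of the first blow-up. -/
def IsExceptionalAt {V : Scheme.{u}} (J : V.IdealSheafData) (f : V ⟶ Spec (.of k)) (x : V) : Prop :=
  ∃ (ε : Fin 2) (p q : ℕ) (γ : k) (y : Coord)
    (μ : ExceptionalRing p q γ y)
    (c : Spec (ExceptionalRing p q γ y) ⟶ V)
    (_ : IsOpenImmersion c), x ∈ Set.range c ∧
    c ≫ f = Spec.map (CommRingCat.ofHom (S := ExceptionalRing p q γ y)
      ((torusMk (headVar 0) (headVar 1) p q γ y).comp C)) ∧
    (p ≠ 0 ∨ q ≠ 0) ∧ γ ≠ 0 ∧ μ ∈ nonZeroDivisors _ ∧ y ∈ tailVars ε ∧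
      J.comap c = idl
        (Ideal.span {μ} * exceptionalIdeal p q γ ε y)

lemma X_mem_residualIdeal {p q : ℕ} {γ : k} {ε : Fin 2} {i : Coord} (hi : i ∈ tailVars ε.rev) :
    X i ∈ residualIdeal p q γ ε :=
  Ideal.mem_sup_left (X_mem_torusIdeal _ _ p q γ hi)

lemma X_dvd_of_X_dvd_mul {σ : Type} {i j : σ} (h : i ≠ j) {s : MvPolynomial σ k}
    (hs : X i ∣ X j * s) : X i ∣ s := by
  refine ((X_prime (i := i)).dvd_or_dvd hs).resolve_left fun h' ↦ ?_
  rw [X_dvd_iff_killVars, killVars_of_notMem (by simpa using h.symm)] at h'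
  exact X_ne_zero _ h'

variable [CharZero k]

/-- The regular pair is formed by the two tail variables of the row `ε.rev`, which belong to the
residual ideal without being squared. -/
lemma comap_nonCartierIdeal_of_residual {V : Scheme.{u}} {J : V.IdealSheafData}
    {c : Spec (ChartRing k) ⟶ V} [IsOpenImmersion c] {ε : Fin 2} {p q : ℕ} {γ : k}
    {μ : ChartRing k} (hpq : p ≠ 0 ∨ q ≠ 0) (hγ : γ ≠ 0) (hμ : μ ≠ 0)
    (hJ : J.comap c = idl (Ideal.span {μ} * residualIdeal p q γ ε)) :
    (nonCartierIdeal J).comap c =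
      idl (torusIdeal (headVar 0) (headVar 1) p q γ (tailVars ε.rev ∪ tailVars ε)) := by
  refine comap_nonCartierIdeal (A := ChartRing k) (K := residualIdeal p q γ ε)
    (f := X (.inl (ε.rev, 1))) (g := X (.inl (ε.rev, 2)))
    (mem_nonZeroDivisors_of_ne_zero hμ) hJ (X_mem_residualIdeal (by simp [mem_tailVars]))
    (X_mem_residualIdeal (by simp [mem_tailVars])) (X_mem_nonZeroDivisors _)
    (fun s hs ↦ X_dvd_of_X_dvd_mul (by simp) hs) ?_ fun P hP ↦ thickIdeal_le_iff_of_isPrime _ _ _ _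
        _ _ _ hP
  exact torusIdeal_isRadical headVar_ne (head_notMem_tailVars _ _) (head_notMem_tailVars _ _) hpq hγ

/-- The regular pair is the exceptional variable and a tail variable of the row `ε.rev`. Radicality
is inherited from the translated subtorus which is the preimage in the polynomial ring. -/
lemma comap_nonCartierIdeal_of_exceptional {V : Scheme.{u}} {J : V.IdealSheafData}
    {ε : Fin 2} {p q : ℕ} {γ : k} {y : Coord} (hy : y ∈ tailVars ε)
    {c : Spec (ExceptionalRing p q γ y) ⟶ V} [IsOpenImmersion c]
    {μ : ExceptionalRing p q γ y} (hpq : p ≠ 0 ∨ q ≠ 0)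
    (hγ : γ ≠ 0) (hμ : μ ∈ nonZeroDivisors _)
    (hJ : J.comap c = idl
        (Ideal.span {μ} * exceptionalIdeal p q γ ε y)) :
    (nonCartierIdeal J).comap c = idl
      (exceptionalIdeal p q γ ε y) := by
  have ha : ∀ r, headVar r ≠ y := by
    rintro r rfl
    exact absurd (mem_tailVars.mp hy).2 (by simp)
  have hne : Sum.inl (ε.rev, 1) ≠ y := by
    rintro rfl
    exact absurd (mem_tailVars.mp hy).1 (ToricChart.rev_ne ε)
  have ha' : ∀ r, (some (headVar r) : Option Coord) ∉ exceptionalVars (tailVars ε.rev) y := by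
    rintro r (h | ⟨_, h, h'⟩)
    · cases h
    · cases h'
      rcases h with rfl | h
      · exact ha r rfl
      · exact absurd (mem_tailVars.mp h).2 (by simp)
  refine comap_nonCartierIdeal (A := ExceptionalRing p q γ y)
    (K := exceptionalIdeal p q γ ε y) (f := torusMk _ _ p q γ y (X (some y)))
    (g := torusMk _ _ p q γ y (X (some (.inl (ε.rev, 1))))) hμ hJ ?_ ?_ ?_ ?_ ?_ fun P hP ↦ Iff.rfl
  · exact Ideal.mem_map_of_mem _ (Ideal.subset_span ⟨_, Or.inr ⟨y, Or.inl rfl, rfl⟩, rfl⟩)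
  · exact Ideal.mem_map_of_mem _ (Ideal.subset_span
      ⟨_, Or.inr ⟨_, Or.inr (mem_tailVars.mpr ⟨rfl, by simp⟩), rfl⟩, rfl⟩)
  · exact torusMk_X_mem_nonZeroDivisors (ha 0) (ha 1) hpq hγ
  · intro s hs
    obtain ⟨s, rfl⟩ := torusMk_surjective _ _ p q γ y s
    have hk : killVars k {some y} (X (some (.inl (ε.rev, 1)))) = X (some (.inl (ε.rev, 1))) :=
      killVars_of_notMem (by simpa using hne)
    refine torusMk_X_dvd (ha 0) (ha 1) (g := X (some (.inl (ε.rev, 1)))) (fun f hf ↦ ?_)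
      (by rw [hk]; exact X_ne_zero _) (by rwa [map_mul])
    rw [hk] at hf ⊢
    exact (X_prime.dvd_or_dvd hf).resolve_left
      (not_X_dvd_torusEq (by simp [headVar]) (by simp [headVar]) hpq hγ)
  · have h1 := torusIdeal_isRadical (p := p) (q := q) (a := some (headVar 0))
      (b := some (headVar 1)) (by simp [headVar]) (ha' 0) (ha' 1) hpq hγ
    rw [← comap_map_coordIdeal] at h1
    rintro f ⟨n, hf⟩
    obtain ⟨f, rfl⟩ := torusMk_surjective _ _ p q γ y f
    rw [← map_pow] at hf
    exact h1 ⟨n, hf⟩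

/-- Near `w` some generator of the center generates its inverse image. If it lies in the residual
ideal, that ideal and the ideal of the center have the same image, which is principal. The only
other generators are the tail variables of the row `ε`, and they give the charts of `torusChart`. -/
lemma IsBlowup.isExceptionalAt {V W : Scheme.{u}} {J : V.IdealSheafData} {f : V ⟶ Spec (.of k)}
    {ρ : W ⟶ V} (hρ : IsBlowup (nonCartierIdeal J) ρ) {w : W} (h : IsResidualAt J f (ρ w)) :
    CartierAt (J.comap ρ) w ∨ IsExceptionalAt (J.comap ρ) (ρ ≫ f) w := by
  obtain ⟨c, hc, hw, hcf, ε, p, q, γ, μ, hpq, hγ, hμ, hJ⟩ := h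
  have hI := comap_nonCartierIdeal_of_residual hpq hγ hμ hJ
  have hμ' : μ ∈ nonZeroDivisors (ChartRing k) := mem_nonZeroDivisors_of_ne_zero hμ
  obtain ⟨_, ⟨s, rfl⟩, A, c', hc', ψ, ⟨t, rfl⟩, hψ, hs0, hs⟩ :=
    hρ.exists_generator (R := ChartRing k) hI hw
  obtain ⟨g, hg⟩ : ∃ g : MvPolynomial Coord k, g =
      s.elim (torusEq (headVar 0) (headVar 1) p q γ) fun t ↦ X t.1 := ⟨_, rfl⟩
  beta_reduce at hs0 hs
  rw [← hg] at hs0 hs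
  by_cases hgK : g ∈ residualIdeal p q γ ε
  · left
    refine ⟨A, c', hc', ψ.hom μ * ψ.hom g, ⟨t, rfl⟩,
      mul_mem (hρ.map_mem_nonZeroDivisors hψ hμ') hs0, ?_⟩
    have h1 : (residualIdeal p q γ ε).map ψ.hom = Ideal.span {ψ.hom g} :=
      le_antisymm ((Ideal.map_mono (thickIdeal_le _ _ p q γ _ _)).trans hs.le)
        ((Ideal.span_singleton_le_iff_mem _).mpr (Ideal.mem_map_of_mem _ hgK))
    rw [← comap_comp, hψ, comap_comp, hJ, comap_idl, Ideal.map_mul, Ideal.map_span,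
      Set.image_singleton, ← Ideal.span_singleton_mul_span_singleton]
    exact congrArg (fun K ↦ idl (_ * K)) h1
  right
  obtain ⟨y, hy, hgy⟩ : ∃ y ∈ tailVars ε, g = X y := by
    rcases s with _ | ⟨t, ht | ht⟩
    · exact absurd (hg ▸ Ideal.mem_sup_left (torusEq_mem_torusIdeal _ _ p q γ _)) hgK
    · exact absurd (hg ▸ X_mem_residualIdeal ht) hgK
    · exact ⟨t, ht, hg⟩
  rw [hgy] at hs0 hs
  have hch := isBlowupChart_torusChart (p := p) (q := q) (head_notMem_tailVars 0 ε)
    (head_notMem_tailVars 1 ε) (Or.inr hy) hpq hγ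
  obtain ⟨j', hj', h1, h2⟩ := hρ.exists_chart hI hch
    (X_mem_torusIdeal _ _ p q γ (Or.inr hy))
  have h3 := h2 c' ψ hψ hs0 hs ⟨t, rfl⟩
  refine ⟨ε, p, q, γ, y, torusChart (headVar 0) (headVar 1) p q γ
    (tailVars ε.rev ∪ tailVars ε) y (μ * X y), j', hj', h3, ?_, hpq, hγ, ?_, hy, ?_⟩
  · rw [← Category.assoc, h1, Category.assoc, hcf, ← Spec.map_comp]
    congr 1
    ext : 1
    refine RingHom.ext fun x ↦ ?_
    exact torusChart_C _ _ p q γ _ y x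
  · rw [map_mul]
    exact mul_mem (hρ.map_mem_nonZeroDivisors h1 hμ') hch.mem_nonZeroDivisors
  · rw [← comap_comp, h1, comap_comp, hJ, comap_idl, map_mul]
    congr 1
    rw [Ideal.map_mul, Ideal.map_span, Set.image_singleton,
      ← Ideal.span_singleton_mul_span_singleton, mul_assoc]
    congr 1
    exact map_thickIdeal (head_notMem_tailVars 0 ε) (head_notMem_tailVars 1 ε) hy
      (disjoint_tailVars hy) p q γ

/-- An ideal which is locally invertible, up to the ideal obtained from the one of a translated
subtorus by squaring some of the generators, becomes invertible after two blow-ups. -/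
theorem isCartier_after_two_blowups {V : Scheme.{u}} {J : V.IdealSheafData}
    {f : V ⟶ Spec (.of k)} (h : ∀ x, CartierAt J x ∨ IsResidualAt J f x) :
    SmoothOfRelativeDimension 3 ((nonCartierIdeal J).subschemeι ≫ f) ∧
    ∀ {V₁ : Scheme.{u}} (ρ₁ : V₁ ⟶ V), IsBlowup (nonCartierIdeal J) ρ₁ →
      SmoothOfRelativeDimension 4 ((nonCartierIdeal (J.comap ρ₁)).subschemeι ≫ ρ₁ ≫ f) ∧
      ∀ {V₂ : Scheme.{u}} (ρ₂ : V₂ ⟶ V₁), IsBlowup (nonCartierIdeal (J.comap ρ₁)) ρ₂ →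
        IsCartier ((J.comap ρ₁).comap ρ₂) := by
  refine ⟨smooth_subscheme_of_charts f fun x hx ↦ ?_, fun {V₁} ρ₁ hρ₁ ↦ ?_⟩
  · rw [mem_support_nonCartierIdeal] at hx
    obtain ⟨c, hc, hxc, hcf, ε, p, q, γ, μ, hpq, hγ, hμ, hJ⟩ := (h x).resolve_left hx
    let K : Ideal (MvPolynomial Coord k) :=
      torusIdeal (headVar 0) (headVar 1) p q γ (tailVars ε.rev ∪ tailVars ε)
    refine ⟨ChartRing k, .of (MvPolynomial Coord k ⧸ K), c, hc,
      CommRingCat.ofHom (Ideal.Quotient.mk K), Ideal.Quotient.mk_surjective, hxc, ?_, ?_⟩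
    · rw [comap_nonCartierIdeal_of_residual hpq hγ hμ hJ]
      exact congrArg idl Ideal.mk_ker.symm
    · rw [hcf, ← Spec.map_comp]
      exact smoothOfRelativeDimension_quotient_torusIdeal
        headVar_ne (head_notMem_tailVars 0 ε) (head_notMem_tailVars 1 ε) hpq hγ
        -- Eight coordinates, four variables set to zero and one torus equation: dimension 3.
        (by rw [ncard_tailVars, Nat.card_eq_fintype_card]; decide)
        (T := tailVars ε.rev ∪ tailVars ε)
        (S := .of (MvPolynomial Coord k ⧸ K)) (ψ := Ideal.Quotient.mk K)
            Ideal.Quotient.mk_surjective Ideal.mk_ker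
  have h₁ : ∀ w, CartierAt (J.comap ρ₁) w ∨ IsExceptionalAt (J.comap ρ₁) (ρ₁ ≫ f) w := by
    intro w
    rcases h (ρ₁ w) with hw | hw
    · exact Or.inl (hρ₁.cartierAt_comap hw)
    · exact hρ₁.isExceptionalAt hw
  refine ⟨smooth_subscheme_of_charts (ρ₁ ≫ f) fun x hx ↦ ?_, fun {V₂} ρ₂ hρ₂ ↦ ?_⟩
  · rw [mem_support_nonCartierIdeal] at hx
    obtain ⟨ε, p, q, γ, y, μ, c, hc, hxc, hcf, hpq, hγ, hμ, hy, hJ⟩ := (h₁ x).resolve_left hx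
    let K : Ideal (MvPolynomial (Option Coord) k) := torusIdeal (some (headVar 0))
      (some (headVar 1)) p q γ (exceptionalVars (tailVars ε.rev) y)
    let ψ : ExceptionalRing p q γ y →+* ExceptionalRing p q γ y ⧸ exceptionalIdeal p q γ ε y :=
        Ideal.Quotient.mk _
    have ha' : ∀ r, (some (headVar r) : Option Coord) ∉ exceptionalVars (tailVars ε.rev) y := by
      rintro r (h | ⟨_, h, h'⟩)
      · cases h
      · cases h'
        rcases h with rfl | h
        · exact absurd (mem_tailVars.mp hy).2 (by simp)
        · exact absurd (mem_tailVars.mp h).2 (by simp)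
    refine ⟨ExceptionalRing p q γ y, .of (ExceptionalRing p q γ y ⧸ exceptionalIdeal p q γ ε y), c,
        hc,
      CommRingCat.ofHom (R := ExceptionalRing p q γ y) ψ, Ideal.Quotient.mk_surjective, hxc, ?_, ?_⟩
    · rw [comap_nonCartierIdeal_of_exceptional hy hpq hγ hμ hJ]
      exact congrArg idl Ideal.mk_ker.symm
    · rw [hcf, ← Spec.map_comp]
      have hsurj : Function.Surjective (ψ.comp (torusMk (headVar 0) (headVar 1) p q γ y)) :=
        Ideal.Quotient.mk_surjective.comp (torusMk_surjective _ _ p q γ y)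
      refine smoothOfRelativeDimension_quotient_torusIdeal (n := 4)
        (S := .of (ExceptionalRing p q γ y ⧸ exceptionalIdeal p q γ ε y))
        (T := exceptionalVars (tailVars ε.rev) y) (a := some (headVar 0))
        (b := some (headVar 1)) (by simp [headVar]) (ha' 0) (ha' 1) hpq hγ
        -- Nine variables, four set to zero and one torus equation, the relation of the chart being
        -- a consequence: dimension 4.
        (by rw [ncard_exceptionalVars hy, Nat.card_eq_fintype_card]; decide)
        (ψ := ψ.comp (torusMk (headVar 0) (headVar 1) p q γ y))
        hsurj ?_
      rw [← RingHom.comap_ker]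
      exact (congrArg (fun L : Ideal (ExceptionalRing p q γ y) ↦ L.comap
          (torusMk (headVar 0) (headVar 1) p q γ y))
        Ideal.mk_ker).trans (comap_map_coordIdeal p q γ (tailVars ε.rev))
  · refine hρ₂.isCartier_comap fun x ↦ (h₁ x).imp_right ?_
    rintro ⟨ε, p, q, γ, y, μ, c, hc, hxc, hcf, hpq, hγ, hμ, hy, hJ⟩
    exact ⟨_, c, hc, μ, exceptionalIdeal p q γ ε y, hxc, hμ, hJ,
      comap_nonCartierIdeal_of_exceptional hy hpq hγ hμ hJ⟩

end TwoBlowups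

/-! ## The ideal generated by the coefficients of a ternary form -/

section Content

open MvPolynomial hiding comap_comp comap_id algebraMap_apply

/-- The ideal generated by the coefficients of a polynomial. -/
def coeffIdeal {R τ : Type*} [CommRing R] (G : MvPolynomial τ R) : Ideal R :=
  Ideal.span (Set.range fun a ↦ G.coeff a)

/-- An ideal is determined by the ideals containing it, so a coefficient ideal can be found by
deciding over which quotient rings the polynomial vanishes. -/
lemma coeffIdeal_le_iff {R τ : Type*} [CommRing R] {G : MvPolynomial τ R} {I : Ideal R} :
    coeffIdeal G ≤ I ↔ map (Ideal.Quotient.mk I) G = 0 := by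
  rw [coeffIdeal, Ideal.span_le, Set.range_subset_iff, MvPolynomial.ext_iff]
  refine forall_congr' fun a ↦ ?_
  rw [coeff_map, coeff_zero, Ideal.Quotient.eq_zero_iff_mem]
  rfl

lemma coeffIdeal_C_mul {R τ : Type*} [CommRing R] (μ : R) (G : MvPolynomial τ R) :
    coeffIdeal (C μ * G) = Ideal.span {μ} * coeffIdeal G := by
  rw [coeffIdeal, coeffIdeal, Ideal.span_mul_span']
  congr 1
  ext x
  simp

lemma map_coeffIdeal {R S τ : Type*} [CommRing R] [CommRing S] (φ : R →+* S)
    (G : MvPolynomial τ R) : (coeffIdeal G).map φ = coeffIdeal (map φ G) := by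
  rw [coeffIdeal, coeffIdeal, Ideal.map_span, ← Set.range_comp]
  congr 2

lemma coeffIdeal_algHom_le {R τ τ' : Type*} [CommRing R]
    (θ : MvPolynomial τ R →ₐ[R] MvPolynomial τ' R) (G : MvPolynomial τ R) :
    coeffIdeal (θ G) ≤ coeffIdeal G := by
  have h : G ∈ (coeffIdeal G).map C := mem_map_C_iff.mpr fun a ↦ Ideal.subset_span ⟨a, rfl⟩
  have h1 : (coeffIdeal G).map (C : R →+* MvPolynomial τ R) ≤
      ((coeffIdeal G).map C).comap (θ : MvPolynomial τ R →+* MvPolynomial τ' R) := by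
    rw [Ideal.map_le_iff_le_comap]
    intro x hx
    have h2 : θ (C x) = C x := θ.commutes x
    change θ (C x) ∈ (coeffIdeal G).map (C : R →+* MvPolynomial τ' R)
    rw [h2]
    exact Ideal.mem_map_of_mem _ hx
  rw [coeffIdeal, Ideal.span_le]
  rintro _ ⟨a, rfl⟩
  exact mem_map_C_iff.mp (h1 h) a

lemma coeffIdeal_algHom_eq {R τ τ' : Type*} [CommRing R]
    (θ : MvPolynomial τ R →ₐ[R] MvPolynomial τ' R) (θ' : MvPolynomial τ' R →ₐ[R] MvPolynomial τ R)
    (h : θ'.comp θ = AlgHom.id R _) (G : MvPolynomial τ R) : coeffIdeal (θ G) = coeffIdeal G := by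
  refine le_antisymm (coeffIdeal_algHom_le θ G) ?_
  have := coeffIdeal_algHom_le θ' (θ G)
  rwa [← AlgHom.comp_apply, h] at this

/-- The linear form with given coefficients. -/
def linForm {S : Type*} [CommRing S] (f : Fin 3 → S) : MvPolynomial (Fin 3) S :=
  ∑ j, C (f j) * X j

lemma map_linForm {R S : Type*} [CommRing R] [CommRing S] (φ : R →+* S) (f : Fin 3 → R) :
    map φ (linForm f) = linForm fun j ↦ φ (f j) := by
  simp [linForm]

lemma linForm_smul {S : Type*} [CommRing S] (c : S) (f : Fin 3 → S) :
    linForm (fun j ↦ c * f j) = C c * linForm f := by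
  simp only [linForm, Finset.mul_sum, C_mul, mul_assoc]

lemma eval_linForm {S : Type*} [CommRing S] (f x : Fin 3 → S) :
    eval x (linForm f) = ∑ j, f j * x j := by
  simp [linForm]

lemma eval_single_linForm {S : Type*} [CommRing S] (f : Fin 3 → S) (i : Fin 3) :
    eval (Pi.single i 1) (linForm f) = f i := by
  rw [eval_linForm]
  simp [Pi.single_apply]

lemma linForm_isHomogeneous {S : Type*} [CommRing S] (f : Fin 3 → S) :
    (linForm f).IsHomogeneous 1 :=
  IsHomogeneous.sum _ _ _ fun j _ ↦ by
    simpa using (isHomogeneous_C (Fin 3) (f j)).mul (isHomogeneous_X S j)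

lemma pderiv_linForm {S : Type*} [CommRing S] (f : Fin 3 → S) (i : Fin 3) :
    pderiv i (linForm f) = C (f i) := by
  classical
  simp [linForm, Derivation.leibniz, pderiv_X, Pi.single_apply]

lemma add_pow_of_sq_eq_zero {S : Type*} [CommRing S] {x y : S} (hy : y * y = 0) (n : ℕ) :
    (x + y) ^ (n + 1) = x ^ (n + 1) + (n + 1) * x ^ n * y := by
  induction n with
  | zero => simp
  | succ n ih =>
    rw [pow_succ, ih]
    push_cast
    linear_combination ((n : S) + 1) * x ^ n * hy

/-! ### When a power of a linear form equals a product of powers of two linear forms -/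

section CharZero

variable {S : Type*} [CommRing S] (hchar : ∀ N : ℕ, N ≠ 0 → IsUnit (N : S)) {n M : ℕ}
  (hM : 0 < M) (hMn : M < n) {c ρ : S} {f g : Fin 3 → S}

/-- Values at `(1, 0, 0)` of both sides and of their first and second derivatives in directions
other than `X 0`. -/
lemma eval_of_linForm_pow_eq (h : C c * linForm f ^ n = C ρ * linForm g ^ M * X 0 ^ (n - M)) :
    c * f 0 ^ n = ρ * g 0 ^ M ∧
    (∀ i ≠ 0, n * c * f 0 ^ (n - 1) * f i = M * ρ * g 0 ^ (M - 1) * g i) ∧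
    ∀ i ≠ 0, ∀ j ≠ 0, n * (n - 1 : ℕ) * c * f 0 ^ (n - 2) * f i * f j =
      M * (M - 1 : ℕ) * ρ * g 0 ^ (M - 2) * g i * g j := by
  have hX : eval (Pi.single 0 1 : Fin 3 → S) (X 0) = 1 := by simp
  have h1 : ∀ i ≠ 0, (n : MvPolynomial (Fin 3) S) * C c * linForm f ^ (n - 1) * C (f i) =
      (M : MvPolynomial (Fin 3) S) * C ρ * linForm g ^ (M - 1) * C (g i) * X 0 ^ (n - M) := by
    intro i hi
    have h2 := congr(pderiv i $h)
    have h3 : pderiv i (X 0 ^ (n - M) : MvPolynomial (Fin 3) S) = 0 := by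
      rw [pderiv_pow, pderiv_X_of_ne hi.symm, mul_zero]
    simp only [Derivation.leibniz, pderiv_pow, pderiv_linForm, pderiv_C, h3, smul_eq_mul] at h2
    linear_combination h2
  refine ⟨?_, fun i hi ↦ ?_, fun i hi j hj ↦ ?_⟩
  · have := congr(eval (Pi.single 0 1) $h)
    simpa only [map_mul, map_pow, eval_C, eval_single_linForm, hX, one_pow, mul_one] using this
  · have := congr(eval (Pi.single 0 1) $(h1 i hi))
    simpa only [map_mul, map_pow, eval_C, eval_single_linForm, hX, one_pow, mul_one,
      map_natCast] using this
  · have h2 := congr(pderiv j $(h1 i hi))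
    have h3 : pderiv j (X 0 ^ (n - M) : MvPolynomial (Fin 3) S) = 0 := by
      rw [pderiv_pow, pderiv_X_of_ne hj.symm, mul_zero]
    have h4 : ∀ N : ℕ, pderiv j (N : MvPolynomial (Fin 3) S) = 0 := fun N ↦ by
      rw [← map_natCast (C : S →+* MvPolynomial (Fin 3) S), pderiv_C]
    simp only [Derivation.leibniz, pderiv_pow, pderiv_linForm, pderiv_C, h3, h4, smul_eq_mul] at h2
    have h5 := congr(eval (Pi.single 0 1) $h2)
    simp only [map_mul, map_pow, eval_C, eval_single_linForm, hX, one_pow, map_natCast,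
      mul_zero, add_zero, zero_add, Nat.sub_sub] at h5
    linear_combination h5

include hchar hM hMn in
/-- A power of a linear form is a multiple of a product of powers of two linear forms only if, up to
nilpotents of order two, all of them are multiples of each other. -/
lemma linForm_pow_eq_iff (hu : IsUnit (c * f 0 ^ n) ∨ IsUnit (ρ * g 0 ^ M)) :
    C c * linForm f ^ n = C ρ * linForm g ^ M * X 0 ^ (n - M) ↔
      c * f 0 ^ n = ρ * g 0 ^ M ∧ (∀ i ≠ 0, n * g 0 * f i = M * f 0 * g i) ∧
      (∀ i ≠ 0, ∀ j ≠ 0, f i * f j = 0) ∧ ∀ i ≠ 0, ∀ j ≠ 0, g i * g j = 0 := by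
  obtain ⟨n, rfl⟩ : ∃ n', n = n' + 1 := ⟨n - 1, by omega⟩
  obtain ⟨M, rfl⟩ : ∃ M', M = M' + 1 := ⟨M - 1, by omega⟩
  have key : c * f 0 ^ (n + 1) = ρ * g 0 ^ (M + 1) → IsUnit (c * f 0 ^ (n + 1)) ∧ IsUnit (f 0) ∧
      IsUnit (g 0) := by
    intro h
    have h1 : IsUnit (c * f 0 ^ (n + 1)) := hu.elim id fun h' ↦ h ▸ h'
    have h2 := h1
    rw [h] at h2
    exact ⟨h1, (isUnit_pow_iff n.succ_ne_zero).mp (isUnit_of_mul_isUnit_right h1),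
      (isUnit_pow_iff M.succ_ne_zero).mp (isUnit_of_mul_isUnit_right h2)⟩
  have hnu := hchar (n + 1) n.succ_ne_zero
  have hMu := hchar (M + 1) M.succ_ne_zero
  constructor
  · intro h
    obtain ⟨h0, h1, h2⟩ := eval_of_linForm_pow_eq h
    obtain ⟨hw, hf, hg⟩ := key h0
    simp only [Nat.add_sub_cancel] at h1 h2
    -- The first-order relation times `f 0 * g 0`, divided by the unit `c * f 0 ^ (n + 1) = ρ * g 0
    -- ^ (M + 1)`.
    have hlin : ∀ i ≠ 0, ((n + 1 : ℕ) : S) * g 0 * f i = (M + 1 : ℕ) * f 0 * g i := by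
      intro i hi
      rw [← hw.mul_right_inj]
      linear_combination f 0 * g 0 * h1 i hi +
        (M + 1 : ℕ) * f 0 * g i * (-h0)
    have hsq : ∀ i ≠ 0, ∀ j ≠ 0, ((n + 1 : ℕ) : S) * n * g 0 ^ 2 * (f i * f j) =
        (M + 1 : ℕ) * M * f 0 ^ 2 * (g i * g j) := by
      intro i hi j hj
      rw [← hw.mul_right_inj]
      have h3 := h2 i hi j hj
      obtain ⟨n, rfl⟩ : ∃ n', n = n' + 1 := ⟨n - 1, by omega⟩
      have h4 : ((M + 1 : ℕ) : S) * M * ρ * g 0 ^ (M + 1 - 2) * g i * g j * g 0 ^ 2 =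
          (M + 1 : ℕ) * M * ρ * g 0 ^ (M + 1) * g i * g j := by
        rcases M with _ | M
        · simp
        · rw [show M + 1 + 1 - 2 = M by omega]; ring
      rw [show n + 1 + 1 - 2 = n by omega] at h3
      linear_combination f 0 ^ 2 * g 0 ^ 2 * h3 + f 0 ^ 2 * h4 -
        (M + 1 : ℕ) * M * f 0 ^ 2 * (g i * g j) * h0
    -- Eliminating the `g i` between the first- and second-order relations leaves `f i * f j` times
    -- the product of the two exponents involving `n` and `n - M`; these are units because `M < n`
    -- and nonzero integers are invertible.
    have hff : ∀ i ≠ 0, ∀ j ≠ 0, f i * f j = 0 := by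
      intro i hi j hj
      have hd := hchar (n - M) (by omega)
      have h3 : (((n + 1 : ℕ) : S) * (n - M : ℕ) * g 0 ^ 2) * (f i * f j) = 0 := by
        rw [Nat.cast_sub (by omega)]
        push_cast
        have h4 := hlin i hi
        have h5 := hlin j hj
        have h6 := hsq i hi j hj
        push_cast at h4 h5 h6
        linear_combination ((M : S) + 1) * h6 - M * ((n + 1) * g 0 * f i * h5) -
          M * ((M + 1) * f 0 * g j) * h4
      exact (((hnu.mul hd).mul (hg.pow 2)).mul_right_eq_zero).mp h3
    refine ⟨h0, hlin, hff, fun i hi j hj ↦ ?_⟩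
    have h3 : (((M + 1 : ℕ) : S) ^ 2 * f 0 ^ 2) * (g i * g j) = 0 := by
      have h4 := hlin i hi
      have h5 := hlin j hj
      linear_combination (n + 1 : ℕ) ^ 2 * g 0 ^ 2 * hff i hi j hj - (n + 1 : ℕ) * g 0 * f i * h5 -
        (M + 1 : ℕ) * f 0 * g j * h4
    exact (((hMu.pow 2).mul (hf.pow 2)).mul_right_eq_zero).mp h3
  · rintro ⟨h0, hlin, hff, hgg⟩
    obtain ⟨hw, hf, hg⟩ := key h0
    -- Conversely, the parts of the forms not involving `X 0` have square zero, so the powers stop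
    -- at the linear term and only the zeroth and first-order relations are needed.
    have hsplit : ∀ f : Fin 3 → S, linForm f = C (f 0) * X 0 + (C (f 1) * X 1 + C (f 2) * X 2) :=
      fun f ↦ by rw [linForm, Fin.sum_univ_three, add_assoc]
    have hz : ∀ f : Fin 3 → S, (∀ i ≠ 0, ∀ j ≠ 0, f i * f j = 0) →
        (C (f 1) * X 1 + C (f 2) * X 2) * (C (f 1) * X 1 + C (f 2) * X 2) =
          (0 : MvPolynomial (Fin 3) S) := by
      intro f hf
      have h11 := congr((C $(hf 1 (by decide) 1 (by decide)) : MvPolynomial (Fin 3) S))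
      have h12 := congr((C $(hf 1 (by decide) 2 (by decide)) : MvPolynomial (Fin 3) S))
      have h22 := congr((C $(hf 2 (by decide) 2 (by decide)) : MvPolynomial (Fin 3) S))
      simp only [C_mul, C_0] at h11 h12 h22
      linear_combination X 1 ^ 2 * h11 + 2 * X 1 * X 2 * h12 + X 2 ^ 2 * h22
    rw [hsplit f, hsplit g, add_pow_of_sq_eq_zero (hz f hff), add_pow_of_sq_eq_zero (hz g hgg)]
    have hl : ∀ i ≠ 0, ((n + 1 : ℕ) : S) * c * f 0 ^ n * f i = (M + 1 : ℕ) * ρ * g 0 ^ M * g i := by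
      intro i hi
      rw [← (hf.mul hg).mul_right_inj]
      linear_combination c * f 0 ^ (n + 1) * hlin i hi + (M + 1 : ℕ) * f 0 * g i * h0
    have e0 := congr((C $h0 : MvPolynomial (Fin 3) S))
    have e1 := congr((C $(hl 1 (by decide)) : MvPolynomial (Fin 3) S))
    have e2 := congr((C $(hl 2 (by decide)) : MvPolynomial (Fin 3) S))
    simp only [C_mul, C_pow, map_natCast] at e0 e1 e2
    obtain ⟨d, rfl⟩ : ∃ d, n = M + d := ⟨n - M, by omega⟩
    rw [show M + d + 1 - (M + 1) = d by omega]
    push_cast at e1 e2 ⊢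
    simp only [mul_pow, pow_add, pow_one] at e0 e1 e2 ⊢
    linear_combination X 0 ^ M * X 0 ^ d * X 0 * e0 + X 0 ^ M * X 0 ^ d * X 1 * e1 +
      X 0 ^ M * X 0 ^ d * X 2 * e2

end CharZero

/-- At the points `e_i`, `i ≠ 0`, the right side vanishes because `n - M > 0`, so `f` would be a
multiple of `X 0`. After cancelling `X 0 ^ (n - M)`, the left side still vanishes at `e_s` because
`M > 0`, but the right side does not. -/
lemma linForm_pow_ne {S : Type*} [CommRing S] [IsDomain S] {n M : ℕ} (hM : 0 < M) (hMn : M < n)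
    {c ρ : S} {f g : Fin 3 → S} (hρ : ρ ≠ 0) {s : Fin 3} (hs : s ≠ 0) (hgs : g s ≠ 0) :
    C c * linForm f ^ n ≠ C ρ * linForm g ^ M * X 0 ^ (n - M) := by
  intro h
  have hX : ∀ i ≠ 0, eval (Pi.single i 1 : Fin 3 → S) (X 0) = 0 := fun i hi ↦ by simp [hi.symm]
  have hg : linForm g ≠ 0 := by
    intro h'
    have := congr(eval (Pi.single s 1) $h')
    rw [eval_single_linForm, map_zero] at this
    exact hgs this
  have hc : c ≠ 0 := by
    rintro rfl
    rw [C_0, zero_mul, eq_comm] at h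
    exact mul_ne_zero (mul_ne_zero (by simpa using hρ) (pow_ne_zero _ hg))
      (pow_ne_zero _ (X_ne_zero 0)) h
  have hf : ∀ i ≠ 0, f i = 0 := by
    intro i hi
    have := congr(eval (Pi.single i 1) $h)
    simp only [map_mul, map_pow, eval_C, eval_single_linForm, hX i hi] at this
    rw [zero_pow (by omega), mul_zero] at this
    exact pow_eq_zero_iff (by omega) |>.mp ((mul_eq_zero.mp this).resolve_left hc)
  have h1 : linForm f = C (f 0) * X 0 := by
    rw [linForm, Fin.sum_univ_three, hf 1 (by decide), hf 2 (by decide)]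
    simp
  have h2 : C c * C (f 0) ^ n * X 0 ^ M = C ρ * linForm g ^ M := by
    have h3 : (X 0 ^ n : MvPolynomial (Fin 3) S) = X 0 ^ M * X 0 ^ (n - M) := by
      rw [← pow_add]; congr 1; omega
    rw [h1, mul_pow, h3, ← mul_assoc, ← mul_assoc] at h
    exact mul_right_cancel₀ (pow_ne_zero _ (X_ne_zero 0)) h
  have := congr(eval (Pi.single s 1) $h2)
  simp only [map_mul, map_pow, eval_C, eval_single_linForm, hX s hs] at this
  rw [zero_pow (by omega), mul_zero, eq_comm] at this
  exact mul_ne_zero hρ (pow_ne_zero _ hgs) this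

end Content

/-! ## The base locus in a toric chart -/

section ChartContent

open MvPolynomial hiding comap_comp comap_id algebraMap_apply

variable {k : Type u} [Field k]

lemma map_composeMatrix_cuspidalForm {R : Type*} [CommRing R] (n m : ℕ) (α : k)
    (Φ : MvPolynomial (Fin 3 × Fin 3) k →+* R) :
    map Φ (composeMatrix (cuspidalForm n m α)) =
      linForm (fun j ↦ Φ (X (0, j))) ^ n - C (Φ (C α)) * linForm (fun j ↦ Φ (X (1, j))) ^ m *
        linForm (fun j ↦ Φ (X (2, j))) ^ (n - m) := by
  simp only [composeMatrix, cuspidalForm, map_sub, map_mul, map_pow, aeval_X, aeval_C,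
    MvPolynomial.algebraMap_apply, algebraMap_eq, map_C, map_sum, map_X, linForm]

lemma span_range_orbitCoeff {R : Type*} [CommRing R] {n m : ℕ} (hmn : m < n) (α : k)
    (Φ : MvPolynomial (Fin 3 × Fin 3) k →+* R) :
    Ideal.span (Set.range fun a : Exponent n ↦ Φ (orbitCoeff (cuspidalForm n m α) a.1)) =
      coeffIdeal (map Φ (composeMatrix (cuspidalForm n m α))) := by
  have hh : (map Φ (composeMatrix (cuspidalForm n m α))).IsHomogeneous n := by
    rw [map_composeMatrix_cuspidalForm]
    refine IsHomogeneous.sub (by simpa using (linForm_isHomogeneous _).pow n) ?_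
    have := ((isHomogeneous_C (Fin 3) (Φ (C α))).mul
      ((linForm_isHomogeneous fun j ↦ Φ (X (1, j))).pow m)).mul
      ((linForm_isHomogeneous fun j ↦ Φ (X (2, j))).pow (n - m))
    rwa [zero_add, one_mul, one_mul, Nat.add_sub_cancel' hmn.le] at this
  refine le_antisymm (Ideal.span_mono ?_) (Ideal.span_le.mpr ?_)
  · rintro _ ⟨a, rfl⟩
    exact ⟨a.1, coeff_map _ _ _⟩
  · rintro _ ⟨a, rfl⟩
    by_cases ha : a.degree = n
    · exact Ideal.subset_span ⟨⟨a, ha⟩, (coeff_map _ _ _).symm⟩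
    · dsimp only
      rw [hh.coeff_eq_zero ha]
      exact zero_mem _

/-- The form with equation `f ^ n = α g ^ M x ^ (n - M)`, where `f` and `g` are generic linear
forms. -/
def genericForm (k : Type u) [Field k] (n M : ℕ) (α : k) :
    MvPolynomial (Fin 3) (MvPolynomial Coord k) :=
  linForm (fun j ↦ X (.inl (0, j))) ^ n - C (C α) * linForm (fun j ↦ X (.inl (1, j))) ^ M *
    X 0 ^ (n - M)

/-- The change of variables that makes the normalized row a coordinate. -/
def rowShear (k : Type u) [Field k] (c : k) :
    MvPolynomial (Fin 3) (MvPolynomial Coord k) →ₐ[MvPolynomial Coord k]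
      MvPolynomial (Fin 3) (MvPolynomial Coord k) :=
  aeval ![X 0 + C (C c) * (C (X (.inr 0)) * X 1 + C (X (.inr 1)) * X 2), X 1, X 2]

lemma rowShear_comp (c : k) : (rowShear k (-c)).comp (rowShear k c) = AlgHom.id _ _ := by
  ext1 i
  fin_cases i
  · simp [rowShear]; ring
  · simp [rowShear]
  · simp [rowShear]

lemma rowShear_X_zero : rowShear k 1 (X 0) = linForm (unitRow k) := by
  simp [rowShear, linForm, Fin.sum_univ_three, unitRow, add_assoc]

lemma rowShear_linForm (ρ : Fin 2) :
    rowShear k 1 (linForm fun j ↦ X (.inl (ρ, j))) = linForm (otherRow k ρ) := by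
  have : ∀ f : Fin 3 → MvPolynomial Coord k, rowShear k 1 (linForm f) =
      ∑ j, C (f j) * rowShear k 1 (X j) := fun f ↦ by
    simp [linForm]
  rw [this]
  simp [rowShear, linForm, Fin.sum_univ_three, unitRow, otherRow]
  ring

lemma linForm_comp_swap {S : Type*} [CommRing S] (f : Fin 3 → S) (i₀ : Fin 3) :
    linForm (fun j ↦ f (Equiv.swap 0 i₀ j)) = rename (Equiv.swap 0 i₀) (linForm f) := by
  rw [linForm, ← Equiv.sum_comp (Equiv.swap 0 i₀)]
  simp [linForm]

/-- Permuting the coordinates of the plane and shearing them so that the normalized row becomes `X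
0` does not affect the coefficient ideal. The remaining nonzero row index `q` carries the exponent
`M`. -/
lemma coeffIdeal_matrixCoord {n m M : ℕ} (hmn : m < n) (α : k) {q r : Fin 3}
    (hqr : IsRowPair q r) (hM : M = if q = 1 then m else n - m) (i₀ : Fin 3) :
    coeffIdeal (map (matrixCoord k r i₀) (composeMatrix (cuspidalForm n m α))) =
      coeffIdeal (genericForm k n M α) := by
  have hσ : ((rename (Equiv.swap 0 i₀)).comp (rename (Equiv.swap 0 i₀)) :
      MvPolynomial (Fin 3) (MvPolynomial Coord k) →ₐ[MvPolynomial Coord k] _) =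
      AlgHom.id _ _ := by
    ext1 i; simp
  refine Eq.trans ?_ (coeffIdeal_algHom_eq ((rename (Equiv.swap 0 i₀)).comp (rowShear k 1))
    ((rowShear k (-1)).comp (rename (Equiv.swap 0 i₀))) (by
      rw [AlgHom.comp_assoc, ← AlgHom.comp_assoc _ _ (rowShear k 1), hσ, AlgHom.id_comp,
        rowShear_comp]) _)
  congr 1
  rw [map_composeMatrix_cuspidalForm]
  have hr : linForm (fun j ↦ matrixCoord k r i₀ (X (r, j))) =
      rename (Equiv.swap 0 i₀) (rowShear k 1 (X 0)) := by
    rw [rowShear_X_zero, ← linForm_comp_swap]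
    simp only [matrixCoord_X, if_true]
  have ho : ∀ i ≠ r, linForm (fun j ↦ matrixCoord k r i₀ (X (i, j))) =
      rename (Equiv.swap 0 i₀) (rowShear k 1
        (linForm fun j ↦ X (.inl (if i = 0 then 0 else 1, j)))) := by
    intro i hi
    rw [rowShear_linForm, ← linForm_comp_swap]
    simp only [matrixCoord_X, if_neg hi]
  have h0 := ho 0 hqr.ne_zero_right.symm
  have hq := ho q hqr.ne
  rw [if_pos rfl] at h0
  rw [if_neg hqr.ne_zero_left] at hq
  have hC : rowShear k 1 (C (C α)) = C (C α) := (rowShear k 1).commutes _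
  simp only [AlgHom.comp_apply, genericForm, map_sub, map_mul, map_pow, hC, rename_C,
    matrixCoord_C]
  rw [← h0, ← hq, ← hr]
  have hcases : q = 1 ∧ r = 2 ∨ q = 2 ∧ r = 1 := by
    obtain ⟨h1, h2, h3⟩ := hqr
    clear hr ho h0 hq hM
    revert q r; decide
  rcases hcases with ⟨rfl, rfl⟩ | ⟨rfl, rfl⟩
  · rw [hM, if_pos rfl]
  · rw [hM, if_neg (by decide), Nat.sub_sub_self hmn.le]
    ring

lemma map_hom_genericForm (s : ToricChart) (n M : ℕ) (α : k) :
    map (s.hom k : MvPolynomial Coord k →+* MvPolynomial Coord k) (genericForm k n M α) =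
      C (s.factor k 0 ^ n) * linForm (s.entry k 0) ^ n -
        C (C α * s.factor k 1 ^ M) * linForm (s.entry k 1) ^ M * X 0 ^ (n - M) := by
  have h : ∀ r j, s.hom k (X (.inl (r, j))) = s.factor k r * s.entry k r j := fun r j ↦ by
    simp [ToricChart.hom]
  have hC : s.hom k (C α) = C α := (s.hom k).commutes α
  simp only [genericForm, map_sub, map_mul, map_pow, map_C, map_X, map_linForm, RingHom.coe_coe, h,
    linForm_smul, mul_pow, hC]
  ring

end ChartContent

/-! ## The residual ideal in a terminal chart -/

section Residual

open MvPolynomial hiding comap_comp comap_id algebraMap_apply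

section Algebra

variable {k A : Type*} [Field k] [CharZero k] [CommRing A] [Algebra k A] {n M : ℕ} (hM : 0 < M)
  (hMn : M < n) {α : k} (hα : α ≠ 0)

lemma isUnit_natCast_of_algebra (k : Type*) {A : Type*} [Field k] [CharZero k] [CommRing A]
    [Algebra k A] (N : ℕ) (hN : N ≠ 0) : IsUnit (N : A) := by
  rw [← map_natCast (algebraMap k A)]
  exact (IsUnit.mk0 (N : k) (by exact_mod_cast hN)).map _

omit [CharZero k] in
include hα in
lemma algebraMap_mul_eq_iff {x y : A} : algebraMap k A α * x = y ↔ x = algebraMap k A α⁻¹ * y := by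
  have h : algebraMap k A α * algebraMap k A α⁻¹ = 1 := by
    rw [← map_mul, mul_inv_cancel₀ hα, map_one]
  exact ⟨fun e ↦ by linear_combination (-x) * h + algebraMap k A α⁻¹ * e,
    fun e ↦ by linear_combination y * h + algebraMap k A α * e⟩

include hM hMn hα in
-- With `f 0 = 1` the linear relations can be solved for the `g i`, and the vanishing of the
-- products `g i * g j` becomes redundant.
lemma linForm_pow_eq_iff_left {ν : A} {f g : Fin 3 → A} (hf : f 0 = 1) :
    linForm f ^ n = C (algebraMap k A α * ν) * linForm g ^ M * X 0 ^ (n - M) ↔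
      ν * g 0 ^ M = algebraMap k A α⁻¹ ∧ (∀ i ≠ 0, g i = algebraMap k A (n / M) * g 0 * f i) ∧
      ∀ i ≠ 0, ∀ j ≠ 0, f i * f j = 0 := by
  have h := linForm_pow_eq_iff (isUnit_natCast_of_algebra k) hM hMn (c := (1 : A))
    (ρ := algebraMap k A α * ν) (f := f) (g := g) (.inl (by simp [hf]))
  rw [C_1, one_mul] at h
  have hM' : (M : k) ≠ 0 := by exact_mod_cast hM.ne'
  have e0 : 1 * f 0 ^ n = algebraMap k A α * ν * g 0 ^ M ↔ ν * g 0 ^ M = algebraMap k A α⁻¹ := by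
    rw [hf, one_pow, one_mul, mul_assoc, eq_comm, algebraMap_mul_eq_iff hα, mul_one]
  have e1 : ∀ i, n * g 0 * f i = M * f 0 * g i ↔ g i = algebraMap k A (n / M) * g 0 * f i := by
    intro i
    rw [hf, mul_one, eq_comm, ← map_natCast (algebraMap k A) M, algebraMap_mul_eq_iff hM',
      ← map_natCast (algebraMap k A) n, div_eq_inv_mul, map_mul]
    simp only [mul_assoc]
  rw [h, e0]
  simp only [e1]
  refine and_congr_right fun _ ↦ and_congr_right fun h1 ↦ ⟨fun h ↦ h.1, fun h ↦ ⟨h, ?_⟩⟩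
  intro i hi j hj
  rw [h1 i hi, h1 j hj]
  linear_combination (algebraMap k A (n / M) * g 0) ^ 2 * h i hi j hj

include hM hMn hα in
lemma linForm_pow_eq_iff_right {ν : A} {f g : Fin 3 → A} (hg : g 0 = 1) :
    C ν * linForm f ^ n = C (algebraMap k A α) * linForm g ^ M * X 0 ^ (n - M) ↔
      ν * f 0 ^ n = algebraMap k A α ∧ (∀ i ≠ 0, f i = algebraMap k A (M / n) * f 0 * g i) ∧
      ∀ i ≠ 0, ∀ j ≠ 0, g i * g j = 0 := by
  have h := linForm_pow_eq_iff (isUnit_natCast_of_algebra k) hM hMn (c := ν)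
    (ρ := algebraMap k A α) (f := f) (g := g) (.inr (by
      rw [hg, one_pow, mul_one]; exact (IsUnit.mk0 α hα).map _))
  have hn : (n : k) ≠ 0 := by exact_mod_cast (hM.trans hMn).ne'
  have e1 : ∀ i, n * g 0 * f i = M * f 0 * g i ↔ f i = algebraMap k A (M / n) * f 0 * g i := by
    intro i
    rw [hg, mul_one, ← map_natCast (algebraMap k A) n, algebraMap_mul_eq_iff hn,
      ← map_natCast (algebraMap k A) M, div_eq_inv_mul, map_mul]
    simp only [mul_assoc]
  rw [h, hg, one_pow, mul_one]
  rw [hg] at e1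
  simp only [e1]
  refine and_congr_right fun _ ↦ and_congr_right fun h1 ↦ ⟨fun h ↦ h.2, fun h ↦ ⟨?_, h⟩⟩
  intro i hi j hj
  rw [h1 i hi, h1 j hj]
  linear_combination (algebraMap k A (M / n) * f 0) ^ 2 * h i hi j hj

end Algebra

variable {k : Type u} [Field k]

/-- The substitution that adds to the variables of the row `ε.rev`, except for the first one, a
multiple of the variables of the row `ε`. -/
def shear (ε : Fin 2) (a : MvPolynomial Coord k) : MvPolynomial Coord k →ₐ[k] MvPolynomial Coord
    k :=
  aeval fun i ↦ X i + Sum.elim (fun i ↦ if i.1 = ε.rev ∧ i.2 ≠ 0 then a * X (.inl (ε, i.2)) else 0)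
    (fun _ ↦ 0) i

lemma shear_X_rev (ε : Fin 2) (a : MvPolynomial Coord k) {l : Fin 3} (hl : l ≠ 0) :
    shear ε a (X (.inl (ε.rev, l))) = X (.inl (ε.rev, l)) + a * X (.inl (ε, l)) := by
  simp [shear, hl]

lemma shear_X_self (ε : Fin 2) (a : MvPolynomial Coord k) (l : Fin 3) :
    shear ε a (X (.inl (ε, l))) = X (.inl (ε, l)) := by
  simp [shear, (ToricChart.rev_ne ε).symm]

lemma shear_X_head (ε : Fin 2) (a : MvPolynomial Coord k) (r : Fin 2) :
    shear ε a (X (headVar r)) = X (headVar r) := by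
  simp [shear, headVar]

lemma shear_shear (ε : Fin 2) {a a' : MvPolynomial Coord k} (ha : shear ε a a' = a')
    (h : a + a' = 0) : (shear ε a).comp (shear ε a') = AlgHom.id k _ := by
  ext1 i
  rcases i with ⟨r, l⟩ | t
  · by_cases hl : l = 0
    · subst hl
      exact (congrArg _ (shear_X_head ε a' r)).trans (shear_X_head ε a r)
    · obtain rfl | rfl := ToricChart.eq_or_eq_rev ε r
      · rw [AlgHom.comp_apply, shear_X_self, shear_X_self]; rfl
      · rw [AlgHom.comp_apply, shear_X_rev _ _ hl, map_add, map_mul, shear_X_rev _ _ hl,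
          shear_X_self, ha, AlgHom.id_apply]
        linear_combination X (.inl (ε, l)) * h
  · simp [shear]

/-- The shear, as an isomorphism. -/
def shearEquiv (ε : Fin 2) (a : MvPolynomial Coord k) (ha : ∀ a', shear ε a' a = a) :
    MvPolynomial Coord k ≃ₐ[k] MvPolynomial Coord k :=
  AlgEquiv.ofAlgHom (shear ε a) (shear ε (-a)) (shear_shear ε (by rw [map_neg, ha]) (by simp))
    (shear_shear ε (ha _) (by simp))

lemma residualIdeal_le_iff {p q : ℕ} {γ : k} {ε : Fin 2} {I : Ideal (MvPolynomial Coord k)} :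
    residualIdeal p q γ ε ≤ I ↔ torusEq (headVar 0) (headVar 1) p q γ ∈ I ∧
      (∀ l ≠ 0, X (.inl (ε.rev, l)) ∈ I) ∧
      ∀ i ≠ 0, ∀ j ≠ 0, X (.inl (ε, i)) * X (.inl (ε, j)) ∈ I := by
  have htail : ∀ {r : Fin 2} {P : Coord → Prop},
      (∀ i ∈ tailVars r, P i) ↔ ∀ l ≠ 0, P (.inl (r, l)) := by
    intro r P
    refine ⟨fun h l hl ↦ h _ (mem_tailVars.mpr ⟨rfl, hl⟩), fun h i hi ↦ ?_⟩
    rcases hi with rfl | rfl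
    · exact h 1 (by decide)
    · exact h 2 (by decide)
  rw [residualIdeal, thickIdeal, torusIdeal_eq_sup, sup_le_iff, sup_le_iff,
    Ideal.span_singleton_le_iff_mem, and_assoc, coordIdeal, Ideal.span_le, pow_two,
    Ideal.span_mul_span', Ideal.span_le, Set.mul_subset_iff, Set.image_subset_iff]
  refine and_congr_right fun _ ↦ and_congr htail ?_
  simp only [Set.forall_mem_image]
  rw [htail]
  exact forall_congr' fun i ↦ forall_congr' fun _ ↦ htail

lemma map_residualIdeal_shear {p q : ℕ} {γ : k} {ε : Fin 2} {a : MvPolynomial Coord k}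
    {I : Ideal (MvPolynomial Coord k)} :
    (residualIdeal p q γ ε).map (shear ε (-a)) ≤ I ↔ torusEq (headVar 0) (headVar 1) p q γ ∈ I ∧
      (∀ l ≠ 0, X (.inl (ε.rev, l)) - a * X (.inl (ε, l)) ∈ I) ∧
      ∀ i ≠ 0, ∀ j ≠ 0, X (.inl (ε, i)) * X (.inl (ε, j)) ∈ I := by
  rw [Ideal.map_le_iff_le_comap, residualIdeal_le_iff]
  refine and_congr ?_ (and_congr ?_ ?_)
  · have h : shear ε (-a) (C γ) = C γ := (shear ε (-a)).commutes γ
    rw [Ideal.mem_comap, torusEq, map_sub, map_mul, map_pow, map_pow, shear_X_head, shear_X_head, h]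
  · refine forall_congr' fun l ↦ forall_congr' fun hl ↦ ?_
    rw [Ideal.mem_comap, shear_X_rev _ _ hl, neg_mul, sub_eq_add_neg]
  · refine forall_congr' fun i ↦ forall_congr' fun _ ↦ forall_congr' fun j ↦ forall_congr' fun _ ↦
      ?_
    rw [Ideal.mem_comap, map_mul, shear_X_self, shear_X_self]

/-- The form defining the base locus in a terminal chart, up to a monomial. -/
def residualForm (s : ToricChart) (n M : ℕ) (α : k) (ε : Fin 2) (ν : MvPolynomial Coord k) :
    MvPolynomial (Fin 3) (MvPolynomial Coord k) :=
  if ε = 0 then linForm (s.entry k 0) ^ n -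
    C (algebraMap k _ α * ν) * linForm (s.entry k 1) ^ M * X 0 ^ (n - M)
  else C ν * linForm (s.entry k 0) ^ n -
    C (algebraMap k _ α) * linForm (s.entry k 1) ^ M * X 0 ^ (n - M)

lemma algebraMap_quotient (I : Ideal (MvPolynomial Coord k)) (c : k) :
    Ideal.Quotient.mk I (algebraMap k _ c) = algebraMap k _ c := rfl

/-- Membership conditions in `I` are equalities in the quotient by `I`, where the criterion for
powers of linear forms applies. The constants `γ` and `κ` are `α⁻¹` and `n / M` for `ε = 0`, and `α`
and `M / n` for `ε = 1`. -/
lemma coeffIdeal_residualForm_le_iff [CharZero k] {s : ToricChart} {n M : ℕ} (hM : 0 < M)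
    (hMn : M < n) {α : k} (hα : α ≠ 0) {ε : Fin 2} (hε : s.o ε = some 0) (ν : MvPolynomial Coord k)
        :
    ∃ (γ κ : k), γ ≠ 0 ∧ ∀ I, coeffIdeal (residualForm s n M α ε ν) ≤ I ↔
      ν * s.entry k ε.rev 0 ^ (if ε = 0 then M else n) - C γ ∈ I ∧
      (∀ l ≠ 0, s.entry k ε.rev l - C κ * s.entry k ε.rev 0 * s.entry k ε l ∈ I) ∧
      ∀ i ≠ 0, ∀ j ≠ 0, s.entry k ε i * s.entry k ε j ∈ I := by
  have hone : s.entry k ε 0 = 1 := if_pos hε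
  have hmem : ∀ {I : Ideal (MvPolynomial Coord k)} {x y}, x - y ∈ I ↔
      Ideal.Quotient.mk I x = Ideal.Quotient.mk I y := fun {I x y} ↦ Ideal.Quotient.eq.symm
  have hmem0 : ∀ {I : Ideal (MvPolynomial Coord k)} {x}, x ∈ I ↔
      Ideal.Quotient.mk I x = 0 := fun {I x} ↦ Ideal.Quotient.eq_zero_iff_mem.symm
  have hC : ∀ c : k, (C c : MvPolynomial Coord k) = algebraMap k _ c := fun _ ↦ rfl
  obtain rfl | rfl : ε = 0 ∨ ε = 1 := by fin_cases ε <;> simp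
  · refine ⟨α⁻¹, n / M, inv_ne_zero hα, fun I ↦ ?_⟩
    have := linForm_pow_eq_iff_left hM hMn hα (ν := Ideal.Quotient.mk I ν)
      (f := fun j ↦ Ideal.Quotient.mk I (s.entry k 0 j))
      (g := fun j ↦ Ideal.Quotient.mk I (s.entry k 1 j)) (by rw [hone, map_one])
    rw [coeffIdeal_le_iff, residualForm, if_pos rfl, map_sub, sub_eq_zero]
    simp only [map_mul, map_pow, map_linForm, map_C, map_X, algebraMap_quotient, hmem, hC, if_true]
    rw [← map_mul, this]
    simp only [hmem0, map_mul]
    exact Iff.rfl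
  · refine ⟨α, M / n, hα, fun I ↦ ?_⟩
    have := linForm_pow_eq_iff_right hM hMn hα (ν := Ideal.Quotient.mk I ν)
      (f := fun j ↦ Ideal.Quotient.mk I (s.entry k 0 j))
      (g := fun j ↦ Ideal.Quotient.mk I (s.entry k 1 j)) (by rw [hone, map_one])
    rw [coeffIdeal_le_iff, residualForm, if_neg (by decide), map_sub, sub_eq_zero]
    simp only [map_mul, map_pow, map_linForm, map_C, map_X, algebraMap_quotient, hmem, hC]
    rw [this]
    simp only [hmem0, map_mul]
    exact Iff.rfl

/-- Over a residue field the form cannot vanish: for `ε = 0` its value at `e_t` is `1`, and for `ε =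
1` this is `linForm_pow_ne`. -/
lemma coeffIdeal_residualForm_eq_top {s : ToricChart} {n M : ℕ} (hM : 0 < M)
    (hMn : M < n) {α : k} (hα : α ≠ 0) {ε : Fin 2} {t : Fin 3} (hε : s.o ε = some t) (ht : t ≠ 0)
    (ν : MvPolynomial Coord k) : coeffIdeal (residualForm s n M α ε ν) = ⊤ := by
  by_contra h
  obtain ⟨I, hI, hle⟩ := Ideal.exists_le_maximal _ h
  have hone : s.entry k ε t = 1 := if_pos hε
  rw [coeffIdeal_le_iff, residualForm] at hle
  obtain rfl | rfl : ε = 0 ∨ ε = 1 := by fin_cases ε <;> simp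
  · rw [if_pos rfl] at hle
    have := congr(eval (Pi.single t 1) $hle)
    have hX : eval (Pi.single t 1 : Fin 3 → MvPolynomial Coord k ⧸ I) (X 0) = 0 := by
      simp [ht.symm]
    simp only [map_sub, map_mul, map_pow, map_linForm, map_X, eval_single_linForm, hX, hone,
      map_one, one_pow, map_zero, zero_pow (Nat.sub_pos_of_lt hMn).ne', mul_zero, sub_zero] at this
    exact one_ne_zero this
  · rw [if_neg (by decide), map_sub, sub_eq_zero] at hle
    simp only [map_mul, map_pow, map_linForm, map_X, map_C] at hle
    refine linForm_pow_ne hM hMn ?_ ht ?_ hle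
    · rw [algebraMap_quotient]
      exact ((IsUnit.mk0 α hα).map (algebraMap k _)).ne_zero
    · rw [hone, map_one]; exact one_ne_zero

variable [CharZero k]

/-- The relations express the tail of the row `ε.rev` as a multiple of that of the row `ε`; a shear
of the chart absorbs this multiple and leaves the standard residual ideal. -/
lemma exists_coeffIdeal_residualForm {s : ToricChart} {n M : ℕ} (hM : 0 < M) (hMn : M < n)
    {α : k} (hα : α ≠ 0) {ε : Fin 2} (hε : s.o ε ≠ none) {D : Fin 2 → ℕ}
    (hD : s.o ε.rev = none → D ε.rev = if ε = 0 then M else n) :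
    coeffIdeal (residualForm s n M α ε (s.var k 0 ^ D 0 * s.var k 1 ^ D 1)) = ⊤ ∨
      ∃ (γ : k) (θ : MvPolynomial Coord k ≃ₐ[k] MvPolynomial Coord k), γ ≠ 0 ∧
        (coeffIdeal (residualForm s n M α ε (s.var k 0 ^ D 0 * s.var k 1 ^ D 1))).map θ =
          residualIdeal (D 0) (D 1) γ ε := by
  obtain ⟨t, ht⟩ := Option.ne_none_iff_exists'.mp hε
  by_cases ht0 : t ≠ 0
  · exact .inl (coeffIdeal_residualForm_eq_top hM hMn hα ht ht0 _)
  rw [not_not] at ht0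
  subst ht0
  obtain ⟨γ, κ, hγ, h⟩ := coeffIdeal_residualForm_le_iff hM hMn hα ht
    (s.var k 0 ^ D 0 * s.var k 1 ^ D 1)
  have hent : ∀ l ≠ 0, s.entry k ε l = X (.inl (ε, l)) := fun l hl ↦ by
    rw [ToricChart.entry, ht, if_neg (by simpa using hl.symm)]
  -- If the other row has its entry `1` outside of the first place, one relation says that `1` is a
  -- multiple of an element whose square lies in the ideal; so the ideal is the unit ideal.
  by_cases hrev : ∃ t ≠ 0, s.o ε.rev = some t
  · obtain ⟨t, ht0, ht'⟩ := hrev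
    refine .inl (Ideal.eq_top_iff_one _ |>.mpr ?_)
    obtain ⟨-, h2, h3⟩ := (h _).mp le_rfl
    have h4 := h2 t ht0
    have h5 := h3 t ht0 t ht0
    rw [show s.entry k ε.rev t = 1 from if_pos ht'] at h4
    have h6 := add_mem (Ideal.mul_mem_right (1 + C κ * s.entry k ε.rev 0 * s.entry k ε t) _ h4)
      (Ideal.mul_mem_left _ ((C κ * s.entry k ε.rev 0) ^ 2) h5)
    ring_nf at h6
    exact h6
  have hent' : ∀ l ≠ 0, s.entry k ε.rev l = X (.inl (ε.rev, l)) := fun l hl ↦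
    if_neg fun h ↦ hrev ⟨l, hl, h⟩
  have hvar : s.var k ε = X (headVar ε) := by rw [ToricChart.var, ht]; rfl
  -- Either the other row is untouched and its first entry supplies the power `D ε.rev`, or that
  -- entry is `1` and the monomial supplies it. The equation is the same in both cases.
  have hb : (s.entry k ε.rev 0 = 1 ∨ s.entry k ε.rev 0 = X (headVar ε.rev)) ∧
      s.var k ε.rev ^ D ε.rev * s.entry k ε.rev 0 ^ (if ε = 0 then M else n) =
        X (headVar ε.rev) ^ D ε.rev := by
    rcases hr : s.o ε.rev with _ | t
    · have h1 : s.entry k ε.rev 0 = X (headVar ε.rev) := by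
        rw [ToricChart.entry, hr, if_neg (by simp)]; rfl
      refine ⟨.inr h1, ?_⟩
      rw [h1, hD hr, ToricChart.var, hr, Option.elim_none, one_pow, one_mul]
    · obtain rfl : t = 0 := by_contra fun ht ↦ hrev ⟨t, ht, hr⟩
      have h1 : s.entry k ε.rev 0 = 1 := if_pos hr
      refine ⟨.inl h1, ?_⟩
      rw [h1, ToricChart.var, hr, one_pow, mul_one]
      rfl
  have heq : s.var k 0 ^ D 0 * s.var k 1 ^ D 1 * s.entry k ε.rev 0 ^ (if ε = 0 then M else n) -
      C γ = torusEq (headVar 0) (headVar 1) (D 0) (D 1) γ := by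
    have h2 := hb.2
    rw [torusEq]
    clear h hD hent hent' hb hrev hε ht
    obtain rfl | rfl : ε = 0 ∨ ε = 1 := by fin_cases ε <;> simp
    · rw [hvar, mul_assoc]
      exact congrArg (fun z ↦ X (headVar 0) ^ D 0 * z - C γ) h2
    · rw [hvar, mul_right_comm]
      exact congrArg (fun z ↦ z * X (headVar 1) ^ D 1 - C γ) h2
  have ha : ∀ a', shear ε a' (C κ * s.entry k ε.rev 0) = C κ * s.entry k ε.rev 0 := by
    intro a'
    have hC : shear ε a' (C κ) = C κ := (shear ε a').commutes κ
    rw [map_mul, hC]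
    rcases hb.1 with h1 | h1
    · rw [h1, map_one]
    · rw [h1, shear_X_head]
  have hI : coeffIdeal (residualForm s n M α ε (s.var k 0 ^ D 0 * s.var k 1 ^ D 1)) =
      (residualIdeal (D 0) (D 1) γ ε).map (shear ε (-(C κ * s.entry k ε.rev 0))) := by
    refine eq_of_forall_ge_iff fun I ↦ ?_
    rw [h I, map_residualIdeal_shear, heq]
    refine and_congr_right fun _ ↦ and_congr ?_ ?_
    · refine forall_congr' fun l ↦ forall_congr' fun hl ↦ ?_
      rw [hent l hl, hent' l hl]
    · refine forall_congr' fun i ↦ forall_congr' fun hi ↦ forall_congr' fun j ↦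
        forall_congr' fun hj ↦ ?_
      rw [hent i hi, hent j hj]
  refine .inr ⟨γ, shearEquiv ε _ ha, hγ, ?_⟩
  rw [hI]
  have hcomp : (shear ε (C κ * s.entry k ε.rev 0)).comp (shear ε (-(C κ * s.entry k ε.rev 0))) =
      AlgHom.id k _ := shear_shear ε (by rw [map_neg, ha]) (by simp)
  refine (Ideal.map_mapₐ (shear ε (-(C κ * s.entry k ε.rev 0)))
    (shear ε (C κ * s.entry k ε.rev 0))).trans ?_
  rw [hcomp]
  exact Ideal.map_id _

/-- In a terminal chart, the base locus is the product of a principal ideal and, up to an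
automorphism, of a residual ideal. -/
lemma exists_residualIdeal {s : ToricChart} {n M : ℕ} (hs : s.IsTerminal n M) (hM : 0 < M)
    (hMn : M < n) {α : k} (hα : α ≠ 0) :
    (∃ μ : MvPolynomial Coord k, μ ≠ 0 ∧ coeffIdeal (map (s.hom k : MvPolynomial Coord k →+*
        MvPolynomial Coord k) (genericForm k n M α)) = Ideal.span {μ}) ∨
      ∃ (ε : Fin 2) (p q : ℕ) (γ : k) (μ : MvPolynomial Coord k)
        (θ : MvPolynomial Coord k ≃ₐ[k] MvPolynomial Coord k), (p ≠ 0 ∨ q ≠ 0) ∧ γ ≠ 0 ∧ μ ≠ 0 ∧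
        (coeffIdeal (map (s.hom k : MvPolynomial Coord k →+*
          MvPolynomial Coord k) (genericForm k n M α))).map θ =
            Ideal.span {μ} * residualIdeal p q γ ε := by
  obtain ⟨ε, hε, hdeg⟩ := hs
  have hvar : ∀ c, s.var k c ≠ 0 := fun c ↦ by
    rw [ToricChart.var]
    cases s.o c
    · exact one_ne_zero
    · exact X_ne_zero _
  have hfac : ∀ r, s.factor k r ≠ 0 := fun r ↦
    mul_ne_zero (pow_ne_zero _ (hvar 0)) (pow_ne_zero _ (hvar 1))
  have hex : ∀ c, ∃ d : ℕ, (d : ℤ) = -(ToricChart.sgn ε * s.deg n M c) := fun c ↦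
    ⟨_, Int.toNat_of_nonneg (by linarith [hdeg c])⟩
  choose D hD using hex
  have hdet := s.det
  obtain ⟨hmul, hrev, hpq⟩ : map (s.hom k : MvPolynomial Coord k →+* MvPolynomial Coord k)
      (genericForm k n M α) = C (s.factor k ε ^ (if ε = 0 then n else M)) *
        residualForm s n M α ε (s.var k 0 ^ D 0 * s.var k 1 ^ D 1) ∧
      (s.o ε.rev = none → D ε.rev = if ε = 0 then M else n) ∧ (D 0 ≠ 0 ∨ D 1 ≠ 0) := by
    -- If all differences vanished, `n` times the determinant `1` of the exponents would be zero.
    have hnonzero : (∀ c, n * s.e 0 c = M * s.e 1 c) → False := by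
      intro h
      have : (n : ℤ) = 0 := by
        zify at hdet h
        linear_combination (-n : ℤ) * hdet + (s.e 1 1 : ℤ) * h 0 - (s.e 1 0 : ℤ) * h 1
      omega
    rw [map_hom_genericForm]
    have hself := s.self_of_none ε.rev
    have hrev := s.rev_of_none ε.rev
    obtain rfl | rfl : ε = 0 ∨ ε = 1 := by clear hself hrev hD hdeg hε; fin_cases ε <;> simp
    · have he : ∀ c, s.e 1 c * M = s.e 0 c * n + D c := fun c ↦ by
        have := hD c
        simp only [ToricChart.sgn, ToricChart.deg, if_true] at this
        zify; linear_combination -this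
      refine ⟨?_, fun h ↦ ?_, ?_⟩
      · have hfac : s.factor k 1 ^ M = s.factor k 0 ^ n * (s.var k 0 ^ D 0 * s.var k 1 ^ D 1) := by
          simp only [ToricChart.factor, mul_pow, ← pow_mul, he, pow_add]
          ring
        simp only [residualForm, if_true, hfac, MvPolynomial.algebraMap_eq, C_mul, C_pow]
        ring
      · have h1 := he 1
        have h2 : s.e 1 1 = 1 := hself h
        have h3 : s.e 0 1 = 0 := hrev h
        rw [h2, h3] at h1
        simpa using h1.symm
      · by_contra! h
        refine hnonzero fun c ↦ ?_
        have := he c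
        rw [show D c = 0 by fin_cases c; exacts [h.1, h.2]] at this
        linarith
    · have he : ∀ c, s.e 0 c * n = s.e 1 c * M + D c := fun c ↦ by
        have := hD c
        simp only [ToricChart.sgn, ToricChart.deg, if_neg one_ne_zero] at this
        zify; linear_combination -this
      refine ⟨?_, fun h ↦ ?_, ?_⟩
      · have hfac : s.factor k 0 ^ n = s.factor k 1 ^ M * (s.var k 0 ^ D 0 * s.var k 1 ^ D 1) := by
          simp only [ToricChart.factor, mul_pow, ← pow_mul, he, pow_add]
          ring
        simp only [residualForm, if_neg one_ne_zero, hfac, MvPolynomial.algebraMap_eq, C_mul, C_pow]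
        ring
      · have h1 := he 0
        have h2 : s.e 0 0 = 1 := hself h
        have h3 : s.e 1 0 = 0 := hrev h
        rw [h2, h3] at h1
        simpa using h1.symm
      · by_contra! h
        refine hnonzero fun c ↦ ?_
        have := he c
        rw [show D c = 0 by fin_cases c; exacts [h.1, h.2]] at this
        linarith
  have hμ : s.factor k ε ^ (if ε = 0 then n else M) ≠ 0 := pow_ne_zero _ (hfac ε)
  rw [hmul, coeffIdeal_C_mul]
  rcases exists_coeffIdeal_residualForm hM hMn hα hε hrev with h | ⟨γ, θ, hγ, h⟩
  · exact .inl ⟨_, hμ, by rw [h, Ideal.mul_top]⟩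
  · refine .inr ⟨ε, D 0, D 1, γ, θ (s.factor k ε ^ (if ε = 0 then n else M)), θ, hpq, hγ,
      (map_ne_zero_iff θ θ.injective).mpr hμ, ?_⟩
    rw [Ideal.map_mul, h, Ideal.map_span, Set.image_singleton]

end Residual

/-! ## Resolution of the indeterminacies -/

section Resolution

open MvPolynomial hiding comap_comp comap_id algebraMap_apply

variable {k : Type u} [Field k]

lemma toProj_structureMap {ι : Type} {R : CommRingCat.{u}} (φ : MvPolynomial ι k →+* R)
    {f : MvPolynomial ι k} {d : ℕ} (hf : f ∈ homogeneousSubmodule ι k d) (hd : 0 < d)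
    (hu : IsUnit (φ f)) : toProj φ hf hd hu ≫ ProjectiveSpace.structureMap k ι =
      Spec.map (CommRingCat.ofHom (φ.comp C)) := by
  rw [toProj, ProjectiveSpace.structureMap, Category.assoc, Proj.awayι_toSpecZero_assoc,
    ← Spec.map_comp, ← Spec.map_comp]
  congr 1
  ext c
  change evalAway φ hu (HomogeneousLocalization.fromZeroRingHom _ _ (algebraMap k _ c)) = φ (C c)
  rw [evalAway, RingHom.comp_apply]
  exact IsLocalization.Away.lift_eq f hu (C c)

/-- The ideal sheaf `b` is generated, locally, by the coefficients of `F(φ(x:y:z))`. -/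
def IsBaseIdeal (F : MvPolynomial (Fin 3) k) (d : ℕ) (b : (MatrixSpace k).IdealSheafData) : Prop :=
  ∀ {R : CommRingCat.{u}} (φ : MvPolynomial (Fin 3 × Fin 3) k →+* R) (i : Fin 3 × Fin 3)
    (hu : IsUnit (φ (X i))), b.comap (toProj φ (X_mem_homogeneousSubmodule i) one_pos hu) =
      idl (Ideal.span (Set.range fun a : Exponent d ↦ φ (orbitCoeff F a.1)))

variable {n m : ℕ} (hm : 0 < m) (hmn : m < n) {α : k} (hα : α ≠ 0)
  {b : (MatrixSpace k).IdealSheafData} (hb : IsBaseIdeal (cuspidalForm n m α) n b)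
  {V : Scheme.{u}} {π : V ⟶ MatrixSpace k}

include hmn hb in
lemma IsBaseIdeal.comap_toProj {R : CommRingCat.{u}} (φ : MvPolynomial (Fin 3 × Fin 3) k →+* R)
    (i : Fin 3 × Fin 3) (hu : IsUnit (φ (X i))) :
    b.comap (toProj φ (X_mem_homogeneousSubmodule i) one_pos hu) =
      idl (coeffIdeal (map φ (composeMatrix (cuspidalForm n m α)))) := by
  rw [hb φ i hu, span_range_orbitCoeff hmn]

include hmn hb in
/-- The base locus does not contain matrices with vanishing row `r` and nonvanishing row `0`. -/
lemma IsBaseIdeal.cartierAt_of_row_eq_zero {x : V} {r i₀ : Fin 3} (hm : 0 < m) (hr : r ≠ 0)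
    (hx : ∀ j, π x ∉ Proj.basicOpen (homogeneousSubmodule (Fin 3 × Fin 3) k) (X (r, j)))
    (hx0 : π x ∈ Proj.basicOpen (homogeneousSubmodule (Fin 3 × Fin 3) k) (X (0, i₀))) :
    CartierAt (b.comap π) x := by
  obtain ⟨A, c, hc, φ, i, hu, ⟨p, rfl⟩, hcπ⟩ := exists_toProj π x
  have hmem : ∀ i, π (c p) ∈ Proj.basicOpen (homogeneousSubmodule (Fin 3 × Fin 3) k) (X i) ↔
      φ (X i) ∉ p.asIdeal := fun i' ↦ by
    rw [← Scheme.Hom.comp_apply, hcπ]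
    exact toProj_mem_basicOpen φ _ one_pos hu (X_mem_homogeneousSubmodule i') one_pos p
  simp only [hmem, not_not] at hx hx0
  refine cartierAt_of_not_le (c := c) (μ := 1) (one_mem _)
    (K := coeffIdeal (map φ (composeMatrix (cuspidalForm n m α)))) ?_ ?_
  · rw [Ideal.span_singleton_one, Ideal.top_mul, ← comap_comp, hcπ]
    exact hb.comap_toProj hmn φ i hu
  · rw [coeffIdeal_le_iff, map_composeMatrix_cuspidalForm]
    intro h
    have hzero : linForm (fun j ↦ Ideal.Quotient.mk p.asIdeal (φ (X (r, j)))) = 0 := by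
      simp only [linForm, Ideal.Quotient.eq_zero_iff_mem.mpr (hx _), C_0, zero_mul,
        Finset.sum_const_zero]
    simp only [map_sub, map_mul, map_pow, map_linForm] at h
    -- One of the two factors contains a positive power of the vanishing row, so modulo the prime of
    -- the point only the `n`-th power of row `0` remains.
    have hprod : linForm (fun j ↦ Ideal.Quotient.mk p.asIdeal (φ (X (1, j)))) ^ m *
        linForm (fun j ↦ Ideal.Quotient.mk p.asIdeal (φ (X (2, j)))) ^ (n - m) = 0 := by
      obtain rfl | rfl : r = 1 ∨ r = 2 := by
        clear h hx hzero; revert r; decide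
      · rw [hzero, zero_pow hm.ne', zero_mul]
      · rw [hzero, zero_pow (by omega), mul_zero]
    rw [mul_assoc, hprod, mul_zero, sub_zero] at h
    have := congr(eval (Pi.single i₀ 1) $h)
    rw [map_pow, eval_single_linForm, map_zero] at this
    rw [← map_pow, Ideal.Quotient.eq_zero_iff_mem] at this
    exact hx0 (p.2.mem_of_pow_mem _ this)

lemma exists_isBaseIdeal (hmn : m < n) (α : k) :
    ∃ b, IsBaseIdeal (cuspidalForm n m α) n b :=
  exists_idealSheaf_of_forms fun a : Exponent n ↦
    orbitCoeff_mem (cuspidalForm_isHomogeneous hmn α) a.1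

/-- Local charts of a sequence of directed blow-ups prescribed by the Euclidean algorithm. -/
lemma exists_terminalChart {q r i₀ : Fin 3} (hqr : IsRowPair q r) {M : ℕ} (hM0 : 0 < M)
    (hMn : M < n) {T W : Scheme.{u}} {ρ : T ⟶ MatrixSpace k} {σ : W ⟶ T}
    (h : IsEuclideanBlowup n M ((vanishingRows k {0, q}).comap ρ) ((vanishingRows k {q}).comap ρ) σ)
    (j : Spec (ChartRing k) ⟶ T) [IsOpenImmersion j] (hj : j ≫ ρ = matrixChart k r i₀) {w : W}
    (hw : σ w ∈ Set.range j) :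
    ∃ (j' : Spec (ChartRing k) ⟶ W) (_ : IsOpenImmersion j') (s : ToricChart),
      w ∈ Set.range j' ∧ s.IsTerminal n M ∧
      j' ≫ σ ≫ ρ = Spec.map (CommRingCat.ofHom (s.hom k).toRingHom) ≫ matrixChart k r i₀ := by
  obtain ⟨h1, h2, -⟩ := vanishingRows_comap_matrixChart (k := k) hqr i₀
  rw [← hj, comap_comp] at h1 h2
  obtain ⟨j', hj', s, hw', ⟨β, hβ, hs⟩, ht⟩ := h.exists_chart hM0 hMn.le j ToricChart.init 0 h1 h2
    (n := n) (m := M) (by simp [ToricChart.deg, ToricChart.init, ToricChart.sgn])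
    (by simp [ToricChart.deg, ToricChart.init, ToricChart.sgn]) hw
  refine ⟨j', hj', s, hw', ht, ?_⟩
  rw [reassoc_of% hβ, hj, ← hs, ToricChart.hom_init]
  rfl

lemma mem_support_vanishingRows {s : Set (Fin 3)} {x : MatrixSpace k} :
    x ∈ (vanishingRows k s).support ↔ ∀ i ∈ s, ∀ j,
      x ∉ Proj.basicOpen (homogeneousSubmodule (Fin 3 × Fin 3) k) (X (i, j)) := by
  rw [vanishingRows, ← SetLike.mem_coe, coe_support_vanishingIdeal]
  constructor
  · intro h i hi j hx
    exact hx (h ⟨i, hi, j, rfl⟩)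
  · rintro h _ ⟨i, hi, j, rfl⟩
    exact not_not.mp (h i hi j)

variable [CharZero k]

include hmn hα hb in
/-- The base locus in a terminal chart. -/
lemma IsBaseIdeal.cartierAt_or_isResidualAt {q r i₀ : Fin 3} (hqr : IsRowPair q r) {M : ℕ}
    (hM : M = if q = 1 then m else n - m) (hM0 : 0 < M) (hMn : M < n)
    {c : Spec (ChartRing k) ⟶ V} [IsOpenImmersion c] {s : ToricChart} (hs : s.IsTerminal n M)
    (hc : c ≫ π = Spec.map (CommRingCat.ofHom (s.hom k).toRingHom) ≫ matrixChart k r i₀) {x : V}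
    (hx : x ∈ Set.range c) : CartierAt (b.comap π) x ∨
      IsResidualAt (b.comap π) (π ≫ ProjectiveSpace.structureMap k _) x := by
  have hJ : (b.comap π).comap c = idl (R := ChartRing k)
      (coeffIdeal (map (s.hom k).toRingHom (genericForm k n M α))) := by
    rw [← comap_comp, hc, comap_comp, matrixChart, hb.comap_toProj hmn]
    refine (comap_idl (R := ChartRing k) (S := ChartRing k) _ _).trans (congrArg _ ?_)
    rw [coeffIdeal_matrixCoord hmn α hqr hM]
    exact map_coeffIdeal _ _
  rcases exists_residualIdeal hs hM0 hMn hα with ⟨μ, hμ, h⟩ | ⟨ε, p, q, γ, μ, θ, hpq, hγ, hμ, h⟩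
  · obtain ⟨y, rfl⟩ := hx
    left
    rw [← cartierAt_comap_iff, hJ]
    have := cartierAt_idl_span (R := ChartRing k) (mem_nonZeroDivisors_of_ne_zero hμ) y
    rw [← h] at this
    exact this
  · right
    let t : ChartRing k ≅ ChartRing k := θ.toRingEquiv.toCommRingCatIso
    have ht : IsIso (Spec.map t.hom) := inferInstance
    refine ⟨Spec.map t.hom ≫ c, inferInstance, ?_, ?_, ε, p, q, γ, μ, hpq, hγ, hμ, ?_⟩
    · obtain ⟨y, rfl⟩ := hx
      refine ⟨inv (Spec.map t.hom) y, ?_⟩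
      rw [← Scheme.Hom.comp_apply, IsIso.inv_hom_id_assoc]
    · rw [Category.assoc, reassoc_of% hc, matrixChart, toProj_structureMap, ← Spec.map_comp,
        ← Spec.map_comp]
      refine congrArg Spec.map (CommRingCat.hom_ext (RingHom.ext fun x ↦ ?_))
      change θ (s.hom k (matrixCoord k r i₀ (C x))) = C x
      rw [matrixCoord_C]
      exact (congrArg θ ((s.hom k).commutes x)).trans (θ.commutes x)
    · rw [comap_comp, hJ]
      refine (comap_idl (R := ChartRing k) (S := ChartRing k) t.hom _).trans (congrArg _ ?_)
      exact h

include hb in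
lemma IsBaseIdeal.twoBlowupsResolve
    (h : ∀ x, CartierAt (b.comap π) x ∨
      IsResidualAt (b.comap π) (π ≫ ProjectiveSpace.structureMap k _) x) :
    TwoBlowupsResolve (cuspidalForm_isHomogeneous hmn α) π := by
  obtain ⟨h1, h2⟩ := isCartier_after_two_blowups h
  refine ⟨_, h1, fun ρ₁ hρ₁ ↦ ⟨_, (h2 ρ₁ hρ₁).1, fun ρ₂ hρ₂ ↦ ?_⟩⟩
  refine exists_isRegularLift (cuspidalForm_isHomogeneous hmn α) (by omega) hb ?_
  rw [comap_comp, comap_comp]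
  exact (h2 ρ₁ hρ₁).2 ρ₂ hρ₂

include hmn hα in
/-- The local statement over one of the two singular points. -/
lemma twoBlowupsResolve_local {q r : Fin 3} (hm : 0 < m) (hqr : IsRowPair q r) {M : ℕ}
    (hM : M = if q = 1 then m else n - m)
    (h : IsEuclideanBlowup n M (vanishingRows k {0, q}) (vanishingRows k {q}) π) :
    TwoBlowupsResolve (cuspidalForm_isHomogeneous hmn α)
      ((π ⁻¹ᵁ (vanishingRows k {0, r}).support.compl).ι ≫ π) := by
  have hM0 : 0 < M := by split_ifs at hM <;> omega
  have hMn : M < n := by split_ifs at hM <;> omega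
  obtain ⟨b, hb⟩ := exists_isBaseIdeal hmn α
  set U := π ⁻¹ᵁ (vanishingRows k {0, r}).support.compl
  refine hb.twoBlowupsResolve hmn fun x ↦ ?_
  have hmem : ∀ v : V, v ∈ U ↔ π v ∉ (vanishingRows k {0, r}).support := fun v ↦ Iff.rfl
  -- If the row `r` does not vanish, the point lies over a matrix chart. If it does, row `0` cannot
  -- vanish, since `U` avoids the locus over the other point.
  by_cases hx : ∃ i₀, π (U.ι x) ∈
      Proj.basicOpen (homogeneousSubmodule (Fin 3 × Fin 3) k) (X (r, i₀))
  · obtain ⟨i₀, hi₀⟩ := hx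
    obtain ⟨hj, hrange⟩ := isOpenImmersion_matrixChart (k := k) hqr i₀
    obtain ⟨j', hj', s, hw, hs, hj'π⟩ := exists_terminalChart (ρ := 𝟙 (MatrixSpace k)) hqr hM0 hMn
      (by rwa [comap_id, comap_id]) (matrixChart k r i₀) (Category.comp_id _)
      ((hrange _).mpr hi₀)
    rw [Category.comp_id] at hj'π
    have hsub : Set.range j' ⊆ Set.range U.ι := by
      rintro _ ⟨y, rfl⟩
      rw [Scheme.Opens.range_ι]
      refine (hmem _).mpr fun hy ↦ ?_
      refine mem_support_vanishingRows.mp hy r (by simp) i₀ ?_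
      rw [← Scheme.Hom.comp_apply, hj'π, Scheme.Hom.comp_apply]
      exact (hrange _).mp ⟨_, rfl⟩
    have hlift : IsOpenImmersion.lift U.ι j' hsub ≫ U.ι = j' := IsOpenImmersion.lift_fac _ _ _
    have hopen : IsOpenImmersion (IsOpenImmersion.lift U.ι j' hsub) := by
      have : IsOpenImmersion (IsOpenImmersion.lift U.ι j' hsub ≫ U.ι) := by rwa [hlift]
      exact IsOpenImmersion.of_comp _ U.ι
    refine hb.cartierAt_or_isResidualAt hmn hα hqr hM hM0 hMn hs
      (c := IsOpenImmersion.lift U.ι j' hsub) (by rw [reassoc_of% hlift, hj'π]) ?_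
    obtain ⟨y, hy⟩ := hw
    refine ⟨y, U.ι.isOpenEmbedding.injective ?_⟩
    rw [← Scheme.Hom.comp_apply, hlift, hy]
  · push Not at hx
    have hx' : π (U.ι x) ∉ (vanishingRows k {0, r}).support := (hmem _).mp x.2
    rw [mem_support_vanishingRows] at hx'
    push Not at hx'
    obtain ⟨i, hi, i₀, hi₀⟩ := hx'
    rcases hi with rfl | rfl
    · exact .inl (hb.cartierAt_of_row_eq_zero hmn hm hqr.ne_zero_right
        (x := x) (π := U.ι ≫ π) (i₀ := i₀) (fun j ↦ by rw [Scheme.Hom.comp_apply]; exact hx j)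
        (by rw [Scheme.Hom.comp_apply]; exact hi₀))
    · exact absurd hi₀ (hx i₀)

include hmn hα in
/-- The global statement. -/
lemma twoBlowupsResolve_global (hm : 0 < m) {W : Scheme.{u}} {σ : W ⟶ V}
    (h : IsEuclideanBlowup n m (vanishingRows k {0, 1}) (vanishingRows k {1}) π)
    (h' : IsEuclideanBlowup n (n - m) ((vanishingRows k {0, 2}).comap π)
      ((vanishingRows k {2}).comap π) σ) :
    TwoBlowupsResolve (cuspidalForm_isHomogeneous hmn α) (σ ≫ π) := by
  have h12 : IsRowPair 1 2 := ⟨by decide, by decide, by decide⟩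
  have h21 : IsRowPair 2 1 := ⟨by decide, by decide, by decide⟩
  obtain ⟨b, hb⟩ := exists_isBaseIdeal hmn α
  refine hb.twoBlowupsResolve hmn fun x ↦ ?_
  by_cases hx2 : ∃ i₀, π (σ x) ∈
      Proj.basicOpen (homogeneousSubmodule (Fin 3 × Fin 3) k) (X (2, i₀))
  · obtain ⟨i₀, hi₀⟩ := hx2
    obtain ⟨hj, hrange⟩ := isOpenImmersion_matrixChart (k := k) h12 i₀
    obtain ⟨j, hj, s, hw, hs, hjπ⟩ := exists_terminalChart (ρ := 𝟙 (MatrixSpace k)) h12 hm hmn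
      (by rwa [comap_id, comap_id]) (matrixChart k 2 i₀) (Category.comp_id _)
      ((hrange _).mpr hi₀)
    rw [Category.comp_id] at hjπ
    -- Row 2 has an entry `1` over this chart, so the blow-ups over the second point leave it
    -- unchanged.
    obtain ⟨j', hj', hfac, hr⟩ := h'.exists_lift j (by
      rw [← comap_comp, hjπ, comap_comp, (vanishingRows_comap_matrixChart h12 i₀).2.2, comap_top])
    exact hb.cartierAt_or_isResidualAt hmn hα h12 (if_pos rfl).symm hm hmn hs
      (by rw [reassoc_of% hfac, hjπ]) (hr x hw)
  by_cases hx1 : ∃ i₀, π (σ x) ∈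
      Proj.basicOpen (homogeneousSubmodule (Fin 3 × Fin 3) k) (X (1, i₀))
  · obtain ⟨i₀, hi₀⟩ := hx1
    obtain ⟨hj, hrange⟩ := isOpenImmersion_matrixChart (k := k) h21 i₀
    -- Symmetrically, where row 1 does not vanish the blow-ups over the first point change nothing,
    -- and those over the second one start from a matrix chart.
    obtain ⟨j, hj, hfac, hr⟩ := h.exists_lift (matrixChart k 1 i₀)
      (vanishingRows_comap_matrixChart h21 i₀).2.2
    obtain ⟨j', hj', s, hw, hs, hjπ⟩ := exists_terminalChart h21 (by omega) (by omega) h' j hfac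
      (hr (σ x) ((hrange _).mpr hi₀))
    exact hb.cartierAt_or_isResidualAt hmn hα h21 (if_neg (by decide)).symm (by omega) (by omega)
      hs hjπ hw
  push Not at hx1 hx2
  obtain ⟨⟨i, i₀⟩, hi⟩ := exists_mem_basicOpen_X (π (σ x))
  obtain rfl | rfl | rfl : i = 0 ∨ i = 1 ∨ i = 2 := by clear hi; revert i; decide
  · exact .inl (hb.cartierAt_of_row_eq_zero hmn hm (r := 1) (by decide) (x := x) (i₀ := i₀)
      (fun j ↦ by rw [Scheme.Hom.comp_apply]; exact hx1 j)
      (by rw [Scheme.Hom.comp_apply]; exact hi))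
  · exact absurd hi (hx1 i₀)
  · exact absurd hi (hx2 i₀)

end Resolution

end

end LinearOrbit

theorem theorem2p4 {k : Type u} [Field k] [IsAlgClosed k] [CharZero k]
    (m n : ℕ) (hm : 1 ≤ m) (hmn : m < n) (hcop : Nat.Coprime m n) (α : k) (hα : α ≠ 0) :
    -- local statement over the cusp `(0:0:1)`, with tangent cone `y = 0`, away from `(0:1:0)`
    (∀ {V : Scheme.{u}} (π : V ⟶ LinearOrbit.MatrixSpace k),
      LinearOrbit.IsEuclideanBlowup n m
        (LinearOrbit.vanishingRows k {0, 1}) (LinearOrbit.vanishingRows k {1}) π →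
      LinearOrbit.TwoBlowupsResolve (LinearOrbit.cuspidalForm_isHomogeneous hmn α)
        ((π ⁻¹ᵁ (LinearOrbit.vanishingRows k {0, 2}).support.compl).ι ≫ π)) ∧
    -- local statement over the cusp `(0:1:0)`, with tangent cone `z = 0`, away from `(0:0:1)`
    (∀ {V : Scheme.{u}} (π : V ⟶ LinearOrbit.MatrixSpace k),
      LinearOrbit.IsEuclideanBlowup n (n - m)
        (LinearOrbit.vanishingRows k {0, 2}) (LinearOrbit.vanishingRows k {2}) π →
      LinearOrbit.TwoBlowupsResolve (LinearOrbit.cuspidalForm_isHomogeneous hmn α)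
        ((π ⁻¹ᵁ (LinearOrbit.vanishingRows k {0, 1}).support.compl).ι ≫ π)) ∧
    -- global statement, after the local blow-ups over both cusps
    (∀ {V V' : Scheme.{u}} (π : V ⟶ LinearOrbit.MatrixSpace k) (π' : V' ⟶ V),
      LinearOrbit.IsEuclideanBlowup n m
        (LinearOrbit.vanishingRows k {0, 1}) (LinearOrbit.vanishingRows k {1}) π →
      LinearOrbit.IsEuclideanBlowup n (n - m)
        ((LinearOrbit.vanishingRows k {0, 2}).comap π)
        ((LinearOrbit.vanishingRows k {2}).comap π) π' →
      LinearOrbit.TwoBlowupsResolve (LinearOrbit.cuspidalForm_isHomogeneous hmn α) (π' ≫ π)) := by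
  refine ⟨fun π h ↦ ?_, fun π h ↦ ?_, fun π π' h h' ↦ ?_⟩
  · exact LinearOrbit.twoBlowupsResolve_local hmn hα hm
      ⟨by decide, by decide, by decide⟩ (if_pos rfl).symm h
  · exact LinearOrbit.twoBlowupsResolve_local hmn hα hm
      ⟨by decide, by decide, by decide⟩ (if_neg (by decide)).symm h
  · exact LinearOrbit.twoBlowupsResolve_global hmn hα hm h h'
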